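/- **Model.** Let $f:[0,1]^3\to[0,1]$ be measurable, $f(x,y,t)=f(y,x,t)$, $\max f=1$. For $\rho\in(0,1)$ and i.i.d. $\mathrm{Uniform}[0,1]$ variables $\xi_1,\dots,\xi_n$ put $P^{(t)}_{ij}=\rho f(\xi_i,\xi_j,t)$, $1\le i,j\le n$, $t\in[0,1]$. At times $t_1,\dots,t_m\in[0,1]$ one observes symmetric 0/1 matrices $A^{(t_1)},\dots,A^{(t_m)}$ whose entries $A^{(t_k)}_{ij}$, $i\le j$, $k\le m$, are, conditionally on $\xi$, independent $\mathrm{Bernoulli}(P^{(t_k)}_{ij})$. **Estimator.** Let $\beta>0$, $\ell=\lfloor\beta\rfloor$, $U(u)=(1,u,\dots,u^\ell)^\top$, let $K:\mathbb R\to\mathbb R$ be a kernel, $h_1,h_2>0$, and $$B_{mt}=\frac1{mh_1}\sum_{k=1}^m U\Bigl(\frac{t_k-t}{h_1}\Bigr)U\Bigl(\frac{t_k-t}{h_1}\Bigr)^{\!\top}K\Bigl(\frac{t_k-t}{h_1}\Bigr),\qquad w_k(t;h_1)=\frac1{mh_1}U(0)^\top B_{mt}^{-1}U\Bigl(\frac{t_k-t}{h_1}\Bigr)K\Bigl(\frac{t_k-t}{h_1}\Bigr).$$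 First stage: $\tilde P^{(t)}_{ij}=\sum_k w_k(t;h_1)A^{(t_k)}_{ij}$. Second stage: with $\tilde d_t(i,i')=\bigl(\max_{l\ne i,i'}|\langle\tilde P^{(t)}_{i\cdot}-\tilde P^{(t)}_{i'\cdot},\tilde P^{(t)}_{l\cdot}\rangle|/n\bigr)^{1/2}$ and $q_{i,t}(h_2)$ the lower $h_2$-quantile of $\{\tilde d_t(i,k)\}_{1\le k\le n}$, let $\mathcal N_i^{(t)}=\{i':\tilde d_t(i,i')\le q_{i,t}(h_2)\}$ if $nh_2>1$ and $\mathcal N_i^{(t)}=\{i\}$ if $nh_2\le1$, and $$\hat P^{(t)}_{ij}=\frac1{|\mathcal N^{(t)}_i|}\sum_{i'\in\mathcal N^{(t)}_i}\tilde P^{(t)}_{i'j},\qquad 1\le i,j\le n.$$ Let $\|B\|_{2,\infty}=\max_i\|B_{i\cdot}\|_2$. **Assumptions.** (1) For all $x,y\in[0,1]$, $t\mapsto f(x,y,t)$ is $\ell$ times differentiable on $[0,1]$ and its $\ell$-th derivative satisfies $|f^{(\ell)}(x,y,t)-f^{(\ell)}(x,y,t')|\le L_1|t-t'|^{\beta-\ell}$,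 where $L_1>0$. (2) There are $\delta>0$ and a partition $0=x_0<\dots<x_J=1$ with all gaps $>\delta$ such that on each $[x_k,x_{k+1})\times[x_l,x_{l+1})$ and for each $t$, $f(\cdot,\cdot,t)$ is Lipschitz in each argument with constant $L_2$. (3) LP1: $\lambda_{\min}(B_{mt})\ge\lambda_0>0$ for all $t\in[0,1]$, at the bandwidth $h_1$ in use. LP2: $\frac1m\#\{k:t_k\in I\}\le a_0\max(|I|,1/m)$ for every interval $I\subseteq[0,1]$. LP3: $K$ vanishes outside $[-1,1]$ and $|K|\le K_{\max}$. **Theorem.** Fix $f,\beta,L_1,L_2$, $K,K_{\max},\lambda_0,a_0$ satisfying these assumptions, and constants $\kappa,c_1,c_2>0$; write $x\asymp y$ for $c_1y\le x\le c_2y$. There are $C,\tilde C,\gamma>0$ and $N_0$, depending only on these data, such that for all $n,m\ge N_0$, all $\rho=\rho_n\in(0,1)$ with $\rho_n\ge\sqrt{\log(nm)/(nm)}$, all time points and bandwidths satisfying LP1–LP2, and every $t\in[0,1]$: (a) if $n\rho_n\ge\kappa\sqrt{n\,m^{\beta/(\beta+1)}\log(nm)}$, $h_1\asymp\bigl(\frac{\log(nm)}{\rho_n^2nm}\bigr)^{1/(2\beta+1)}$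 and $h_2\asymp\rho_n^{1/(2\beta+1)}\bigl(\frac{\log(nm)}{nm}\bigr)^{\beta/(2\beta+1)}$, then with probability at least $1-2(nm)^{-(\tilde C+\gamma)}$ $$\frac1n\|\hat P^{(t)}-P^{(t)}\|_{2,\infty}^2\le C\rho_n^{\frac{2\beta+2}{2\beta+1}}\Bigl(\frac{\log(nm)}{nm}\Bigr)^{\frac{\beta}{2\beta+1}};$$ (b) if $n\rho_n\le\kappa\sqrt{n\,m^{\beta/(\beta+1)}\log(nm)}$, $h_1\asymp\bigl(\frac{\log(nm)}{\rho_nm}\bigr)^{1/(2\beta+1)}$ and $0<h_2\le1/n$, then with probability at least $1-2(nm)^{-(\tilde C+\gamma)}$ one has $\hat P^{(t)}=\tilde P^{(t)}$ and $$\frac1n\|\hat P^{(t)}-P^{(t)}\|_{2,\infty}^2\le C\rho_n^{\frac{2\beta+2}{2\beta+1}}\Bigl(\frac{\log(nm)}{m}\Bigr)^{\frac{2\beta}{2\beta+1}}.$$ -/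

import Mathlib

open MeasureTheory ProbabilityTheory

noncomputable section

/-! ### The model -/

/-- A time-varying graphon: a measurable function `[0,1]³ → [0,1]`, symmetric in its first two
arguments, with maximum `1`. Only the values on the cube matter. -/
structure IsTimeVaryingGraphon (f : ℝ → ℝ → ℝ → ℝ) : Prop where
  measurable : Measurable
    (fun p : unitInterval × unitInterval × unitInterval => f p.1 p.2.1 p.2.2)
  mem_Icc : ∀ x ∈ Set.Icc (0 : ℝ) 1, ∀ y ∈ Set.Icc (0 : ℝ) 1, ∀ t ∈ Set.Icc (0 : ℝ) 1,
    f x y t ∈ Set.Icc (0 : ℝ) 1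
  symm : ∀ x ∈ Set.Icc (0 : ℝ) 1, ∀ y ∈ Set.Icc (0 : ℝ) 1, ∀ t ∈ Set.Icc (0 : ℝ) 1,
    f x y t = f y x t
  max_eq_one : ∃ x ∈ Set.Icc (0 : ℝ) 1, ∃ y ∈ Set.Icc (0 : ℝ) 1, ∃ t ∈ Set.Icc (0 : ℝ) 1,
    f x y t = 1

/-- Temporal Hölder smoothness: with `ℓ = ⌊β⌋`, every `t ↦ f x y t` is `ℓ` times differentiable on
`[0,1]` and its `ℓ`-th derivative is `(β - ℓ)`-Hölder with constant `L₁`. -/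
def HolderInTime (f : ℝ → ℝ → ℝ → ℝ) (β L₁ : ℝ) : Prop :=
  ∀ x ∈ Set.Icc (0 : ℝ) 1, ∀ y ∈ Set.Icc (0 : ℝ) 1,
    (∀ k < ⌊β⌋₊, DifferentiableOn ℝ (iteratedDerivWithin k (f x y) (Set.Icc 0 1))
      (Set.Icc 0 1)) ∧
    ∀ t ∈ Set.Icc (0 : ℝ) 1, ∀ t' ∈ Set.Icc (0 : ℝ) 1,
      |iteratedDerivWithin ⌊β⌋₊ (f x y) (Set.Icc 0 1) t
        - iteratedDerivWithin ⌊β⌋₊ (f x y) (Set.Icc 0 1) t'| ≤ L₁ * |t - t'| ^ (β - ⌊β⌋₊)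

/-- Piecewise Lipschitz continuity in the two latent arguments, with constant `L₂`, on the products
of the cells `[x_k, x_{k+1})` of a partition `0 = x_0 < ⋯ < x_J = 1` of mesh bounded below. -/
def PiecewiseLipschitz (f : ℝ → ℝ → ℝ → ℝ) (L₂ : ℝ) : Prop :=
  ∃ δ > (0 : ℝ), ∃ J ≥ 1, ∃ x : ℕ → ℝ, x 0 = 0 ∧ x J = 1 ∧
    (∀ s < J, δ < x (s + 1) - x s) ∧
    ∀ k < J, ∀ l < J, ∀ t ∈ Set.Icc (0 : ℝ) 1,
      ∀ u ∈ Set.Ico (x k) (x (k + 1)), ∀ u₁ ∈ Set.Ico (x k) (x (k + 1)),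
      ∀ u₂ ∈ Set.Ico (x k) (x (k + 1)),
      ∀ v ∈ Set.Ico (x l) (x (l + 1)), ∀ v₁ ∈ Set.Ico (x l) (x (l + 1)),
      ∀ v₂ ∈ Set.Ico (x l) (x (l + 1)),
        |f u₁ v t - f u₂ v t| ≤ L₂ * |u₁ - u₂| ∧ |f u v₁ t - f u v₂ t| ≤ L₂ * |v₁ - v₂|

/-- The probability matrix `P^{(t)}` at latent positions `x`: `P_ij = ρ f(x_i, x_j, t)`. -/
def probMatrix {n : ℕ} (f : ℝ → ℝ → ℝ → ℝ) (ρ : ℝ) (x : Fin n → ℝ) (t : ℝ) :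
    Matrix (Fin n) (Fin n) ℝ :=
  Matrix.of fun i j => ρ * f (x i) (x j) t

/-- The probability that a Bernoulli(`p`) variable takes the value `b`. -/
def bernoulliWeight (p : ℝ) (b : Bool) : ℝ := if b then p else 1 - p

/-- The observed networks `A k = A^{(τ k)}`, `k < m`, on `n` nodes follow the sparse time-varying
graphon model: the latent positions `ξ i` are i.i.d. uniform on `[0,1]`, the adjacency matrices are
symmetric, and, conditionally on `ξ`, the entries `A k i j` (`k < m`, `i ≤ j`) are independent
Bernoulli variables with success probabilities `P_ij^{(τ k)}`. -/
structure IsSparseGraphonNetwork {Ω : Type*} [MeasurableSpace Ω] (μ : Measure Ω) {n m : ℕ}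
    (f : ℝ → ℝ → ℝ → ℝ) (ρ : ℝ) (τ : Fin m → ℝ) (ξ : Fin n → Ω → ℝ)
    (A : Fin m → Fin n → Fin n → Ω → Bool) : Prop where
  measurable_latent : ∀ i, Measurable (ξ i)
  measurable_adj : ∀ k i j, Measurable (A k i j)
  indep_latent : iIndepFun ξ μ
  uniform_latent : ∀ i, μ.map (ξ i) = volume.restrict (Set.Icc (0 : ℝ) 1)
  symm_adj : ∀ k i j ω, A k i j ω = A k j i ω
  cond_law : ∀ (a : Fin m → Fin n → Fin n → Bool) (S : Set (Fin n → ℝ)), MeasurableSet S →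
    μ {ω | (fun i => ξ i ω) ∈ S ∧ ∀ k i j, i ≤ j → A k i j ω = a k i j}
      = ∫⁻ ω in {ω | (fun i => ξ i ω) ∈ S},
          ENNReal.ofReal (∏ k, ∏ p : Fin n × Fin n with p.1 ≤ p.2,
            bernoulliWeight (probMatrix f ρ (fun i => ξ i ω) (τ k) p.1 p.2) (a k p.1 p.2)) ∂μ

/-! ### First stage: local polynomial smoothing in time -/

/-- `U(u) = (1, u, …, u^ℓ)`. -/
def polyVec (ℓ : ℕ) (u : ℝ) : Fin (ℓ + 1) → ℝ := fun r => u ^ (r : ℕ)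

/-- The local polynomial design matrix
`B_{mt} = (1/(mh)) ∑_k U((t_k-t)/h) U((t_k-t)/h)ᵀ K((t_k-t)/h)`. -/
def designMatrix {m : ℕ} (ℓ : ℕ) (K : ℝ → ℝ) (τ : Fin m → ℝ) (h t : ℝ) :
    Matrix (Fin (ℓ + 1)) (Fin (ℓ + 1)) ℝ :=
  (1 / ((m : ℝ) * h)) • ∑ k, K ((τ k - t) / h) •
    Matrix.vecMulVec (polyVec ℓ ((τ k - t) / h)) (polyVec ℓ ((τ k - t) / h))

/-- The equivalent kernel weights
`w_k(t;h) = (1/(mh)) U(0)ᵀ B_{mt}⁻¹ U((t_k-t)/h) K((t_k-t)/h)`. -/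
def lpWeight {m : ℕ} (ℓ : ℕ) (K : ℝ → ℝ) (τ : Fin m → ℝ) (h t : ℝ) (k : Fin m) : ℝ :=
  1 / ((m : ℝ) * h) *
    (polyVec ℓ 0 ⬝ᵥ (designMatrix ℓ K τ h t)⁻¹.mulVec (polyVec ℓ ((τ k - t) / h))) *
    K ((τ k - t) / h)

/-- Local polynomial regularity, first condition: the smallest eigenvalue of `B_{mt}` is at least
`lam`, for all `t ∈ [0,1]`. -/
def LPEigen {m : ℕ} (ℓ : ℕ) (K : ℝ → ℝ) (τ : Fin m → ℝ) (h lam : ℝ) : Prop :=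
  ∀ t ∈ Set.Icc (0 : ℝ) 1, ∀ r ∈ spectrum ℝ (designMatrix ℓ K τ h t), lam ≤ r

/-- Local polynomial regularity, second condition: the proportion of time points in an interval
`I ⊆ [0,1]` is at most `a₀ max(|I|, 1/m)`. -/
def LPDesign {m : ℕ} (τ : Fin m → ℝ) (a₀ : ℝ) : Prop :=
  ∀ a b : ℝ, 0 ≤ a → a ≤ b → b ≤ 1 →
    1 / (m : ℝ) * ∑ k, Set.indicator (Set.Icc a b) (fun _ => (1 : ℝ)) (τ k)
      ≤ a₀ * max (b - a) (1 / (m : ℝ))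

/-- Local polynomial regularity, third condition: `K` is supported in `[-1,1]` and bounded. -/
def LPKernel (K : ℝ → ℝ) (Kmax : ℝ) : Prop :=
  (∀ u, u ∉ Set.Icc (-1 : ℝ) 1 → K u = 0) ∧ ∀ u, |K u| ≤ Kmax

/-- The first-stage estimator `P̃^{(t)}_ij = ∑_k w_k(t;h) A_ij^{(t_k)}` computed from observed
adjacency matrices `a`. -/
def firstStage {n m : ℕ} (ℓ : ℕ) (K : ℝ → ℝ) (τ : Fin m → ℝ) (h t : ℝ)
    (a : Fin m → Fin n → Fin n → Bool) : Matrix (Fin n) (Fin n) ℝ :=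
  Matrix.of fun i j => ∑ k, lpWeight ℓ K τ h t k * (if a k i j then 1 else 0)

/-! ### Second stage: neighborhood smoothing -/

/-- The empirical distance
`d(i,i') = √(max_{l ≠ i,i'} |⟨Q_i - Q_{i'}, Q_l⟩| / n)` between the nodes `i` and `i'`. -/
def nodeDist {n : ℕ} (Q : Matrix (Fin n) (Fin n) ℝ) (i i' : Fin n) : ℝ :=
  √((⨆ l : {l : Fin n // l ≠ i ∧ l ≠ i'}, |∑ j, (Q i j - Q i' j) * Q l j|) / n)

/-- The `h`-quantile of the family `d`: the smallest `x` such that at least a fraction `h` of the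
values of `d` is at most `x` (for `0 < h ≤ 1`). -/
def quantile {n : ℕ} (d : Fin n → ℝ) (h : ℝ) : ℝ :=
  sInf {x : ℝ | h * n ≤ (Finset.univ.filter fun k => d k ≤ x).card}

open Classical in
/-- The neighborhood `N_i = {i' : d(i,i') ≤ q_i(h)}`, with `q_i(h)` the `h`-quantile of the
distances from `i`. If the fraction `h` amounts to at most one node, the neighborhood is `{i}`: the
node `i`, at distance `0` from itself, is preferred to all other nodes, even to those that happen to
be at empirical distance exactly `0` from `i`. -/
def neighborhood {n : ℕ} (Q : Matrix (Fin n) (Fin n) ℝ) (h : ℝ) (i : Fin n) : Finset (Fin n) :=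
  if h * n ≤ 1 then {i}
  else Finset.univ.filter fun i' => nodeDist Q i i' ≤ quantile (nodeDist Q i) h

/-- Neighborhood smoothing: row `i` is the average of the rows of `Q` over the neighborhood of
`i`. -/
def neighborhoodSmooth {n : ℕ} (Q : Matrix (Fin n) (Fin n) ℝ) (h : ℝ) :
    Matrix (Fin n) (Fin n) ℝ :=
  Matrix.of fun i j => 1 / ((neighborhood Q h i).card : ℝ) * ∑ i' ∈ neighborhood Q h i, Q i' j

/-- The two-stage estimator `P̂^{(t)}`. -/
def twoStage {n m : ℕ} (ℓ : ℕ) (K : ℝ → ℝ) (τ : Fin m → ℝ) (h₁ h₂ t : ℝ)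
    (a : Fin m → Fin n → Fin n → Bool) : Matrix (Fin n) (Fin n) ℝ :=
  neighborhoodSmooth (firstStage ℓ K τ h₁ t a) h₂

/-! ### Norm and comparison of bandwidths -/

/-- `‖B‖_{2,∞}`, the maximal Euclidean norm of the rows of `B`. -/
def norm2Inf {n : ℕ} (B : Matrix (Fin n) (Fin n) ℝ) : ℝ := ⨆ i, √(∑ j, B i j ^ 2)

/-- `x ≍ y` with explicit constants: `c₁ y ≤ x ≤ c₂ y`. -/
def Comparable (c₁ c₂ x y : ℝ) : Prop := c₁ * y ≤ x ∧ x ≤ c₂ * y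

end

/-! Write the first-stage estimator as `Q = M + E`, with `M` its conditional mean given the latent
positions and `E` the noise, and put L = log(nm). The local polynomial weights are O(1/(m h₁)), have
bounded absolute sum and reproduce polynomials of degree at most ⌊β⌋. Hence `M` differs from `P`
entrywise by O(ρ h₁^β), and the entries of `E` are centered with variance O(ρ/(m h₁)).

In the sparse regime no rows are averaged. Bernstein's inequality for each entry and a union bound
give squared noise O(ρ L/(m h₁)), which the choice of h₁ matches with the squared bias
(`exists_sparse_regime_bound`).

In the dense regime the neighborhoods depend on the noise, so the smoothing step is analysed
deterministically (`sum_sq_neighborhoodSmooth_sub_le`) on an event where, uniformly, the rows of `E`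
have controlled norm, distinct rows of `E` are almost orthogonal, and rows of `E` are almost
orthogonal to rows of `M` (`measure_not_isNoiseBounded_le`). There ⟨Q_i, Q_l⟩ approximates ⟨P_i,
P_l⟩ for i ≠ l; the case i = l would carry the squared norm of a noise row, hence its exclusion from
the distance. Every node has at least h₂n nodes close to it in its own cell
(`measure_not_forall_exists_near_le`), which bounds the quantile. A selected neighbor i' therefore
has ⟨P_i - P_i', P_l⟩ small for l ≠ i, i', and replacing l by nodes similar to i and i' bounds the
squared distance of P_i and P_i'. Averaging at least h₂n rows divides the noise by h₂n, up to the
small inner products of distinct rows. With y the prescribed scale of h₁, every contribution is of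
order at most ρ² y^β.

Given the latent positions the edges are independent Bernoulli variables. All deviation bounds hold
uniformly in these positions, so they pass to the joint law
(`IsSparseGraphonNetwork.measure_le_of_forall_networkLaw_le`). Each event fails with probability
O(exp(-4L)), and O(n²) of them are needed. -/

noncomputable section

/-! ### Bernstein's inequality -/

theorem integrable_of_abs_le {Ω : Type*} [MeasurableSpace Ω] {μ : Measure Ω} [IsFiniteMeasure μ]
    {X : Ω → ℝ} (hm : Measurable X) {M : ℝ} (hb : ∀ ω, |X ω| ≤ M) : Integrable X μ :=
  Integrable.of_bound hm.aestronglyMeasurable M (ae_of_all _ fun ω => by simpa using hb ω)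

/-- The inequality `exp x ≤ 1 + x + x²` for `|x| ≤ 1` is integrated; the linear term has mean zero.
-/
theorem mgf_le_of_bounded_centered {Ω : Type*} [MeasurableSpace Ω] {μ : Measure Ω}
    [IsProbabilityMeasure μ] {X : Ω → ℝ} (hm : Measurable X) {M : ℝ}
    (hb : ∀ ω, |X ω| ≤ M) (h0 : ∫ ω, X ω ∂μ = 0) {t : ℝ} (ht : 0 ≤ t) (htM : t * M ≤ 1) :
    mgf X μ t ≤ Real.exp (t ^ 2 * ∫ ω, X ω ^ 2 ∂μ) := by
  have hX : Integrable X μ := integrable_of_abs_le hm hb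
  have hX2 : Integrable (fun ω => X ω ^ 2) μ :=
    integrable_of_abs_le (M := M ^ 2) (by fun_prop) fun ω => by
      rw [abs_pow]; exact pow_le_pow_left₀ (abs_nonneg _) (hb ω) 2
  have key : ∀ ω, Real.exp (t * X ω) ≤ 1 + t * X ω + t ^ 2 * X ω ^ 2 := fun ω => by
    have h1 : |t * X ω| ≤ 1 := by
      rw [abs_mul, abs_of_nonneg ht]
      exact (mul_le_mul_of_nonneg_left (hb ω) ht).trans htM
    have := (abs_le.1 (Real.abs_exp_sub_one_sub_id_le h1)).2
    nlinarith
  have hint : Integrable (fun ω => Real.exp (t * X ω)) μ :=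
    integrable_of_abs_le (M := Real.exp 1) (by fun_prop) fun ω => by
      rw [abs_of_pos (Real.exp_pos _)]
      apply Real.exp_le_exp.2
      exact (mul_le_mul_of_nonneg_left ((le_abs_self _).trans (hb ω)) ht).trans htM
  calc mgf X μ t = ∫ ω, Real.exp (t * X ω) ∂μ := rfl
    _ ≤ ∫ ω, (1 + t * X ω + t ^ 2 * X ω ^ 2) ∂μ :=
        integral_mono hint (((integrable_const _).add (hX.const_mul t)).add (hX2.const_mul _)) key
    _ = 1 + t ^ 2 * ∫ ω, X ω ^ 2 ∂μ := by
        have h1 : Integrable (fun ω => 1 + t * X ω) μ :=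
          (integrable_const _).add (hX.const_mul t)
        rw [integral_add h1 (hX2.const_mul _),
          integral_add (integrable_const _) (hX.const_mul t), integral_const_mul,
          integral_const_mul, h0]
        simp
    _ ≤ _ := by
        have := Real.add_one_le_exp (t ^ 2 * ∫ ω, X ω ^ 2 ∂μ)
        linarith

/-- Chernoff's bound with `t = √(A/V)` when this is at most `1/M`, and `t = 1/M` otherwise. The
hypothesis is factorization of the moment generating function rather than independence of the
family, so that sums of products of edge variables are covered through `mgf_sum_mul_of_iIndepFun`.
-/
theorem bernstein_upper {Ω : Type*} [MeasurableSpace Ω] {μ : Measure Ω} [IsProbabilityMeasure μ]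
    {ι : Type*} {s : Finset ι} {X : ι → Ω → ℝ}
    (hmgf : ∀ t, mgf (fun ω => ∑ i ∈ s, X i ω) μ t = ∏ i ∈ s, mgf (X i) μ t)
    (hm : ∀ i, Measurable (X i)) {M V A : ℝ} (hM : 0 < M) (hb : ∀ i ∈ s, ∀ ω, |X i ω| ≤ M)
    (h0 : ∀ i ∈ s, ∫ ω, X i ω ∂μ = 0) (hV : ∑ i ∈ s, ∫ ω, X i ω ^ 2 ∂μ ≤ V) (hA : 0 ≤ A) :
    μ.real {ω | 2 * √(V * A) + 2 * M * A ≤ ∑ i ∈ s, X i ω} ≤ Real.exp (-A) := by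
  have hV0 : 0 ≤ V :=
    (Finset.sum_nonneg fun i _ => integral_nonneg fun ω => sq_nonneg (X i ω)).trans hV
  have main : ∀ t : ℝ, 0 ≤ t → t * M ≤ 1 → ∀ u : ℝ,
      μ.real {ω | u ≤ ∑ i ∈ s, X i ω} ≤ Real.exp (-t * u + t ^ 2 * V) := by
    intro t ht htM u
    have hS : Measurable fun ω => ∑ i ∈ s, X i ω := Finset.measurable_sum _ fun i _ => hm i
    have hint : Integrable (fun ω => Real.exp (t * ∑ i ∈ s, X i ω)) μ :=
      integrable_of_abs_le (M := Real.exp (t * ∑ i ∈ s, M)) (by fun_prop) fun ω => by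
        rw [abs_of_pos (Real.exp_pos _)]
        apply Real.exp_le_exp.2
        exact mul_le_mul_of_nonneg_left
          (Finset.sum_le_sum fun i hi => (le_abs_self _).trans (hb i hi ω)) ht
    refine (measure_ge_le_exp_mul_mgf u ht hint).trans ?_
    rw [Real.exp_add]
    refine mul_le_mul_of_nonneg_left ?_ (Real.exp_pos _).le
    rw [hmgf t]
    calc ∏ i ∈ s, mgf (X i) μ t ≤ ∏ i ∈ s, Real.exp (t ^ 2 * ∫ ω, X i ω ^ 2 ∂μ) :=
          Finset.prod_le_prod (fun i _ => mgf_nonneg) fun i hi =>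
            mgf_le_of_bounded_centered (hm i) (hb i hi) (h0 i hi) ht htM
      _ = Real.exp (t ^ 2 * ∑ i ∈ s, ∫ ω, X i ω ^ 2 ∂μ) := by
          rw [← Real.exp_sum, Finset.mul_sum]
      _ ≤ _ := Real.exp_le_exp.2 (mul_le_mul_of_nonneg_left hV (sq_nonneg t))
  set r := √(V * A) with hr
  have hr0 : 0 ≤ r := Real.sqrt_nonneg _
  have hr2 : r ^ 2 = V * A := Real.sq_sqrt (mul_nonneg hV0 hA)
  by_cases hcase : A * M ^ 2 ≤ V
  · rcases hV0.eq_or_lt with h | h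
    -- When `V = 0` this case forces `A = 0`, and the bound by one is trivial.
    · have hA0 : A = 0 := by
        have : 0 < M ^ 2 := by positivity
        nlinarith
      refine (main 0 le_rfl (by simp) _).trans ?_
      simp [hA0]
    · refine (main (r / V) (by positivity) ?_ _).trans (Real.exp_le_exp.2 ?_)
      · rw [div_mul_eq_mul_div, div_le_one h]
        refine abs_le_of_sq_le_sq' ?_ hV0 |>.2
        rw [mul_pow, hr2]
        nlinarith
      · have e : (r / V) ^ 2 * V = A := by
          rw [div_pow, hr2]; field_simp
        have e2 : r / V * r = A := by
          rw [div_mul_eq_mul_div, ← sq, hr2]; field_simp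
        have : 0 ≤ r / V * (2 * M * A) := by positivity
        nlinarith
  · push Not at hcase
    refine (main (1 / M) (by positivity) (by field_simp; rfl) _).trans (Real.exp_le_exp.2 ?_)
    have e : (1 / M) ^ 2 * V ≤ A := by
      rw [div_pow, one_pow, div_mul_eq_mul_div, one_mul, div_le_iff₀ (by positivity)]
      exact hcase.le
    have e2 : 1 / M * (2 * M * A) = 2 * A := by field_simp
    have : 0 ≤ 1 / M * (2 * r) := by positivity
    nlinarith

/-- **Bernstein's inequality** for a sum of independent bounded centered variables. -/
theorem bernstein_abs {Ω : Type*} [MeasurableSpace Ω] {μ : Measure Ω} [IsProbabilityMeasure μ]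
    {ι : Type*} {s : Finset ι} {X : ι → Ω → ℝ}
    (hmgf : ∀ t, mgf (fun ω => ∑ i ∈ s, X i ω) μ t = ∏ i ∈ s, mgf (X i) μ t)
    (hm : ∀ i, Measurable (X i)) {M V A : ℝ} (hM : 0 < M) (hb : ∀ i ∈ s, ∀ ω, |X i ω| ≤ M)
    (h0 : ∀ i ∈ s, ∫ ω, X i ω ∂μ = 0) (hV : ∑ i ∈ s, ∫ ω, X i ω ^ 2 ∂μ ≤ V) (hA : 0 ≤ A) :
    μ.real {ω | 2 * √(V * A) + 2 * M * A ≤ |∑ i ∈ s, X i ω|} ≤ 2 * Real.exp (-A) := by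
  have h1 := bernstein_upper hmgf hm hM hb h0 hV hA
  have hmgf' : ∀ t, mgf (fun ω => ∑ i ∈ s, -X i ω) μ t =
      ∏ i ∈ s, mgf (fun ω => -X i ω) μ t := fun t => by
    have := hmgf (-t)
    simp only [mgf, Finset.sum_neg_distrib, mul_neg, neg_mul] at this ⊢
    exact this
  have h2 := bernstein_upper hmgf' (fun i => (hm i).neg) hM
    (fun i hi ω => by rw [abs_neg]; exact hb i hi ω)
    (fun i hi => by rw [integral_neg, h0 i hi, neg_zero])
    (V := V) (s := s) (by simpa using hV) hA
  have hsub : {ω | 2 * √(V * A) + 2 * M * A ≤ |∑ i ∈ s, X i ω|} ⊆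
      {ω | 2 * √(V * A) + 2 * M * A ≤ ∑ i ∈ s, X i ω} ∪
      {ω | 2 * √(V * A) + 2 * M * A ≤ ∑ i ∈ s, -X i ω} := fun ω hω => by
    simp only [Set.mem_ofPred_eq, Set.mem_union, Finset.sum_neg_distrib] at hω ⊢
    exact le_abs.1 hω
  refine (measureReal_mono hsub).trans ((measureReal_union_le _ _).trans ?_)
  linarith

theorem mgf_sum_of_iIndepFun {Ω : Type*} [MeasurableSpace Ω] {μ : Measure Ω} {ι : Type*}
    {X : ι → Ω → ℝ} (hind : iIndepFun X μ) (hm : ∀ i, Measurable (X i)) (s : Finset ι) (t : ℝ) :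
    mgf (fun ω => ∑ i ∈ s, X i ω) μ t = ∏ i ∈ s, mgf (X i) μ t := by
  rw [show (fun ω => ∑ i ∈ s, X i ω) = ∑ i ∈ s, X i by ext ω; simp]
  exact hind.mgf_sum hm s

/-- The moment generating function of a sum of products of disjoint pairs of independent
variables. -/
theorem mgf_sum_mul_of_iIndepFun {Ω : Type*} [MeasurableSpace Ω] {μ : Measure Ω}
    [IsProbabilityMeasure μ] {ι κ : Type*} [DecidableEq ι]
    {X : ι → Ω → ℝ} (hind : iIndepFun X μ) (hm : ∀ i, Measurable (X i)) (s : Finset κ)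
    (a b : κ → ι) (ha : Set.InjOn a s) (hb : Set.InjOn b s)
    (hab : ∀ j ∈ s, ∀ j' ∈ s, a j ≠ b j') (t : ℝ) :
    mgf (fun ω => ∑ j ∈ s, X (a j) ω * X (b j) ω) μ t =
      ∏ j ∈ s, mgf (fun ω => X (a j) ω * X (b j) ω) μ t := by
  classical
  induction s using Finset.induction_on with
  | empty => simp
  | insert j₀ s hj₀ ih =>
    rw [Finset.prod_insert hj₀, ← ih (ha.mono (by simp)) (hb.mono (by simp))
      fun j hj j' hj' => hab j (by simp [hj]) j' (by simp [hj'])]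
    simp only [Finset.sum_insert hj₀]
    -- Blocks of variables with disjoint index sets are independent, so the new product splits off
    -- from the remaining sum.
    have hdisj : Disjoint ({a j₀, b j₀} : Finset ι) (s.image a ∪ s.image b) := by
      rw [Finset.disjoint_left]
      intro i hi hi'
      simp only [Finset.mem_insert, Finset.mem_singleton, Finset.mem_union,
        Finset.mem_image] at hi hi'
      have hj₀' : j₀ ∈ insert j₀ s := Finset.mem_insert_self _ _
      rcases hi with rfl | rfl <;> rcases hi' with ⟨j, hj, e⟩ | ⟨j, hj, e⟩
      · exact hj₀ (ha (by simp [hj]) (by simp) e ▸ hj)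
      · exact hab j₀ hj₀' j (by simp [hj]) e.symm
      · exact hab j (by simp [hj]) j₀ hj₀' e
      · exact hj₀ (hb (by simp [hj]) (by simp) e ▸ hj)
    have h1 := hind.indepFun_finset _ _ hdisj hm
    have h2 := h1.comp
      (φ := fun v : (({a j₀, b j₀} : Finset ι) → ℝ) => v ⟨a j₀, by simp⟩ * v ⟨b j₀, by simp⟩)
      (ψ := fun v : ((s.image a ∪ s.image b : Finset ι) → ℝ) => ∑ j ∈ s.attach,
        v ⟨a j, Finset.mem_union_left _ (Finset.mem_image_of_mem _ j.2)⟩ *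
        v ⟨b j, Finset.mem_union_right _ (Finset.mem_image_of_mem _ j.2)⟩)
      (by fun_prop) (by fun_prop)
    have e : (fun ω => ∑ j ∈ s, X (a j) ω * X (b j) ω) =
        fun ω => ∑ j ∈ s.attach, X (a j) ω * X (b j) ω := by
      ext ω
      exact (Finset.sum_attach s fun j => X (a j) ω * X (b j) ω).symm
    rw [e]
    have h3 : IndepFun (fun ω => X (a j₀) ω * X (b j₀) ω)
        (fun ω => ∑ j ∈ s.attach, X (a j) ω * X (b j) ω) μ := h2
    have := h3.mgf_add (t := t) (by fun_prop) (by fun_prop)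
    rw [← this]
    congr 1
    ext ω
    exact congrArg _ (Finset.sum_attach s fun j => X (a j) ω * X (b j) ω).symm

/-! ### Local polynomial weights -/

section LocalPolynomial

variable {m ℓ : ℕ} {K : ℝ → ℝ} {τ : Fin m → ℝ} {h t lam Kmax a₀ : ℝ}

theorem polyVec_zero (ℓ : ℕ) : polyVec ℓ 0 = Pi.single 0 1 := by
  ext r
  rcases eq_or_ne r 0 with rfl | hr
  · simp [polyVec]
  · have : (r : ℕ) ≠ 0 := fun e => hr (Fin.ext e)
    simp [polyVec, hr, this]

theorem designMatrix_isHermitian : (designMatrix ℓ K τ h t).IsHermitian := by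
  ext r c
  simp only [designMatrix, Matrix.conjTranspose_apply, Matrix.smul_apply, Matrix.sum_apply,
    Matrix.vecMulVec_apply, smul_eq_mul, star_trivial]
  congr 1
  exact Finset.sum_congr rfl fun k _ => by ring

/-- `B - lam • 1` is Hermitian with nonnegative spectrum, hence positive semidefinite. This turns
the eigenvalue condition into coercivity of the quadratic form. -/
theorem le_dotProduct_designMatrix
    (hspec : ∀ r ∈ spectrum ℝ (designMatrix ℓ K τ h t), lam ≤ r) (v : Fin (ℓ + 1) → ℝ) :
    lam * (v ⬝ᵥ v) ≤ v ⬝ᵥ (designMatrix ℓ K τ h t).mulVec v := by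
  set B := designMatrix ℓ K τ h t
  have hps : (B - algebraMap ℝ (Matrix (Fin (ℓ + 1)) (Fin (ℓ + 1)) ℝ) lam).PosSemidef := by
    rw [Matrix.posSemidef_iff_isHermitian_and_spectrum_nonneg]
    refine ⟨Matrix.IsHermitian.sub designMatrix_isHermitian ?_, fun r hr => ?_⟩
    · rw [Algebra.algebraMap_eq_smul_one]
      ext r c
      simp [Matrix.one_apply, eq_comm]
    · have h1 : r + lam ∈ spectrum ℝ B := by
        rw [← spectrum.sub_singleton_eq] at hr
        obtain ⟨x, hx, y, hy, e⟩ := hr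
        rw [Set.mem_singleton_iff] at hy
        subst hy
        rw [← e]
        simpa using hx
      have := hspec _ h1
      simp only [Set.mem_ofPred_eq]
      linarith
  have := hps.dotProduct_mulVec_nonneg v
  rw [Algebra.algebraMap_eq_smul_one, Matrix.sub_mulVec, Matrix.smul_mulVec, Matrix.one_mulVec,
    dotProduct_sub, dotProduct_smul, star_trivial, smul_eq_mul] at this
  linarith

theorem isUnit_det_designMatrix (hlam : 0 < lam)
    (hspec : ∀ r ∈ spectrum ℝ (designMatrix ℓ K τ h t), lam ≤ r) :
    IsUnit (designMatrix ℓ K τ h t).det := by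
  rw [isUnit_iff_ne_zero]
  intro hdet
  obtain ⟨v, hv, hv0⟩ := Matrix.exists_mulVec_eq_zero_iff.2 hdet
  have h1 := le_dotProduct_designMatrix hspec v
  rw [hv0, dotProduct_zero] at h1
  have h2 : 0 < v ⬝ᵥ v := by
    have h0 : 0 ≤ v ⬝ᵥ v := Finset.sum_nonneg fun i _ => mul_self_nonneg _
    refine lt_of_le_of_ne h0 fun e => hv (dotProduct_self_eq_zero.1 e.symm)
  nlinarith

/-- For `z = B⁻¹ U(u)`, coercivity and Cauchy–Schwarz give `lam |z|² ≤ z · U(u) ≤ |z| |U(u)|`, while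
`|U(u)|² ≤ ℓ + 1` inside the window. Pairing with `U(0)` only reads off the coordinate `z 0`. -/
theorem abs_dotProduct_inv_designMatrix_le (hlam : 0 < lam)
    (hspec : ∀ r ∈ spectrum ℝ (designMatrix ℓ K τ h t), lam ≤ r) {u : ℝ} (hu : |u| ≤ 1) :
    |polyVec ℓ 0 ⬝ᵥ (designMatrix ℓ K τ h t)⁻¹.mulVec (polyVec ℓ u)| ≤ (ℓ + 1) / lam := by
  set B := designMatrix ℓ K τ h t with hB
  have hunit : IsUnit B.det := isUnit_det_designMatrix hlam hspec
  set v := polyVec ℓ u with hv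
  set z := B⁻¹.mulVec v with hz
  have hBz : B.mulVec z = v := by
    rw [hz, Matrix.mulVec_mulVec, Matrix.mul_nonsing_inv _ hunit, Matrix.one_mulVec]
  have h1 : lam * (z ⬝ᵥ z) ≤ z ⬝ᵥ v := by
    have := le_dotProduct_designMatrix hspec z
    rwa [← hB, hBz] at this
  have hvv : v ⬝ᵥ v ≤ ℓ + 1 := by
    calc v ⬝ᵥ v = ∑ r : Fin (ℓ + 1), u ^ (r : ℕ) * u ^ (r : ℕ) := rfl
      _ ≤ ∑ r : Fin (ℓ + 1), (1 : ℝ) := Finset.sum_le_sum fun r _ => by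
          rw [← pow_add, ← two_mul, pow_mul]
          exact pow_le_one₀ (sq_nonneg u) (by rw [sq_le_one_iff_abs_le_one]; exact hu)
      _ = ℓ + 1 := by simp
  have h2 : (z ⬝ᵥ v) ^ 2 ≤ (z ⬝ᵥ z) * (v ⬝ᵥ v) := by
    have := Finset.sum_mul_sq_le_sq_mul_sq Finset.univ z v
    simpa [dotProduct, sq] using this
  have hz0 : z 0 ^ 2 ≤ z ⬝ᵥ z := by
    have := Finset.single_le_sum (f := fun i => z i * z i) (fun i _ => mul_self_nonneg (z i))
      (Finset.mem_univ (0 : Fin (ℓ + 1)))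
    rw [sq]
    exact this
  have e0 : polyVec ℓ 0 ⬝ᵥ z = z 0 := by rw [polyVec_zero]; simp
  rw [e0]
  have hS0 : 0 ≤ z ⬝ᵥ z := (sq_nonneg _).trans hz0
  have hℓ : (1 : ℝ) ≤ ℓ + 1 := by
    have : (0 : ℝ) ≤ ℓ := Nat.cast_nonneg _
    linarith
  have h3 : lam ^ 2 * (z ⬝ᵥ z) ≤ ℓ + 1 := by
    by_contra hcon
    push Not at hcon
    have hzpos : 0 < z ⬝ᵥ z := by
      by_contra h'
      have : z ⬝ᵥ z = 0 := le_antisymm (not_lt.1 h') hS0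
      rw [this] at hcon
      linarith
    have h4 : (lam * (z ⬝ᵥ z)) ^ 2 ≤ (z ⬝ᵥ v) ^ 2 := pow_le_pow_left₀ (by positivity) h1 2
    have h5 : (lam * (z ⬝ᵥ z)) ^ 2 ≤ (z ⬝ᵥ z) * (ℓ + 1) :=
      h4.trans (h2.trans (mul_le_mul_of_nonneg_left hvv hS0))
    nlinarith
  rw [le_div_iff₀ hlam]
  have habs : |z 0| * lam = |z 0 * lam| := by rw [abs_mul, abs_of_pos hlam]
  rw [habs]
  refine abs_le_of_sq_le_sq ?_ (by positivity)
  calc (z 0 * lam) ^ 2 = lam ^ 2 * z 0 ^ 2 := by ring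
    _ ≤ lam ^ 2 * (z ⬝ᵥ z) := by gcongr
    _ ≤ ℓ + 1 := h3
    _ ≤ (ℓ + 1) ^ 2 := by nlinarith

theorem designMatrix_apply (r c : Fin (ℓ + 1)) :
    designMatrix ℓ K τ h t r c = 1 / ((m : ℝ) * h) * ∑ k, K ((τ k - t) / h) *
      (((τ k - t) / h) ^ (r : ℕ) * ((τ k - t) / h) ^ (c : ℕ)) := by
  simp [designMatrix, Matrix.sum_apply, Matrix.vecMulVec_apply, polyVec]

/-- Coercivity tested on the first basis vector. Both the upper and the lower bound on the bandwidth
come from this inequality. -/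
theorem le_designMatrix_zero
    (hspec : ∀ r ∈ spectrum ℝ (designMatrix ℓ K τ h t), lam ≤ r) :
    lam ≤ 1 / ((m : ℝ) * h) * ∑ k, K ((τ k - t) / h) := by
  have := le_dotProduct_designMatrix hspec (Pi.single 0 1)
  simpa [designMatrix_apply] using this

/-- The local polynomial weights reproduce polynomials of degree at most `ℓ`. -/
theorem sum_lpWeight_mul_pow (hlam : 0 < lam)
    (hspec : ∀ r ∈ spectrum ℝ (designMatrix ℓ K τ h t), lam ≤ r) {r : ℕ} (hr : r ≤ ℓ) :
    ∑ k, lpWeight ℓ K τ h t k * ((τ k - t) / h) ^ r = if r = 0 then 1 else 0 := by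
  set B := designMatrix ℓ K τ h t with hB
  have hunit : IsUnit B.det := isUnit_det_designMatrix hlam hspec
  -- The sum over times assembles column `r` of `B`, which `B⁻¹` sends to a basis vector.
  have h1 : ∑ k, lpWeight ℓ K τ h t k * ((τ k - t) / h) ^ r =
      polyVec ℓ 0 ⬝ᵥ B⁻¹.mulVec (fun i => B i ⟨r, by omega⟩) := by
    have e : (fun i => B i ⟨r, by omega⟩) = ∑ k, (1 / ((m : ℝ) * h) * K ((τ k - t) / h) *
        ((τ k - t) / h) ^ r) • polyVec ℓ ((τ k - t) / h) := by
      ext i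
      rw [hB, designMatrix_apply, Finset.sum_apply, Finset.mul_sum]
      refine Finset.sum_congr rfl fun k _ => ?_
      simp only [polyVec, Pi.smul_apply, smul_eq_mul]
      ring
    rw [e, Matrix.mulVec_sum, dotProduct_sum]
    refine Finset.sum_congr rfl fun k _ => ?_
    rw [Matrix.mulVec_smul, dotProduct_smul, lpWeight, smul_eq_mul]
    ring
  have h2 : B⁻¹.mulVec (fun i => B i ⟨r, by omega⟩) = Pi.single ⟨r, by omega⟩ 1 := by
    have : (fun i => B i ⟨r, by omega⟩) = B.mulVec (Pi.single ⟨r, by omega⟩ 1) := by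
      ext i; simp
    rw [this, Matrix.mulVec_mulVec, Matrix.nonsing_inv_mul _ hunit, Matrix.one_mulVec]
  rw [h1, h2, polyVec_zero]
  simp [Pi.single_apply, Fin.ext_iff, eq_comm]

theorem lpWeight_eq_zero (hh : 0 < h) (hK : LPKernel K Kmax) {k : Fin m} (hk : h < |τ k - t|) :
    lpWeight ℓ K τ h t k = 0 := by
  have : (τ k - t) / h ∉ Set.Icc (-1 : ℝ) 1 := by
    rw [Set.mem_Icc, ← abs_le, abs_div, abs_of_pos hh, div_le_one hh]
    exact not_le.2 hk
  rw [lpWeight, hK.1 _ this, mul_zero]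

theorem LPKernel.nonneg (hK : LPKernel K Kmax) : 0 ≤ Kmax := (abs_nonneg _).trans (hK.2 0)

theorem abs_lpWeight_le (hh : 0 < h) (hlam : 0 < lam) (hK : LPKernel K Kmax)
    (hspec : ∀ r ∈ spectrum ℝ (designMatrix ℓ K τ h t), lam ≤ r) (k : Fin m) :
    |lpWeight ℓ K τ h t k| ≤ (ℓ + 1) / lam * Kmax * (1 / ((m : ℝ) * h)) := by
  have hK0 := hK.nonneg
  by_cases hk : h < |τ k - t|
  · rw [lpWeight_eq_zero hh hK hk, abs_zero]
    positivity
  · have hu : |(τ k - t) / h| ≤ 1 := by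
      rw [abs_div, abs_of_pos hh, div_le_one hh]
      exact not_lt.1 hk
    rw [lpWeight, abs_mul, abs_mul, abs_of_nonneg (by positivity : 0 ≤ 1 / ((m : ℝ) * h))]
    calc 1 / ((m : ℝ) * h) * |polyVec ℓ 0 ⬝ᵥ (designMatrix ℓ K τ h t)⁻¹.mulVec
          (polyVec ℓ ((τ k - t) / h))| * |K ((τ k - t) / h)|
        ≤ 1 / ((m : ℝ) * h) * ((ℓ + 1) / lam) * Kmax := by
          gcongr
          · exact abs_dotProduct_inv_designMatrix_le hlam hspec hu
          · exact hK.2 _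
      _ = _ := by ring

/-- The top-left entry of the design matrix is at most `Kmax / h`, so the eigenvalue condition
excludes large bandwidths. -/
theorem bandwidth_le (hm : 0 < m) (hh : 0 < h) (hlam : 0 < lam) (hK : LPKernel K Kmax)
    (hspec : ∀ r ∈ spectrum ℝ (designMatrix ℓ K τ h t), lam ≤ r) : h ≤ Kmax / lam := by
  have h1 := le_designMatrix_zero hspec
  have hm' : (0 : ℝ) < m := Nat.cast_pos.2 hm
  have h2 : ∑ k, K ((τ k - t) / h) ≤ m * Kmax := by
    calc ∑ k, K ((τ k - t) / h) ≤ ∑ _k : Fin m, Kmax :=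
          Finset.sum_le_sum fun k _ => (le_abs_self _).trans (hK.2 _)
      _ = m * Kmax := by simp
  rw [le_div_iff₀ hlam]
  have h3 : lam ≤ 1 / ((m : ℝ) * h) * (m * Kmax) :=
    h1.trans (mul_le_mul_of_nonneg_left h2 (by positivity))
  have h4 : 1 / ((m : ℝ) * h) * (m * Kmax) = Kmax / h := by field_simp
  rw [h4, le_div_iff₀ hh] at h3
  linarith

/-- The windows `[τ_k - h, τ_k + h]` cover `[0,1]`, so `2mh ≥ 1`. -/
theorem one_le_two_mul_mul_bandwidth (hh : 0 < h) (hlam : 0 < lam) (hK : LPKernel K Kmax)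
    (hspec : LPEigen ℓ K τ h lam) : 1 ≤ 2 * (m * h) := by
  -- At an uncovered `t` every kernel value vanishes, and the top-left entry of the design matrix
  -- could not be at least `lam > 0`.
  have hcover : Set.Icc (0 : ℝ) 1 ⊆ ⋃ k, Set.Icc (τ k - h) (τ k + h) := by
    intro t ht
    by_contra hcon
    simp only [Set.mem_iUnion, Set.mem_Icc, not_exists] at hcon
    have h1 := le_designMatrix_zero (hspec t ht)
    have h2 : ∑ k, K ((τ k - t) / h) = 0 := Finset.sum_eq_zero fun k _ => by
      refine hK.1 _ fun hmem => hcon k ?_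
      rw [Set.mem_Icc, le_div_iff₀ hh, div_le_iff₀ hh] at hmem
      constructor <;> linarith [hmem.1, hmem.2]
    rw [h2, mul_zero] at h1
    linarith
  have hvol : volume (Set.Icc (0 : ℝ) 1) ≤ ENNReal.ofReal (2 * (m * h)) := by
    calc volume (Set.Icc (0 : ℝ) 1) ≤ volume (⋃ k, Set.Icc (τ k - h) (τ k + h)) :=
          measure_mono hcover
      _ ≤ ∑ k, volume (Set.Icc (τ k - h) (τ k + h)) := measure_iUnion_fintype_le _ _
      _ = ENNReal.ofReal (2 * (m * h)) := by
          simp only [Real.volume_Icc, show ∀ k, τ k + h - (τ k - h) = 2 * h from fun k => by ring]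
          rw [Finset.sum_const, Finset.card_univ, Fintype.card_fin, nsmul_eq_mul,
            ← ENNReal.ofReal_natCast, ← ENNReal.ofReal_mul (Nat.cast_nonneg _)]
          congr 1
          ring
  rw [Real.volume_Icc, sub_zero] at hvol
  exact (ENNReal.ofReal_le_ofReal_iff (by positivity)).1 hvol

/-- The design condition is applied to the window intersected with `[0,1]`; the alternative `1/m` in
its maximum is absorbed by `1 ≤ 2mh`. -/
theorem sum_indicator_window_le (hm : 0 < m) (hτ : ∀ k, τ k ∈ Set.Icc (0 : ℝ) 1)
    (hdes : LPDesign τ a₀) (ha₀ : 0 < a₀) (hmh : 1 ≤ 2 * (m * h))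
    (ht : t ∈ Set.Icc (0 : ℝ) 1) :
    ∑ k, (if h < |τ k - t| then 0 else (1 : ℝ)) ≤ 2 * a₀ * (m * h) := by
  have hm' : (0 : ℝ) < m := Nat.cast_pos.2 hm
  have hh : 0 < h := by
    by_contra hcon
    have : (m : ℝ) * h ≤ 0 := mul_nonpos_of_nonneg_of_nonpos hm'.le (not_lt.1 hcon)
    linarith
  have h1 := hdes (max 0 (t - h)) (min 1 (t + h)) (le_max_left _ _)
    (by simp only [le_min_iff, max_le_iff]
        refine ⟨⟨zero_le_one, ?_⟩, ?_, ?_⟩ <;> linarith [ht.1, ht.2]) (min_le_left _ _)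
  have h2 : max (min 1 (t + h) - max 0 (t - h)) (1 / (m : ℝ)) ≤ 2 * h := by
    refine max_le ?_ ?_
    · linarith [min_le_right 1 (t + h), le_max_right 0 (t - h)]
    · rw [div_le_iff₀ hm']; linarith
  have h3 : ∑ k, (if h < |τ k - t| then 0 else (1 : ℝ)) ≤
      ∑ k, Set.indicator (Set.Icc (max 0 (t - h)) (min 1 (t + h))) (fun _ => (1 : ℝ)) (τ k) := by
    refine Finset.sum_le_sum fun k _ => ?_
    split_ifs with hk
    · exact Set.indicator_nonneg (fun _ _ => zero_le_one) _
    · rw [Set.indicator_of_mem]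
      have := abs_le.1 (not_lt.1 hk)
      simp only [Set.mem_Icc, max_le_iff, le_min_iff]
      refine ⟨⟨(hτ k).1, ?_⟩, (hτ k).2, ?_⟩ <;> linarith [this.1, this.2]
  rw [div_mul_eq_mul_div, one_mul, div_le_iff₀ hm'] at h1
  calc _ ≤ _ := h3
    _ ≤ _ := h1
    _ ≤ a₀ * (2 * h) * m := by gcongr
    _ = _ := by ring

/-- At most `2 a₀ m h` weights are nonzero, and each is of order `1/(mh)`. -/
theorem sum_abs_lpWeight_le (hm : 0 < m) (hτ : ∀ k, τ k ∈ Set.Icc (0 : ℝ) 1)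
    (hdes : LPDesign τ a₀) (ha₀ : 0 < a₀) (hh : 0 < h) (hlam : 0 < lam) (hK : LPKernel K Kmax)
    (hspec : LPEigen ℓ K τ h lam) (ht : t ∈ Set.Icc (0 : ℝ) 1) :
    ∑ k, |lpWeight ℓ K τ h t k| ≤ 2 * a₀ * ((ℓ + 1) / lam * Kmax) := by
  have hm' : (0 : ℝ) < m := Nat.cast_pos.2 hm
  have hK0 := hK.nonneg
  have h1 := sum_indicator_window_le hm hτ hdes ha₀
    (one_le_two_mul_mul_bandwidth hh hlam hK hspec) ht
  calc ∑ k, |lpWeight ℓ K τ h t k|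
      ≤ ∑ k, (ℓ + 1) / lam * Kmax * (1 / ((m : ℝ) * h)) *
          (if h < |τ k - t| then 0 else (1 : ℝ)) := Finset.sum_le_sum fun k _ => by
        split_ifs with hk
        · rw [lpWeight_eq_zero hh hK hk]; simp
        · rw [mul_one]; exact abs_lpWeight_le hh hlam hK (hspec t ht) k
    _ = (ℓ + 1) / lam * Kmax * (1 / ((m : ℝ) * h)) *
          ∑ k, (if h < |τ k - t| then 0 else (1 : ℝ)) := by rw [Finset.mul_sum]
    _ ≤ (ℓ + 1) / lam * Kmax * (1 / ((m : ℝ) * h)) * (2 * a₀ * (m * h)) := by gcongr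
    _ = _ := by field_simp

end LocalPolynomial

/-! ### Taylor expansion and bias -/

/-- Taylor's formula: if the derivative of order `ℓ` of `g` varies by at most
`M` between `t` and the points of a convex set `S`, the Taylor polynomial of order `ℓ` at `t`
approximates `g` on `S` up to `M |s - t|^ℓ`. -/
theorem abs_sub_taylorWithinEval_le_of_abs_sub_le {I S : Set ℝ}
    (hS : Convex ℝ S) (hSI : S ⊆ I) {t : ℝ} (ht : t ∈ S) {M : ℝ} (ℓ : ℕ) :
    ∀ (g : ℝ → ℝ), (∀ k < ℓ, DifferentiableOn ℝ (iteratedDerivWithin k g I) I) →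
    (∀ s ∈ S, |iteratedDerivWithin ℓ g I s - iteratedDerivWithin ℓ g I t| ≤ M) →
    ∀ s ∈ S, |g s - ∑ r ∈ Finset.range (ℓ + 1),
      iteratedDerivWithin r g I t / (r.factorial : ℝ) * (s - t) ^ r| ≤ M * |s - t| ^ ℓ := by
  induction ℓ with
  | zero =>
    intro g _ hM s hs
    simpa [iteratedDerivWithin_zero] using hM s hs
  | succ ℓ ih =>
    intro g hg hM s hs
    set g' := derivWithin g I with hg'
    have hsucc : ∀ k, Set.EqOn (iteratedDerivWithin k g' I) (iteratedDerivWithin (k + 1) g I) I :=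
      fun k x hx => (congrFun (iteratedDerivWithin_succ' (n := k) (f := g) (s := I)) x).symm
    have hgd : DifferentiableOn ℝ g I := by
      have := hg 0 (by omega)
      rwa [iteratedDerivWithin_zero] at this
    have htI := hSI ht
    -- Induction on the derivative: the Taylor polynomial of `g'` is the derivative of that of `g`,
    -- and the mean value inequality on the segment from `t` to `s` supplies one more factor `|s -
    -- t|`. Derivatives are taken within `I`, whereas the increment bound `M` is only needed on `S`,
    -- which in the application is the segment between two times.
    have ih' := ih g' (fun k hk => (hg (k + 1) (by omega)).congr (hsucc k))
      (fun s hs => by rw [hsucc ℓ (hSI hs), hsucc ℓ htI]; exact hM s hs)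
    set T : ℝ → ℝ := fun s => ∑ r ∈ Finset.range (ℓ + 1 + 1),
      iteratedDerivWithin r g I t / (r.factorial : ℝ) * (s - t) ^ r with hT
    have hT' : ∀ x, HasDerivAt T (∑ r ∈ Finset.range (ℓ + 1),
        iteratedDerivWithin r g' I t / (r.factorial : ℝ) * (x - t) ^ r) x := by
      intro x
      have h1 : HasDerivAt T (∑ r ∈ Finset.range (ℓ + 1 + 1),
          iteratedDerivWithin r g I t / (r.factorial : ℝ) * ((r : ℝ) * (x - t) ^ (r - 1) * 1)) x :=
        HasDerivAt.fun_sum fun r _ => (((hasDerivAt_id x).sub_const t).pow r).const_mul _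
      convert h1 using 1
      rw [Finset.sum_range_succ' _ (ℓ + 1)]
      simp only [Nat.cast_zero, zero_mul, mul_zero, add_zero, mul_one, Nat.add_sub_cancel]
      refine Finset.sum_congr rfl fun r _ => ?_
      rw [hsucc r htI, Nat.factorial_succ]
      push_cast
      have h1 : (r.factorial : ℝ) ≠ 0 := by positivity
      have h2 : (r : ℝ) + 1 ≠ 0 := by positivity
      field_simp
    have hseg : segment ℝ t s ⊆ S := hS.segment_subset ht hs
    have hbound : ∀ x ∈ segment ℝ t s, ‖g' x - ∑ r ∈ Finset.range (ℓ + 1),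
        iteratedDerivWithin r g' I t / (r.factorial : ℝ) * (x - t) ^ r‖ ≤ M * |s - t| ^ ℓ := by
      intro x hx
      have hM0 : 0 ≤ M := (abs_nonneg _).trans (hM t ht)
      refine (ih' x (hseg hx)).trans ?_
      rw [segment_eq_uIcc] at hx
      exact mul_le_mul_of_nonneg_left
        (pow_le_pow_left₀ (abs_nonneg _) (Set.abs_sub_left_of_mem_uIcc hx) ℓ) hM0
    have := (convex_segment t s).norm_image_sub_le_of_norm_hasDerivWithin_le
      (f := fun x => g x - T x) (fun x hx =>
        (((hgd x (hSI (hseg hx))).hasDerivWithinAt).mono (hseg.trans hSI)).sub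
          (hT' x).hasDerivWithinAt) hbound (left_mem_segment ℝ t s) (right_mem_segment ℝ t s)
    have hTt : T t = g t := by
      simp only [hT, sub_self]
      rw [Finset.sum_eq_single_of_mem 0 (by simp)]
      · simp
      · intro r _ hr
        simp [hr]
    simp only [hTt, sub_self, sub_zero, Real.norm_eq_abs] at this
    rw [pow_succ, ← mul_assoc]
    exact this

/-- The weights reproduce the Taylor polynomial of order `⌊β⌋` at `t` exactly, so only the remainder
is left. It is at most `L h^β` on the window, outside of which the weights vanish. -/
theorem abs_sum_lpWeight_mul_sub_le {m : ℕ} {K : ℝ → ℝ} {τ : Fin m → ℝ}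
    {h t lam Kmax β L : ℝ} {g : ℝ → ℝ} (hβ : 0 < β)
    (hτ : ∀ k, τ k ∈ Set.Icc (0 : ℝ) 1) (hh : 0 < h) (hlam : 0 < lam) (hK : LPKernel K Kmax)
    (hspec : ∀ r ∈ spectrum ℝ (designMatrix ⌊β⌋₊ K τ h t), lam ≤ r)
    (ht : t ∈ Set.Icc (0 : ℝ) 1) (hL : 0 < L)
    (hg : ∀ k < ⌊β⌋₊, DifferentiableOn ℝ (iteratedDerivWithin k g (Set.Icc 0 1)) (Set.Icc 0 1))
    (hgL : ∀ s ∈ Set.Icc (0 : ℝ) 1, |iteratedDerivWithin ⌊β⌋₊ g (Set.Icc 0 1) s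
      - iteratedDerivWithin ⌊β⌋₊ g (Set.Icc 0 1) t| ≤ L * |s - t| ^ (β - ⌊β⌋₊)) :
    |∑ k, lpWeight ⌊β⌋₊ K τ h t k * g (τ k) - g t| ≤
      (∑ k, |lpWeight ⌊β⌋₊ K τ h t k|) * (L * h ^ β) := by
  set w := lpWeight ⌊β⌋₊ K τ h t with hw
  set T : ℝ → ℝ := fun s => ∑ r ∈ Finset.range (⌊β⌋₊ + 1),
    iteratedDerivWithin r g (Set.Icc 0 1) t / (r.factorial : ℝ) * (s - t) ^ r with hT
  have hwT : ∑ k, w k * T (τ k) = g t := by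
    simp only [hT, Finset.mul_sum]
    rw [Finset.sum_comm, Finset.sum_eq_single_of_mem 0 (by simp)]
    · have := sum_lpWeight_mul_pow hlam hspec (Nat.zero_le ⌊β⌋₊)
      simp only [pow_zero, mul_one, if_true] at this
      simp only [Nat.factorial_zero, Nat.cast_one, div_one, pow_zero, mul_one,
        iteratedDerivWithin_zero, ← Finset.sum_mul]
      rw [this, one_mul]
    · intro r hr hr0
      have := sum_lpWeight_mul_pow hlam hspec (Nat.lt_succ_iff.1 (Finset.mem_range.1 hr))
      rw [if_neg hr0] at this
      calc _ = ∑ k, (iteratedDerivWithin r g (Set.Icc 0 1) t / (r.factorial : ℝ) * h ^ r) *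
            (w k * ((τ k - t) / h) ^ r) := Finset.sum_congr rfl fun k _ => by
              rw [div_pow]; field_simp
        _ = 0 := by rw [← Finset.mul_sum, this, mul_zero]
  have hfloor : (⌊β⌋₊ : ℝ) ≤ β := Nat.floor_le hβ.le
  have htaylor : ∀ s ∈ Set.Icc (0 : ℝ) 1, |s - t| ≤ h → |g s - T s| ≤ L * h ^ β := by
    intro s hs hsh
    have hsub : Set.uIcc t s ⊆ Set.Icc 0 1 := Set.uIcc_subset_Icc ht hs
    have := abs_sub_taylorWithinEval_le_of_abs_sub_le
      (convex_uIcc t s) hsub (Set.left_mem_uIcc) (M := L * h ^ (β - ⌊β⌋₊)) ⌊β⌋₊ g hg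
      (fun x hx => (hgL x (hsub hx)).trans (by
        gcongr
        exact (Set.abs_sub_left_of_mem_uIcc hx).trans hsh)) s Set.right_mem_uIcc
    refine this.trans ?_
    calc L * h ^ (β - ⌊β⌋₊) * |s - t| ^ ⌊β⌋₊ ≤ L * h ^ (β - ⌊β⌋₊) * h ^ ⌊β⌋₊ := by gcongr
      _ = L * h ^ β := by
        rw [mul_assoc, ← Real.rpow_natCast h, ← Real.rpow_add hh]
        congr 2
        ring
  rw [← hwT, ← Finset.sum_sub_distrib, Finset.sum_mul]
  refine (Finset.abs_sum_le_sum_abs _ _).trans (Finset.sum_le_sum fun k _ => ?_)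
  rw [← mul_sub, abs_mul]
  by_cases hk : h < |τ k - t|
  · rw [hw, lpWeight_eq_zero hh hK hk]; simp
  · exact mul_le_mul_of_nonneg_left (htaylor _ (hτ k) (not_lt.1 hk)) (abs_nonneg _)

/-! ### Concentration for independent noise on the edges of a graph -/

/-- Unordered pairs of nodes, loops included. -/
abbrev Edge (n : ℕ) : Type := {p : Fin n × Fin n // p.1 ≤ p.2}

/-- The edge joining `i` and `j`. -/
def edge {n : ℕ} (i j : Fin n) : Edge n := ⟨(min i j, max i j), min_le_max⟩

theorem edge_eq_edge_iff {n : ℕ} {i j k l : Fin n} :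
    edge i j = edge k l ↔ (i = k ∧ j = l) ∨ (i = l ∧ j = k) := by
  simp only [edge, Subtype.mk.injEq, Prod.mk.injEq]
  constructor
  · intro h
    rcases le_total i j with h1 | h1 <;> rcases le_total k l with h2 | h2 <;>
      simp_all
  · rintro (⟨rfl, rfl⟩ | ⟨rfl, rfl⟩)
    · simp
    · simp [min_comm, max_comm]

theorem edge_injective {n : ℕ} (i : Fin n) : Function.Injective (edge i) := by
  intro j j' h
  rcases edge_eq_edge_iff.1 h with h | h
  · exact h.2
  · exact h.2.trans h.1

/-- Independent centered noise on edges, bounded by `S` and with variances at most `v`. -/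
structure IsEdgeNoise {Ω : Type*} [MeasurableSpace Ω] (μ : Measure Ω) {n : ℕ}
    (X : Edge n → Ω → ℝ) (S v : ℝ) : Prop where
  indep : iIndepFun X μ
  measurable : ∀ e, Measurable (X e)
  bound : ∀ e ω, |X e ω| ≤ S
  centered : ∀ e, ∫ ω, X e ω ∂μ = 0
  variance_le : ∀ e, ∫ ω, X e ω ^ 2 ∂μ ≤ v

namespace IsEdgeNoise

variable {Ω : Type*} [MeasurableSpace Ω] {μ : Measure Ω} [IsProbabilityMeasure μ] {n : ℕ}
  {X : Edge n → Ω → ℝ} {S v A : ℝ}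

/-- Bernstein's inequality for the centered squares, whose variance is at most `E X⁴ ≤ S² v`. -/
theorem measureReal_row_sq_ge_le (hX : IsEdgeNoise μ X S v) (hS : 0 < S) (hA : 0 ≤ A)
    (i : Fin n) :
    μ.real {ω | n * v + (2 * √(n * (S ^ 2 * v) * A) + 2 * S ^ 2 * A) ≤
      ∑ j, X (edge i j) ω ^ 2} ≤ Real.exp (-A) := by
  set Y : Edge n → Ω → ℝ := fun e ω => X e ω ^ 2 - ∫ ω, X e ω ^ 2 ∂μ with hY
  have hm := hX.measurable
  have hsq : ∀ e ω, X e ω ^ 2 ≤ S ^ 2 := fun e ω => sq_le_sq' (abs_le.1 (hX.bound e ω)).1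
    (abs_le.1 (hX.bound e ω)).2
  have hint : ∀ e, Integrable (fun ω => X e ω ^ 2) μ := fun e =>
    integrable_of_abs_le (M := S ^ 2) (by fun_prop) fun ω => by
      rw [abs_of_nonneg (sq_nonneg _)]; exact hsq e ω
  have hint4 : ∀ e, Integrable (fun ω => (X e ω ^ 2) ^ 2) μ := fun e =>
    integrable_of_abs_le (M := (S ^ 2) ^ 2) (by fun_prop) fun ω => by
      rw [abs_of_nonneg (sq_nonneg _)]; exact pow_le_pow_left₀ (sq_nonneg _) (hsq e ω) 2
  have hI0 : ∀ e, 0 ≤ ∫ ω, X e ω ^ 2 ∂μ := fun e => integral_nonneg fun ω => sq_nonneg _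
  have hIS : ∀ e, ∫ ω, X e ω ^ 2 ∂μ ≤ S ^ 2 := fun e => by
    have := integral_mono (hint e) (integrable_const (S ^ 2)) (hsq e)
    simpa using this
  have hind : iIndepFun (fun j => Y (edge i j)) μ :=
    (hX.indep.comp (fun e x => x ^ 2 - ∫ ω, X e ω ^ 2 ∂μ) (fun e => by fun_prop)).precomp
      (edge_injective i)
  have hYm : ∀ j, Measurable (Y (edge i j)) := fun j => by
    have := hm (edge i j)
    simp only [hY]
    fun_prop
  have hYsq : ∀ e, ∫ ω, Y e ω ^ 2 ∂μ ≤ S ^ 2 * v := fun e => by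
    set c := ∫ ω, X e ω ^ 2 ∂μ with hc
    have h1 : ∀ ω, Y e ω ^ 2 = (X e ω ^ 2) ^ 2 - 2 * c * X e ω ^ 2 + c ^ 2 := fun ω => by
      simp only [hY]; ring
    calc ∫ ω, Y e ω ^ 2 ∂μ = ∫ ω, ((X e ω ^ 2) ^ 2 - 2 * c * X e ω ^ 2 + c ^ 2) ∂μ :=
          integral_congr_ae (ae_of_all _ h1)
      _ = ∫ ω, (X e ω ^ 2) ^ 2 ∂μ - c ^ 2 := by
          have h2 : Integrable (fun ω => (X e ω ^ 2) ^ 2 - 2 * c * X e ω ^ 2) μ :=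
            (hint4 e).sub ((hint e).const_mul _)
          rw [integral_add h2 (integrable_const _),
            integral_sub (hint4 e) ((hint e).const_mul _), integral_const_mul, ← hc]
          simp
          ring
      _ ≤ ∫ ω, (X e ω ^ 2) ^ 2 ∂μ := by linarith [sq_nonneg c]
      _ ≤ ∫ ω, S ^ 2 * X e ω ^ 2 ∂μ := integral_mono (hint4 e) ((hint e).const_mul _) fun ω => by
          simp only [sq (X e ω ^ 2)]
          exact mul_le_mul_of_nonneg_right (hsq e ω) (sq_nonneg _)
      _ ≤ S ^ 2 * v := by
          rw [integral_const_mul]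
          exact mul_le_mul_of_nonneg_left (hX.variance_le e) (sq_nonneg _)
  have key := bernstein_upper (s := Finset.univ) (mgf_sum_of_iIndepFun hind hYm _) hYm
    (M := S ^ 2) (V := n * (S ^ 2 * v)) (A := A) (by positivity)
    (fun j _ ω => by
      simp only [hY]
      rw [abs_le]
      constructor
      · linarith [sq_nonneg (X (edge i j) ω), hIS (edge i j)]
      · linarith [hsq (edge i j) ω, hI0 (edge i j)])
    (fun j _ => by
      simp only [hY]
      rw [integral_sub (hint _) (integrable_const _)]
      simp)
    ((Finset.sum_le_sum fun j _ => hYsq (edge i j)).trans (by simp)) hA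
  refine (measureReal_mono ?_).trans key
  intro ω hω
  simp only [Set.mem_ofPred_eq, hY, Finset.sum_sub_distrib] at hω ⊢
  have : ∑ j, ∫ ω, X (edge i j) ω ^ 2 ∂μ ≤ n * v :=
    (Finset.sum_le_sum fun j _ => hX.variance_le (edge i j)).trans (by simp)
  linarith

/-- Meant for `x` a row of the conditional mean, which is deterministic once the latent positions
are given. -/
theorem measureReal_row_dot_ge_le (hX : IsEdgeNoise μ X S v) (hS : 0 < S) (hA : 0 ≤ A)
    (i : Fin n) {c : ℝ} (hc : 0 < c) {x : Fin n → ℝ} (hx : ∀ j, |x j| ≤ c) :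
    μ.real {ω | 2 * √(n * (c ^ 2 * v) * A) + 2 * (S * c) * A ≤ |∑ j, X (edge i j) ω * x j|} ≤
      2 * Real.exp (-A) := by
  have hm := hX.measurable
  have hind0 : iIndepFun (fun j => X (edge i j)) μ := hX.indep.precomp (edge_injective i)
  have hind : iIndepFun (fun j ω => X (edge i j) ω * x j) μ :=
    hind0.comp (fun j y => y * x j) (fun j => by fun_prop)
  have hYm : ∀ j, Measurable fun ω => X (edge i j) ω * x j := fun j => by fun_prop
  refine bernstein_abs (s := Finset.univ) (mgf_sum_of_iIndepFun hind hYm _) hYm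
    (M := S * c) (V := n * (c ^ 2 * v)) (A := A) (by positivity) (fun j _ ω => ?_)
    (fun j _ => ?_) ?_ hA
  · rw [abs_mul]
    exact mul_le_mul (hX.bound _ ω) (hx j) (abs_nonneg _) hS.le
  · rw [integral_mul_const, hX.centered, zero_mul]
  · calc ∑ j, ∫ ω, (X (edge i j) ω * x j) ^ 2 ∂μ ≤ ∑ _j : Fin n, c ^ 2 * v :=
          Finset.sum_le_sum fun j _ => by
            simp only [mul_pow]
            rw [integral_mul_const, mul_comm]
            exact mul_le_mul (sq_le_sq' (abs_le.1 (hx j)).1 (abs_le.1 (hx j)).2)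
              (hX.variance_le _) (integral_nonneg fun ω => sq_nonneg _) (sq_nonneg _)
      _ = n * (c ^ 2 * v) := by simp

/-- Distinct rows `i` and `l` share only the edge joining `i` and `l`. For `j` outside `{i, l}` the
products use disjoint pairs of edges, so Bernstein applies with variances at most `v²`; the two
omitted products cost `2 S²`. -/
theorem measureReal_row_row_ge_le (hX : IsEdgeNoise μ X S v) (hS : 0 < S) (hA : 0 ≤ A)
    {i l : Fin n} (hil : i ≠ l) :
    μ.real {ω | 2 * √(n * v ^ 2 * A) + 2 * S ^ 2 * A + 2 * S ^ 2 ≤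
      |∑ j, X (edge i j) ω * X (edge l j) ω|} ≤ 2 * Real.exp (-A) := by
  have hm := hX.measurable
  set s : Finset (Fin n) := Finset.univ.filter fun j => j ≠ i ∧ j ≠ l with hs
  have hv : 0 ≤ v := (integral_nonneg fun ω => sq_nonneg _).trans (hX.variance_le (edge i l))
  have hYm : ∀ j, Measurable fun ω => X (edge i j) ω * X (edge l j) ω := fun j => by fun_prop
  have hmem : ∀ {j}, j ∈ s → j ≠ i ∧ j ≠ l := fun hj => (Finset.mem_filter.1 hj).2
  have hne : ∀ {j j'}, j ∈ s → j' ∈ s → edge i j ≠ edge l j' := fun {j j'} hj hj' e => by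
    rcases edge_eq_edge_iff.1 e with h | h
    · exact hil h.1
    · exact (hmem hj).2 h.2
  have hmgf := mgf_sum_mul_of_iIndepFun hX.indep hm s (edge i) (edge l)
    ((edge_injective i).injOn) ((edge_injective l).injOn) (fun j hj j' hj' => hne hj hj')
  have hindep : ∀ j ∈ s, IndepFun (X (edge i j)) (X (edge l j)) μ := fun j hj =>
    hX.indep.indepFun (hne hj hj)
  have habs : ∀ j ω, |X (edge i j) ω * X (edge l j) ω| ≤ S ^ 2 := fun j ω => by
    rw [abs_mul, sq]
    exact mul_le_mul (hX.bound _ ω) (hX.bound _ ω) (abs_nonneg _) hS.le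
  have key := bernstein_abs (s := s) (μ := μ) hmgf hYm (M := S ^ 2) (V := n * v ^ 2) (A := A)
    (by positivity) (fun j _ ω => habs j ω)
    (fun j hj => by
      rw [(hindep j hj).integral_fun_mul_eq_mul_integral (hm _).aestronglyMeasurable
        (hm _).aestronglyMeasurable, hX.centered, zero_mul])
    (by
      calc ∑ j ∈ s, ∫ ω, (X (edge i j) ω * X (edge l j) ω) ^ 2 ∂μ ≤ ∑ _j ∈ s, v ^ 2 :=
            Finset.sum_le_sum fun j hj => by
              have h2 : IndepFun (fun ω => X (edge i j) ω ^ 2) (fun ω => X (edge l j) ω ^ 2) μ :=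
                (hindep j hj).comp (φ := fun x => x ^ 2) (ψ := fun x => x ^ 2) (by fun_prop)
                  (by fun_prop)
              simp only [mul_pow]
              rw [h2.integral_fun_mul_eq_mul_integral (by fun_prop) (by fun_prop), sq]
              exact mul_le_mul (hX.variance_le _) (hX.variance_le _)
                (integral_nonneg fun ω => sq_nonneg _) hv
        _ = s.card * v ^ 2 := by simp
        _ ≤ n * v ^ 2 := by
            gcongr
            exact_mod_cast (Finset.card_le_univ s).trans (by simp)) hA
  refine (measureReal_mono ?_).trans key
  intro ω hω
  simp only [Set.mem_ofPred_eq] at hω ⊢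
  have hsplit : ∑ j, X (edge i j) ω * X (edge l j) ω =
      ∑ j ∈ s, X (edge i j) ω * X (edge l j) ω +
        ∑ j ∈ ({i, l} : Finset (Fin n)), X (edge i j) ω * X (edge l j) ω := by
    rw [hs, ← Finset.sum_filter_add_sum_filter_not Finset.univ fun j => j ≠ i ∧ j ≠ l]
    congr 1
    refine Finset.sum_congr ?_ fun _ _ => rfl
    ext j
    simp only [Finset.mem_filter, Finset.mem_univ, true_and, Finset.mem_insert,
      Finset.mem_singleton]
    tauto
  have hpair : |∑ j ∈ ({i, l} : Finset (Fin n)), X (edge i j) ω * X (edge l j) ω| ≤ 2 * S ^ 2 := by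
    rw [Finset.sum_pair hil]
    refine (abs_add_le _ _).trans ?_
    linarith [habs i ω, habs l ω]
  rw [hsplit] at hω
  linarith [abs_add_le (∑ j ∈ s, X (edge i j) ω * X (edge l j) ω)
    (∑ j ∈ ({i, l} : Finset (Fin n)), X (edge i j) ω * X (edge l j) ω)]

end IsEdgeNoise

/-! ### The conditional law of the networks given the latent positions -/

/-- The Bernoulli distribution on `Bool`. -/
def bernoulliLaw (p : unitInterval) : Measure Bool :=
  ENNReal.ofReal p • Measure.dirac true + ENNReal.ofReal (1 - p) • Measure.dirac false

theorem bernoulliLaw_singleton (p : unitInterval) (b : Bool) :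
    bernoulliLaw p {b} = ENNReal.ofReal (bernoulliWeight p b) := by
  cases b <;> simp [bernoulliLaw, bernoulliWeight]

instance (p : unitInterval) : IsProbabilityMeasure (bernoulliLaw p) := by
  constructor
  simp only [bernoulliLaw, Measure.coe_add, Measure.coe_smul, Pi.add_apply, Pi.smul_apply,
    measure_univ, smul_eq_mul, mul_one]
  rw [← ENNReal.ofReal_add p.2.1 (by linarith [p.2.2])]
  simp

theorem integral_bernoulliLaw (p : unitInterval) (g : Bool → ℝ) :
    ∫ b, g b ∂(bernoulliLaw p) = p * g true + (1 - p) * g false := by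
  have h1 : Integrable g (ENNReal.ofReal (p : ℝ) • Measure.dirac true) :=
    Integrable.of_finite.smul_measure ENNReal.ofReal_ne_top
  have h2 : Integrable g (ENNReal.ofReal (1 - p : ℝ) • Measure.dirac false) :=
    Integrable.of_finite.smul_measure ENNReal.ofReal_ne_top
  rw [bernoulliLaw, integral_add_measure h1 h2, integral_smul_measure, integral_smul_measure,
    integral_dirac, integral_dirac, ENNReal.toReal_ofReal p.2.1,
    ENNReal.toReal_ofReal (by linarith [p.2.2]), smul_eq_mul, smul_eq_mul]

section EdgeNoise

variable {m : ℕ} (w : Fin m → ℝ) (q : Fin m → unitInterval)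

/-- The weighted sum over time of the centered indicators of one edge. -/
def edgeNoise (v : Fin m → Bool) : ℝ := ∑ k, w k * ((if v k then 1 else 0) - (q k : ℝ))

theorem abs_indicator_sub_le_one (p : unitInterval) (b : Bool) :
    |(if b then 1 else 0) - (p : ℝ)| ≤ 1 := by
  have h1 := p.2.1
  have h2 := p.2.2
  rw [abs_le]
  cases b <;> constructor <;> simp <;> linarith

theorem abs_edgeNoise_le (v : Fin m → Bool) : |edgeNoise w q v| ≤ ∑ k, |w k| := by
  refine (Finset.abs_sum_le_sum_abs _ _).trans (Finset.sum_le_sum fun k _ => ?_)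
  rw [abs_mul]
  exact mul_le_of_le_one_right (abs_nonneg _) (abs_indicator_sub_le_one _ _)

theorem integral_pi_eval {ι : Type*} [Fintype ι] {E : ι → Type*} [∀ i, MeasurableSpace (E i)]
    (μ : ∀ i, Measure (E i)) [∀ i, IsProbabilityMeasure (μ i)] (i : ι) {g : E i → ℝ}
    (hg : Measurable g) :
    ∫ v, g (v i) ∂(Measure.pi μ) = ∫ x, g x ∂(μ i) := by
  have h := measurePreserving_eval μ i
  rw [← h.map_eq, integral_map h.measurable.aemeasurable (by fun_prop)]

theorem integral_centered_indicator (k : Fin m) :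
    ∫ v, w k * ((if v k then 1 else 0) - (q k : ℝ))
      ∂(Measure.pi fun k => bernoulliLaw (q k)) = 0 := by
  rw [integral_pi_eval (fun k => bernoulliLaw (q k)) k
    (g := fun b => w k * ((if b then 1 else 0) - (q k : ℝ))) (Measurable.of_discrete),
    integral_bernoulliLaw]
  simp
  ring

theorem integral_centered_indicator_sq_le (k : Fin m) :
    ∫ v, (w k * ((if v k then 1 else 0) - (q k : ℝ))) ^ 2
      ∂(Measure.pi fun k => bernoulliLaw (q k)) ≤ w k ^ 2 * q k := by
  rw [integral_pi_eval (fun k => bernoulliLaw (q k)) k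
    (g := fun b => (w k * ((if b then 1 else 0) - (q k : ℝ))) ^ 2) (Measurable.of_discrete),
    integral_bernoulliLaw]
  simp only [if_true, Bool.false_eq_true, if_false]
  have h1 := (q k).2.1
  have : w k ^ 2 * q k - ((q k : ℝ) * (w k * (1 - (q k : ℝ))) ^ 2 +
      (1 - (q k : ℝ)) * (w k * (0 - (q k : ℝ))) ^ 2) = w k ^ 2 * (q k : ℝ) ^ 2 := by ring
  have h2 : 0 ≤ w k ^ 2 * (q k : ℝ) ^ 2 := by positivity
  linarith

theorem iIndepFun_centered_indicator :
    iIndepFun (fun k (v : Fin m → Bool) => w k * ((if v k then 1 else 0) - (q k : ℝ)))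
      (Measure.pi fun k => bernoulliLaw (q k)) :=
  iIndepFun_pi (X := fun k (b : Bool) => w k * ((if b then 1 else 0) - (q k : ℝ)))
    fun _ => (Measurable.of_discrete).aemeasurable

theorem integral_edgeNoise :
    ∫ v, edgeNoise w q v ∂(Measure.pi fun k => bernoulliLaw (q k)) = 0 := by
  simp only [edgeNoise]
  rw [integral_finsetSum _ fun k _ => Integrable.of_finite]
  exact Finset.sum_eq_zero fun k _ => integral_centered_indicator w q k

theorem integral_edgeNoise_sq_le {ρ S₂ : ℝ} (hq : ∀ k, (q k : ℝ) ≤ ρ) (hρ : 0 ≤ ρ)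
    (hw : ∑ k, w k ^ 2 ≤ S₂) :
    ∫ v, edgeNoise w q v ^ 2 ∂(Measure.pi fun k => bernoulliLaw (q k)) ≤ ρ * S₂ := by
  set μ := Measure.pi fun k => bernoulliLaw (q k) with hμ
  set X : Fin m → (Fin m → Bool) → ℝ :=
    fun k v => w k * ((if v k then 1 else 0) - (q k : ℝ)) with hX
  have hLp : ∀ k, MemLp (X k) 2 μ := fun k => MemLp.of_discrete
  have h1 : ∫ v, edgeNoise w q v ^ 2 ∂μ = variance (∑ k, X k) μ := by
    have e : (∑ k, X k) = edgeNoise w q := by ext v; simp [edgeNoise, hX]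
    rw [e, variance_of_integral_eq_zero (Measurable.of_discrete).aemeasurable
      (integral_edgeNoise w q)]
  rw [h1, IndepFun.variance_sum (fun k _ => hLp k)
    fun k _ k' _ hkk' => (iIndepFun_centered_indicator w q).indepFun hkk']
  calc ∑ k, variance (X k) μ ≤ ∑ k, w k ^ 2 * ρ := Finset.sum_le_sum fun k _ => by
        rw [variance_of_integral_eq_zero (Measurable.of_discrete).aemeasurable
          (integral_centered_indicator w q k)]
        exact (integral_centered_indicator_sq_le w q k).trans
          (mul_le_mul_of_nonneg_left (hq k) (sq_nonneg _))
    _ = ρ * ∑ k, w k ^ 2 := by rw [← Finset.sum_mul, mul_comm]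
    _ ≤ ρ * S₂ := mul_le_mul_of_nonneg_left hw hρ

/-- Bernstein's inequality over the times of a single edge. Its linear term involves the largest
weight instead of the total weight, which is the precision needed for the entrywise bound of the
sparse regime. -/
theorem measureReal_edgeNoise_ge_le {ρ S₂ W A : ℝ} (hq : ∀ k, (q k : ℝ) ≤ ρ) (hρ : 0 ≤ ρ)
    (hw : ∑ k, w k ^ 2 ≤ S₂) (hW : 0 < W) (hwW : ∀ k, |w k| ≤ W) (hA : 0 ≤ A) :
    (Measure.pi fun k => bernoulliLaw (q k)).real
      {v | 2 * √(ρ * S₂ * A) + 2 * W * A ≤ |edgeNoise w q v|} ≤ 2 * Real.exp (-A) := by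
  refine bernstein_abs (s := Finset.univ)
    (mgf_sum_of_iIndepFun (iIndepFun_centered_indicator w q) (fun k => Measurable.of_discrete) _)
    (fun k => Measurable.of_discrete) hW (fun k _ v => ?_)
    (fun k _ => integral_centered_indicator w q k) ?_ hA
  · rw [abs_mul]
    exact (mul_le_of_le_one_right (abs_nonneg _) (abs_indicator_sub_le_one _ _)).trans (hwW k)
  · calc _ ≤ ∑ k, w k ^ 2 * ρ := Finset.sum_le_sum fun k _ =>
          (integral_centered_indicator_sq_le w q k).trans
            (mul_le_mul_of_nonneg_left (hq k) (sq_nonneg _))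
      _ = ρ * ∑ k, w k ^ 2 := by rw [← Finset.sum_mul, mul_comm]
      _ ≤ ρ * S₂ := mul_le_mul_of_nonneg_left hw hρ

end EdgeNoise

/-- The joint law of independent Bernoulli variables indexed by edges and times. -/
def networkLaw {n m : ℕ} (q : Edge n → Fin m → unitInterval) : Measure (Edge n → Fin m → Bool) :=
  Measure.pi fun e => Measure.pi fun k => bernoulliLaw (q e k)

instance {n m : ℕ} (q : Edge n → Fin m → unitInterval) : IsProbabilityMeasure (networkLaw q) := by
  unfold networkLaw; infer_instance

theorem isEdgeNoise_networkLaw {n m : ℕ} (q : Edge n → Fin m → unitInterval) (w : Fin m → ℝ)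
    {ρ S S₂ : ℝ} (hq : ∀ e k, (q e k : ℝ) ≤ ρ) (hρ : 0 ≤ ρ) (hS : ∑ k, |w k| ≤ S)
    (hw : ∑ k, w k ^ 2 ≤ S₂) :
    IsEdgeNoise (networkLaw q) (fun e a => edgeNoise w (q e) (a e)) S (ρ * S₂) where
  indep := iIndepFun_pi (μ := fun e => Measure.pi fun k => bernoulliLaw (q e k))
    (X := fun e v => edgeNoise w (q e) v) fun e => (Measurable.of_discrete).aemeasurable
  measurable e := Measurable.of_discrete
  bound e a := (abs_edgeNoise_le w (q e) (a e)).trans hS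
  centered e := by
    have := integral_pi_eval (fun e => Measure.pi fun k => bernoulliLaw (q e k)) e
      (g := edgeNoise w (q e)) Measurable.of_discrete
    exact this.trans (integral_edgeNoise w (q e))
  variance_le e := by
    have := integral_pi_eval (fun e => Measure.pi fun k => bernoulliLaw (q e k)) e
      (g := fun v => edgeNoise w (q e) v ^ 2) Measurable.of_discrete
    exact this.trans_le (integral_edgeNoise_sq_le w (q e) (hq e) hρ hw)

theorem measureReal_networkLaw_edgeNoise_ge_le {n m : ℕ} (q : Edge n → Fin m → unitInterval)
    (w : Fin m → ℝ) {ρ S₂ W A : ℝ} (hq : ∀ e k, (q e k : ℝ) ≤ ρ) (hρ : 0 ≤ ρ)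
    (hw : ∑ k, w k ^ 2 ≤ S₂) (hW : 0 < W) (hwW : ∀ k, |w k| ≤ W) (hA : 0 ≤ A) (e : Edge n) :
    (networkLaw q).real {a | 2 * √(ρ * S₂ * A) + 2 * W * A ≤ |edgeNoise w (q e) (a e)|} ≤
      2 * Real.exp (-A) := by
  have h := measurePreserving_eval (fun e => Measure.pi fun k => bernoulliLaw (q e k)) e
  have := measureReal_edgeNoise_ge_le w (q e) (hq e) hρ hw hW hwW hA
  rw [← h.map_eq, map_measureReal_apply h.measurable (MeasurableSet.of_discrete)] at this
  exact this

theorem networkLaw_singleton {n m : ℕ} (q : Edge n → Fin m → unitInterval)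
    (a : Edge n → Fin m → Bool) :
    networkLaw q {a} = ENNReal.ofReal (∏ e, ∏ k, bernoulliWeight (q e k) (a e k)) := by
  have hb : ∀ (p : unitInterval) b, 0 ≤ bernoulliWeight p b := fun p b => by
    have h1 := p.2.1
    have h2 := p.2.2
    cases b <;> simp [bernoulliWeight] <;> linarith
  rw [networkLaw, ← Set.univ_pi_singleton, Measure.pi_pi,
    ENNReal.ofReal_prod_of_nonneg fun e _ => Finset.prod_nonneg fun k _ => hb _ _]
  refine Finset.prod_congr rfl fun e _ => ?_
  rw [← Set.univ_pi_singleton, Measure.pi_pi, ENNReal.ofReal_prod_of_nonneg fun k _ => hb _ _]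
  exact Finset.prod_congr rfl fun k _ => bernoulliLaw_singleton _ _

/-- The extension of `ρ f(·,·,t)` from the cube to all real arguments by projection, with values in
`[0,1]`. -/
def linkProb {f : ℝ → ℝ → ℝ → ℝ} (hf : IsTimeVaryingGraphon f) {ρ : ℝ} (hρ : ρ ∈ Set.Icc (0 : ℝ) 1)
    (x y t : ℝ) : unitInterval :=
  ⟨ρ * f (Set.projIcc (0 : ℝ) 1 zero_le_one x) (Set.projIcc (0 : ℝ) 1 zero_le_one y)
      (Set.projIcc (0 : ℝ) 1 zero_le_one t), by
    have := hf.mem_Icc _ (Set.projIcc (0 : ℝ) 1 zero_le_one x).2 _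
      (Set.projIcc (0 : ℝ) 1 zero_le_one y).2 _ (Set.projIcc (0 : ℝ) 1 zero_le_one t).2
    exact ⟨mul_nonneg hρ.1 this.1, mul_le_one₀ hρ.2 this.1 this.2⟩⟩

section LinkProb

variable {f : ℝ → ℝ → ℝ → ℝ} (hf : IsTimeVaryingGraphon f) {ρ : ℝ} (hρ : ρ ∈ Set.Icc (0 : ℝ) 1)

theorem linkProb_of_mem {x y t : ℝ} (hx : x ∈ Set.Icc (0 : ℝ) 1) (hy : y ∈ Set.Icc (0 : ℝ) 1)
    (ht : t ∈ Set.Icc (0 : ℝ) 1) : (linkProb hf hρ x y t : ℝ) = ρ * f x y t := by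
  simp only [linkProb, Set.projIcc_of_mem zero_le_one hx, Set.projIcc_of_mem zero_le_one hy,
    Set.projIcc_of_mem zero_le_one ht]

theorem linkProb_le (x y t : ℝ) : (linkProb hf hρ x y t : ℝ) ≤ ρ :=
  mul_le_of_le_one_right hρ.1 (hf.mem_Icc _ (Set.projIcc (0 : ℝ) 1 zero_le_one x).2 _
      (Set.projIcc (0 : ℝ) 1 zero_le_one y).2 _ (Set.projIcc (0 : ℝ) 1 zero_le_one t).2).2

theorem linkProb_comm (x y t : ℝ) : linkProb hf hρ x y t = linkProb hf hρ y x t := by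
  refine Subtype.ext ?_
  exact congrArg (ρ * ·) (hf.symm _ (Set.projIcc (0 : ℝ) 1 zero_le_one x).2 _
      (Set.projIcc (0 : ℝ) 1 zero_le_one y).2 _ (Set.projIcc (0 : ℝ) 1 zero_le_one t).2)

theorem measurable_linkProb (t : ℝ) :
    Measurable fun p : ℝ × ℝ => (linkProb hf hρ p.1 p.2 t : ℝ) := by
  have h1 : Measurable fun p : ℝ × ℝ => ((Set.projIcc (0 : ℝ) 1 zero_le_one p.1,
      Set.projIcc (0 : ℝ) 1 zero_le_one p.2, Set.projIcc (0 : ℝ) 1 zero_le_one t) :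
        unitInterval × unitInterval × unitInterval) :=
    (continuous_projIcc.measurable.comp measurable_fst).prodMk
      ((continuous_projIcc.measurable.comp measurable_snd).prodMk measurable_const)
  exact (hf.measurable.comp h1).const_mul ρ

/-- The edge probabilities at latent positions `x`. -/
def edgeProb {n m : ℕ} (τ : Fin m → ℝ) (x : Fin n → ℝ) (e : Edge n) (k : Fin m) : unitInterval :=
  linkProb hf hρ (x e.1.1) (x e.1.2) (τ k)

theorem edgeProb_edge {n m : ℕ} (τ : Fin m → ℝ) (x : Fin n → ℝ) (i j : Fin n) (k : Fin m) :
    edgeProb hf hρ τ x (edge i j) k = linkProb hf hρ (x i) (x j) (τ k) := by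
  rcases le_total i j with h | h
  · simp [edgeProb, edge, h]
  · simp only [edgeProb, edge, min_eq_right h, max_eq_left h]
    exact linkProb_comm hf hρ _ _ _

theorem IsSparseGraphonNetwork.ae_mem_Icc {Ω : Type*} [MeasurableSpace Ω]
    {μ : Measure Ω} {n m : ℕ} {f : ℝ → ℝ → ℝ → ℝ} {ρ : ℝ} {τ : Fin m → ℝ} {ξ : Fin n → Ω → ℝ}
    {A : Fin m → Fin n → Fin n → Ω → Bool} (hN : IsSparseGraphonNetwork μ f ρ τ ξ A) :
    ∀ᵐ ω ∂μ, ∀ i, ξ i ω ∈ Set.Icc (0 : ℝ) 1 := by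
  rw [ae_all_iff]
  intro i
  have : ∀ᵐ x ∂(μ.map (ξ i)), x ∈ Set.Icc (0 : ℝ) 1 := by
    rw [hN.uniform_latent i]
    exact ae_restrict_mem measurableSet_Icc
  exact ae_of_ae_map (hN.measurable_latent i).aemeasurable this

/-- A bound on the conditional probability of an event, uniform in the latent positions, is a bound
on its probability. -/
theorem IsSparseGraphonNetwork.measure_le_of_forall_networkLaw_le {Ω : Type*} [MeasurableSpace Ω]
    {μ : Measure Ω} [IsProbabilityMeasure μ] {n m : ℕ} {τ : Fin m → ℝ} {ξ : Fin n → Ω → ℝ}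
    {A : Fin m → Fin n → Fin n → Ω → Bool} (hτ : ∀ k, τ k ∈ Set.Icc (0 : ℝ) 1)
    (hN : IsSparseGraphonNetwork μ f ρ τ ξ A)
    (bad : (Fin n → ℝ) → Set (Edge n → Fin m → Bool))
    (hbad : ∀ a, MeasurableSet {x | a ∈ bad x}) {ε : ℝ}
    (hε : ∀ x, (networkLaw (edgeProb hf hρ τ x)).real (bad x) ≤ ε) :
    μ {ω | (fun e k => A k e.1.1 e.1.2 ω) ∈ bad fun i => ξ i ω} ≤ ENNReal.ofReal ε := by
  classical
  set Ξ : Ω → Fin n → ℝ := fun ω i => ξ i ω with hΞ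
  have hΞm : Measurable Ξ := measurable_pi_lambda _ hN.measurable_latent
  have hcube := hN.ae_mem_Icc
  -- There are finitely many adjacency configurations; the event is split according to the observed
  -- one, and the assumed joint law applies to each piece.
  have hcover : {ω | (fun e k => A k e.1.1 e.1.2 ω) ∈ bad (Ξ ω)} ⊆
      ⋃ a : Edge n → Fin m → Bool, {ω | Ξ ω ∈ {x | a ∈ bad x} ∧
        ∀ k i j, i ≤ j → A k i j ω = a (edge i j) k} := by
    intro ω hω
    rw [Set.mem_iUnion]
    refine ⟨fun e k => A k e.1.1 e.1.2 ω, hω, fun k i j hij => ?_⟩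
    simp [edge, hij]
  have hterm : ∀ a : Edge n → Fin m → Bool,
      μ {ω | Ξ ω ∈ {x | a ∈ bad x} ∧ ∀ k i j, i ≤ j → A k i j ω = a (edge i j) k} =
      ∫⁻ ω, (Ξ ⁻¹' {x | a ∈ bad x}).indicator
        (fun ω => networkLaw (edgeProb hf hρ τ (Ξ ω)) {a}) ω ∂μ := by
    intro a
    rw [hN.cond_law (fun k i j => a (edge i j) k) _ (hbad a),
      lintegral_indicator (hΞm (hbad a))]
    refine lintegral_congr_ae (ae_restrict_of_ae ?_)
    filter_upwards [hcube] with ω hω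
    rw [networkLaw_singleton]
    congr 1
    rw [Finset.prod_comm, Finset.prod_subtype (p := fun p : Fin n × Fin n => p.1 ≤ p.2)
      (Finset.univ.filter fun p : Fin n × Fin n => p.1 ≤ p.2) (by simp)]
    refine Finset.prod_congr rfl fun e _ => Finset.prod_congr rfl fun k _ => ?_
    have h1 : edge e.1.1 e.1.2 = e := by
      refine Subtype.ext ?_
      simp [edge, e.2]
    rw [h1, edgeProb, linkProb_of_mem hf hρ (hω _) (hω _) (hτ k)]
    rfl
  have hmeas : ∀ a : Edge n → Fin m → Bool,
      Measurable fun ω => networkLaw (edgeProb hf hρ τ (Ξ ω)) {a} := by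
    intro a
    simp only [networkLaw_singleton, edgeProb, bernoulliWeight]
    refine ENNReal.measurable_ofReal.comp ?_
    refine Finset.measurable_prod _ fun e _ => Finset.measurable_prod _ fun k _ => ?_
    have h2 : Measurable fun ω => (linkProb hf hρ (Ξ ω e.1.1) (Ξ ω e.1.2) (τ k) : ℝ) :=
      (measurable_linkProb hf hρ (τ k)).comp
        ((hN.measurable_latent e.1.1).prodMk (hN.measurable_latent e.1.2))
    split_ifs
    · exact h2
    · exact h2.const_sub 1
  calc μ {ω | (fun e k => A k e.1.1 e.1.2 ω) ∈ bad (Ξ ω)}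
      ≤ ∑ a, μ {ω | Ξ ω ∈ {x | a ∈ bad x} ∧ ∀ k i j, i ≤ j → A k i j ω = a (edge i j) k} :=
        (measure_mono hcover).trans (measure_iUnion_fintype_le _ _)
    _ = ∫⁻ ω, ∑ a, (Ξ ⁻¹' {x | a ∈ bad x}).indicator
        (fun ω => networkLaw (edgeProb hf hρ τ (Ξ ω)) {a}) ω ∂μ := by
        rw [lintegral_finsetSum _ fun a _ => (hmeas a).indicator (hΞm (hbad a))]
        exact Finset.sum_congr rfl fun a _ => hterm a
    _ ≤ ∫⁻ _ω, ENNReal.ofReal ε ∂μ := by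
        refine lintegral_mono fun ω => ?_
        -- At fixed latent positions, summing the masses of the configurations in the slice recovers
        -- its probability under the product law.
        have h3 : ∑ a, (Ξ ⁻¹' {x | a ∈ bad x}).indicator
            (fun ω => networkLaw (edgeProb hf hρ τ (Ξ ω)) {a}) ω =
            networkLaw (edgeProb hf hρ τ (Ξ ω)) (bad (Ξ ω)) := by
          have h4 : bad (Ξ ω) = (Finset.univ.filter fun a => a ∈ bad (Ξ ω) : Finset _) := by
            ext a; simp
          rw [h4, ← sum_measure_singleton, Finset.sum_filter]
          refine Finset.sum_congr rfl fun a _ => ?_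
          by_cases ha : a ∈ bad (Ξ ω) <;> simp [Set.indicator, ha]
        rw [h3]
        exact ENNReal.le_ofReal_iff_toReal_le (measure_ne_top _ _)
          (measureReal_nonneg.trans (hε (Ξ ω))) |>.2 (hε (Ξ ω))
    _ = ENNReal.ofReal ε := by simp

end LinkProb

/-! ### Occupation numbers of small cells -/

/-- Lower tail of a binomial count of mean `np`. The hypothesis `64 A ≤ np` makes the Bernstein
deviation at most `np/4 + np/32`, less than half the mean. -/
theorem measureReal_occupation_le {Ω : Type*} [MeasurableSpace Ω] {μ : Measure Ω}
    [IsProbabilityMeasure μ] {n : ℕ} {ξ : Fin n → Ω → ℝ} (hm : ∀ i, Measurable (ξ i))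
    (hind : iIndepFun ξ μ)
    (hunif : ∀ i, μ.map (ξ i) = volume.restrict (Set.Icc (0 : ℝ) 1)) {a b A : ℝ} (ha : 0 ≤ a)
    (hab : a ≤ b) (hb : b ≤ 1) (hA : 0 ≤ A) (hn : 64 * A ≤ n * (b - a)) :
    μ.real {ω | ∑ i, (Set.Ico a b).indicator (fun _ => (1 : ℝ)) (ξ i ω) ≤ n * (b - a) / 2} ≤
      Real.exp (-A) := by
  set p := b - a with hp
  have hp0 : 0 ≤ p := by linarith
  have hp1 : p ≤ 1 := by linarith
  set φ : ℝ → ℝ := fun u => p - (Set.Ico a b).indicator (fun _ => (1 : ℝ)) u with hφ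
  have hIm : Measurable ((Set.Ico a b).indicator fun _ => (1 : ℝ)) :=
    measurable_const.indicator measurableSet_Ico
  have hφm : Measurable φ := hIm.const_sub p
  have hI01 : ∀ u, 0 ≤ (Set.Ico a b).indicator (fun _ => (1 : ℝ)) u ∧
      (Set.Ico a b).indicator (fun _ => (1 : ℝ)) u ≤ 1 := fun u => by
    by_cases hu : u ∈ Set.Ico a b <;> simp [hu]
  have hφb : ∀ u, |φ u| ≤ 1 := fun u => by
    have := hI01 u
    rw [abs_le]
    constructor <;> simp only [hφ] <;> linarith
  have hmean : ∀ i, ∫ ω, (Set.Ico a b).indicator (fun _ => (1 : ℝ)) (ξ i ω) ∂μ = p := fun i => by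
    have h1 : ∫ ω, (Set.Ico a b).indicator (fun _ => (1 : ℝ)) (ξ i ω) ∂μ =
        ∫ u, (Set.Ico a b).indicator (fun _ => (1 : ℝ)) u ∂(μ.map (ξ i)) :=
      (integral_map (hm i).aemeasurable hIm.aestronglyMeasurable).symm
    rw [h1, hunif i, integral_indicator_const _ measurableSet_Ico, smul_eq_mul, mul_one,
      measureReal_restrict_apply measurableSet_Ico, Set.inter_eq_left.2, Real.volume_real_Ico_of_le hab]
    exact fun u hu => ⟨ha.trans hu.1, hu.2.le.trans hb⟩
  have hint : ∀ i, Integrable (fun ω => (Set.Ico a b).indicator (fun _ => (1 : ℝ)) (ξ i ω)) μ :=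
    fun i => integrable_of_abs_le (M := 1) (hIm.comp (hm i)) fun ω => by
      rw [abs_of_nonneg (hI01 _).1]; exact (hI01 _).2
  have h0 : ∀ i, ∫ ω, φ (ξ i ω) ∂μ = 0 := fun i => by
    simp only [hφ]
    rw [integral_sub (integrable_const _) (hint i), hmean i]
    simp
  have hvar : ∀ i, ∫ ω, φ (ξ i ω) ^ 2 ∂μ ≤ p := fun i => by
    have h2 : ∀ u, φ u ^ 2 =
        p ^ 2 + (1 - 2 * p) * (Set.Ico a b).indicator (fun _ => (1 : ℝ)) u := fun u => by
      by_cases hu : u ∈ Set.Ico a b <;> simp [hφ, hu]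
      ring
    simp only [h2]
    rw [integral_add (integrable_const _) ((hint i).const_mul _), integral_const_mul, hmean i]
    simp only [integral_const, probReal_univ, smul_eq_mul, one_mul]
    nlinarith
  have hXm : ∀ i, Measurable fun ω => φ (ξ i ω) := fun i => hφm.comp (hm i)
  have key := bernstein_upper (s := Finset.univ)
    (mgf_sum_of_iIndepFun (hind.comp (fun _ => φ) fun _ => hφm) hXm _) hXm
    (M := 1) (V := n * p) (A := A) one_pos (fun i _ ω => hφb _) (fun i _ => h0 i)
    ((Finset.sum_le_sum fun i _ => hvar i).trans (by simp)) hA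
  refine (measureReal_mono ?_).trans key
  intro ω hω
  have e : ∑ i, φ (ξ i ω) =
      n * p - ∑ i, (Set.Ico a b).indicator (fun _ => (1 : ℝ)) (ξ i ω) := by
    simp only [hφ]
    rw [Finset.sum_sub_distrib]
    simp
  simp only [Set.mem_ofPred_eq] at hω
  change _ ≤ ∑ i, φ (ξ i ω)
  rw [e]
  have hnp : 0 ≤ n * p := by positivity
  have hsqrt : √(n * p * A) ≤ n * p / 8 := by
    rw [Real.sqrt_le_left (by positivity)]
    nlinarith
  linarith

/-- The cell ends at the first partition point above `u`; its minimality takes the place of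
monotonicity. -/
theorem exists_subcell {J : ℕ} {x : ℕ → ℝ} {u : ℝ} (hx0 : x 0 = 0) (hxJ : x J = 1)
    (hu : u ∈ Set.Ico (0 : ℝ) 1) : ∃ s < J, u ∈ Set.Ico (x s) (x (s + 1)) := by
  have hex : ∃ k, u < x k := ⟨J, by rw [hxJ]; exact hu.2⟩
  classical
  set k := Nat.find hex with hk
  have hk1 : u < x k := Nat.find_spec hex
  have hk0 : k ≠ 0 := fun e => by
    rw [e, hx0] at hk1
    exact absurd hu.1 (not_le.2 hk1)
  obtain ⟨s, hs⟩ := Nat.exists_eq_succ_of_ne_zero hk0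
  refine ⟨s, ?_, ?_, ?_⟩
  · have : k ≤ J := Nat.find_min' hex (by rw [hxJ]; exact hu.2)
    omega
  · exact not_lt.1 (Nat.find_min hex (by omega : s < k))
  · rw [hs] at hk1; exact hk1

theorem exists_equal_piece {a b u : ℝ} (hu : u ∈ Set.Ico a b) {M : ℕ} (hM : 0 < M) :
    ∃ r < M, u ∈ Set.Ico (a + r * ((b - a) / M)) (a + (r + 1) * ((b - a) / M)) := by
  have hM' : (0 : ℝ) < M := Nat.cast_pos.2 hM
  have hab : 0 < b - a := by linarith [hu.1, hu.2]
  have hw : 0 < (b - a) / M := by positivity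
  have h0 : 0 ≤ (u - a) / ((b - a) / M) := div_nonneg (by linarith [hu.1]) hw.le
  refine ⟨⌊(u - a) / ((b - a) / M)⌋₊, ?_, ?_, ?_⟩
  · rw [Nat.floor_lt h0, div_lt_iff₀ hw]
    rw [mul_div_cancel₀ _ hM'.ne']
    linarith [hu.2]
  · have := Nat.floor_le h0
    rw [le_div_iff₀ hw] at this
    linarith
  · have := Nat.lt_floor_add_one ((u - a) / ((b - a) / M))
    rw [div_lt_iff₀ hw] at this
    linarith

/-- With high probability, every node has many nodes with nearby latent positions in the same cell
of the partition. -/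
theorem measure_not_forall_exists_near_le {Ω : Type*} [MeasurableSpace Ω] {μ : Measure Ω}
    [IsProbabilityMeasure μ] {n : ℕ} {ξ : Fin n → Ω → ℝ} (hm : ∀ i, Measurable (ξ i))
    (hind : iIndepFun ξ μ)
    (hunif : ∀ i, μ.map (ξ i) = volume.restrict (Set.Icc (0 : ℝ) 1))
    {J : ℕ} {x : ℕ → ℝ} {δ : ℝ} (hδ : 0 < δ) (hx0 : x 0 = 0) (hxJ : x J = 1)
    (hgap : ∀ s < J, δ < x (s + 1) - x s) {M : ℕ} (hM : 0 < M) {A : ℝ} (hA : 0 ≤ A)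
    (hn : 64 * A ≤ n * (δ / M)) :
    μ {ω | ¬ ((∀ i, ξ i ω ∈ Set.Ico (0 : ℝ) 1) ∧ ∀ i, ∃ s < J, ∃ G : Finset (Fin n),
      n * (δ / M) / 2 ≤ G.card ∧ ξ i ω ∈ Set.Ico (x s) (x (s + 1)) ∧
      ∀ l ∈ G, ξ l ω ∈ Set.Ico (x s) (x (s + 1)) ∧ |ξ l ω - ξ i ω| ≤ 1 / M)} ≤
      ENNReal.ofReal (J * M * Real.exp (-A)) := by
  classical
  have hM' : (0 : ℝ) < M := Nat.cast_pos.2 hM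
  have hmono : ∀ s t, s ≤ t → t ≤ J → x s ≤ x t := by
    intro s t hst
    induction t, hst using Nat.le_induction with
    | base => intro _; exact le_rfl
    | succ t _ ih => intro ht; linarith [ih (by omega), hgap t (by omega)]
  -- Every cell is cut into `M` equal pieces, of width between `δ/M` and `1/M`. Nodes in the same
  -- piece are close and lie in the same cell, and a union bound over the `J M` pieces shows that
  -- all are well occupied.
  set w : ℕ → ℝ := fun s => (x (s + 1) - x s) / M with hw
  set lo : ℕ → ℕ → ℝ := fun s r => x s + r * w s with hlo
  set hi : ℕ → ℕ → ℝ := fun s r => x s + (r + 1) * w s with hhi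
  have hwpos : ∀ s < J, δ / M < w s := fun s hs => by
    simp only [hw]; gcongr; exact hgap s hs
  have hδM : 0 < δ / M := by positivity
  have hwM : ∀ s, M * w s = x (s + 1) - x s := fun s => by simp only [hw]; field_simp
  have hlo_ge : ∀ s < J, ∀ r : ℕ, x s ≤ lo s r := fun s hs r => by
    have := hδM.trans (hwpos s hs)
    simp only [hlo]
    have : 0 ≤ r * w s := by positivity
    linarith
  have hhi_le : ∀ s < J, ∀ r < M, hi s r ≤ x (s + 1) := fun s hs r hr => by
    have h1 := hδM.trans (hwpos s hs)
    have h2 : (r : ℝ) + 1 ≤ M := by exact_mod_cast hr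
    have := mul_le_mul_of_nonneg_right h2 h1.le
    simp only [hhi]
    linarith [hwM s]
  have hx_nonneg : ∀ s ≤ J, 0 ≤ x s := fun s hs => by
    have := hmono 0 s (Nat.zero_le _) hs
    rwa [hx0] at this
  have hx_le : ∀ s ≤ J, x s ≤ 1 := fun s hs => by
    have := hmono s J hs le_rfl
    rwa [hxJ] at this
  have hsub : ∀ s r, hi s r - lo s r = w s := fun s r => by simp only [hlo, hhi]; ring
  set count : ℕ → ℕ → Ω → ℝ := fun s r ω =>
    ∑ i, (Set.Ico (lo s r) (hi s r)).indicator (fun _ => (1 : ℝ)) (ξ i ω) with hcount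
  have hocc : ∀ s < J, ∀ r < M, μ.real {ω | count s r ω ≤ n * w s / 2} ≤ Real.exp (-A) := by
    intro s hs r hr
    have h1 := hwpos s hs
    have := measureReal_occupation_le hm hind hunif (a := lo s r) (b := hi s r) (A := A)
      ((hx_nonneg s hs.le).trans (hlo_ge s hs r)) (by linarith [hsub s r])
      ((hhi_le s hs r hr).trans (hx_le _ hs)) hA
      (by rw [hsub]; exact hn.trans (by gcongr))
    rwa [hsub] at this
  -- The endpoint `1` lies in no half-open cell, but it has probability zero.
  have hae : ∀ᵐ ω ∂μ, ∀ i, ξ i ω ∈ Set.Ico (0 : ℝ) 1 := by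
    rw [ae_all_iff]
    intro i
    have : ∀ᵐ u ∂(μ.map (ξ i)), u ∈ Set.Ico (0 : ℝ) 1 := by
      rw [hunif i, ← restrict_Ico_eq_restrict_Icc]
      exact ae_restrict_mem measurableSet_Ico
    exact ae_of_ae_map (hm i).aemeasurable this
  have hincl : {ω | ¬ ((∀ i, ξ i ω ∈ Set.Ico (0 : ℝ) 1) ∧ ∀ i, ∃ s < J, ∃ G : Finset (Fin n),
      n * (δ / M) / 2 ≤ G.card ∧ ξ i ω ∈ Set.Ico (x s) (x (s + 1)) ∧
      ∀ l ∈ G, ξ l ω ∈ Set.Ico (x s) (x (s + 1)) ∧ |ξ l ω - ξ i ω| ≤ 1 / M)} ⊆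
      {ω | ¬ ∀ i, ξ i ω ∈ Set.Ico (0 : ℝ) 1} ∪
      ⋃ s ∈ Finset.range J, ⋃ r ∈ Finset.range M, {ω | count s r ω ≤ n * w s / 2} := by
    intro ω hω
    by_contra hcon
    simp only [Set.mem_union, Set.mem_ofPred_eq, not_or, not_not, Set.mem_iUnion,
      Finset.mem_range, not_exists, not_le] at hcon
    refine hω ⟨hcon.1, fun i => ?_⟩
    obtain ⟨s, hs, hus⟩ := exists_subcell hx0 hxJ (hcon.1 i)
    obtain ⟨r, hr, hur⟩ := exists_equal_piece hus hM
    have hur' : ξ i ω ∈ Set.Ico (lo s r) (hi s r) := hur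
    refine ⟨s, hs, Finset.univ.filter fun l => ξ l ω ∈ Set.Ico (lo s r) (hi s r), ?_, hus, ?_⟩
    · have h1 := hcon.2 s hs r hr
      have h2 : count s r ω =
          ((Finset.univ.filter fun l => ξ l ω ∈ Set.Ico (lo s r) (hi s r)).card : ℝ) := by
        simp only [hcount, Set.indicator_apply, Finset.sum_boole]
      rw [← h2]
      have h3 := hwpos s hs
      have h4 : (n : ℝ) * (δ / M) ≤ n * w s := by gcongr
      linarith
    · intro l hl
      have hl' := (Finset.mem_filter.1 hl).2
      refine ⟨⟨(hlo_ge s hs r).trans hl'.1, hl'.2.trans_le (hhi_le s hs r hr)⟩, ?_⟩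
      have h5 : w s ≤ 1 / M := by
        simp only [hw]
        gcongr
        linarith [hx_le (s + 1) hs, hx_nonneg s hs.le]
      have h6 := hsub s r
      rw [abs_le]
      constructor <;> linarith [hl'.1, hl'.2, hur'.1, hur'.2]
  refine (measure_mono hincl).trans ((measure_union_le _ _).trans ?_)
  rw [show μ {ω | ¬ ∀ i, ξ i ω ∈ Set.Ico (0 : ℝ) 1} = 0 from hae, zero_add]
  calc μ (⋃ s ∈ Finset.range J, ⋃ r ∈ Finset.range M, {ω | count s r ω ≤ n * w s / 2})
      ≤ ∑ s ∈ Finset.range J, ∑ r ∈ Finset.range M, μ {ω | count s r ω ≤ n * w s / 2} :=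
        (measure_biUnion_finset_le _ _).trans
          (Finset.sum_le_sum fun s _ => measure_biUnion_finset_le _ _)
    _ ≤ ∑ s ∈ Finset.range J, ∑ r ∈ Finset.range M, ENNReal.ofReal (Real.exp (-A)) :=
        Finset.sum_le_sum fun s hs => Finset.sum_le_sum fun r hr => by
          rw [← ofReal_measureReal]
          exact ENNReal.ofReal_le_ofReal (hocc s (Finset.mem_range.1 hs) r (Finset.mem_range.1 hr))
    _ = ENNReal.ofReal (J * M * Real.exp (-A)) := by
        simp only [Finset.sum_const, Finset.card_range, nsmul_eq_mul]
        rw [ENNReal.ofReal_mul (by positivity), ENNReal.ofReal_mul (by positivity),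
          ENNReal.ofReal_natCast, ENNReal.ofReal_natCast, mul_assoc]

/-! ### Deterministic analysis of neighborhood smoothing -/

section Quantile

variable {n : ℕ} {d : Fin n → ℝ} {h : ℝ}

/-- The count jumps only at values of `d`, so an admissible level can be lowered to the largest
value of `d` below it. The smallest admissible value of `d` then attains the infimum. -/
theorem isLeast_quantile (hh : 0 < h * n) (hne : h * n ≤ n) :
    IsLeast {x : ℝ | h * n ≤ (Finset.univ.filter fun k => d k ≤ x).card} (quantile d h) := by
  set S := {x : ℝ | h * n ≤ (Finset.univ.filter fun k => d k ≤ x).card} with hS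
  have hmax : ∀ x ∈ S, ∃ k, d k ≤ x ∧ d k ∈ S := by
    intro x hx
    have hcard : (0 : ℝ) < (Finset.univ.filter fun k => d k ≤ x).card := hh.trans_le hx
    obtain ⟨k, hk, hkmax⟩ := Finset.exists_max_image _ d (Finset.card_pos.1 (Nat.cast_pos.1 hcard))
    refine ⟨k, (Finset.mem_filter.1 hk).2, ?_⟩
    refine (show h * n ≤ _ from hx).trans ?_
    exact_mod_cast Finset.card_le_card fun l hl =>
      Finset.mem_filter.2 ⟨Finset.mem_univ _, hkmax l hl⟩
  have hn : 0 < n := by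
    rcases Nat.eq_zero_or_pos n with rfl | hn
    · simp at hh
    · exact hn
  have : Nonempty (Fin n) := ⟨⟨0, hn⟩⟩
  obtain ⟨k₀, -, hk₀⟩ := Finset.exists_max_image Finset.univ d Finset.univ_nonempty
  have hS0 : d k₀ ∈ S := by
    have : (Finset.univ.filter fun k => d k ≤ d k₀) = Finset.univ :=
      Finset.filter_true_of_mem fun k _ => hk₀ k (Finset.mem_univ _)
    simp only [hS, Set.mem_ofPred_eq, this, Finset.card_univ, Fintype.card_fin]
    exact hne
  classical
  obtain ⟨k, hk, hkmin⟩ := Finset.exists_min_image (Finset.univ.filter fun k => d k ∈ S) d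
    ⟨k₀, Finset.mem_filter.2 ⟨Finset.mem_univ _, hS0⟩⟩
  have hleast : IsLeast S (d k) := by
    refine ⟨(Finset.mem_filter.1 hk).2, fun x hx => ?_⟩
    obtain ⟨l, hl, hlS⟩ := hmax x hx
    exact (hkmin l (Finset.mem_filter.2 ⟨Finset.mem_univ _, hlS⟩)).trans hl
  have : quantile d h = d k := hleast.csInf_eq
  rwa [this]

end Quantile

section Neighborhood

variable {n : ℕ} {Q : Matrix (Fin n) (Fin n) ℝ} {h : ℝ}

theorem le_card_neighborhood (i : Fin n) (hh : 0 < h * n) (hne : h * n ≤ n) :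
    h * n ≤ (neighborhood Q h i).card := by
  unfold neighborhood
  split_ifs with hcase
  · simpa using hcase
  · have := (isLeast_quantile (d := nodeDist Q i) hh hne).1
    simp only [Set.mem_ofPred_eq] at this
    convert this

theorem nodeDist_le_of_forall_abs_le {i i' : Fin n} {D : ℝ} (hn : 0 < n) (hD : 0 ≤ D)
    (hle : ∀ l, l ≠ i → l ≠ i' → |∑ j, (Q i j - Q i' j) * Q l j| ≤ n * D) :
    nodeDist Q i i' ≤ √D := by
  refine Real.sqrt_le_sqrt ?_
  have hn' : (0 : ℝ) < n := Nat.cast_pos.2 hn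
  rw [div_le_iff₀ hn', mul_comm]
  exact Real.iSup_le (fun l => hle l.1 l.2.1 l.2.2) (by positivity)

theorem abs_sum_le_of_nodeDist_le {i i' l : Fin n} {D : ℝ} (hD : 0 ≤ D)
    (hle : nodeDist Q i i' ≤ √D) (hli : l ≠ i) (hli' : l ≠ i') :
    |∑ j, (Q i j - Q i' j) * Q l j| ≤ n * D := by
  have hn' : (0 : ℝ) < n := Nat.cast_pos.2 i.pos
  have h1 := le_ciSup (f := fun l : {l : Fin n // l ≠ i ∧ l ≠ i'} =>
    |∑ j, (Q i j - Q i' j) * Q l j|) (Set.finite_range _).bddAbove ⟨l, hli, hli'⟩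
  have h2 := (Real.sqrt_le_sqrt_iff hD).1 hle
  rw [div_le_iff₀ hn', mul_comm] at h2
  exact h1.trans h2

/-- Rows of neighboring nodes are close in mean square. -/
theorem sum_sq_sub_le_of_mem_neighborhood {P : Matrix (Fin n) (Fin n) ℝ} {ρ D η : ℝ}
    (hP : ∀ i j, |P i j| ≤ ρ) (hD : 0 ≤ D) (hη : 0 ≤ η) (hh : 0 < h * n)
    (hQP : ∀ i l, i ≠ l → |∑ j, Q i j * Q l j - ∑ j, P i j * P l j| ≤ n * D)
    (hnear : ∀ i, ∃ G : Finset (Fin n), 3 ≤ G.card ∧ h * n ≤ G.card ∧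
      ∀ l ∈ G, ∀ j, |P l j - P i j| ≤ η)
    {i i' : Fin n} (hi' : i' ∈ neighborhood Q h i) :
    ∑ j, (P i' j - P i j) ^ 2 ≤ n * (8 * D + 6 * (ρ * η)) := by
  have hn : 0 < n := i.pos
  have hn' : (0 : ℝ) < n := Nat.cast_pos.2 hn
  have hρ : 0 ≤ ρ := (abs_nonneg _).trans (hP i i)
  have hdot : ∀ (u v : Fin n → ℝ), (∀ j, |u j| ≤ η) → (∀ j, |v j| ≤ ρ) →
      |∑ j, u j * v j| ≤ n * (ρ * η) := by
    intro u v hu hv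
    calc |∑ j, u j * v j| ≤ ∑ j, |u j * v j| := Finset.abs_sum_le_sum_abs _ _
      _ ≤ ∑ _j : Fin n, ρ * η := Finset.sum_le_sum fun j _ => by
          rw [abs_mul, mul_comm]
          exact mul_le_mul (hv j) (hu j) (abs_nonneg _) hρ
      _ = n * (ρ * η) := by simp
  -- Excluding `l = i` and `l = i'` leaves only inner products of distinct rows, where no squared
  -- norm of a noise row appears.
  have hdiff : ∀ i i' l : Fin n, l ≠ i → l ≠ i' →
      |∑ j, (Q i j - Q i' j) * Q l j - ∑ j, (P i j - P i' j) * P l j| ≤ n * (2 * D) := by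
    intro i i' l hl hl'
    have h1 := abs_le.1 (hQP i l hl.symm)
    have h2 := abs_le.1 (hQP i' l hl'.symm)
    simp only [sub_mul, Finset.sum_sub_distrib]
    rw [abs_le]
    constructor <;> linarith [h1.1, h1.2, h2.1, h2.2]
  by_cases hself : i' = i
  · subst hself
    simp only [sub_self]
    have : (0 : ℝ) ≤ n * (8 * D + 6 * (ρ * η)) := by positivity
    simpa using this
  set q := ρ * η + 2 * D with hq
  have hq0 : 0 ≤ q := by positivity
  -- The nodes of `G` number at least `h n` and all lie within empirical distance `√q` of `i`, so
  -- the quantile is at most `√q`.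
  have hquant : nodeDist Q i i' ≤ √q := by
    unfold neighborhood at hi'
    split_ifs at hi' with hcase
    · exact absurd (Finset.mem_singleton.1 hi') hself
    · refine (Finset.mem_filter.1 hi').2.trans ?_
      obtain ⟨G, -, hG, hGη⟩ := hnear i
      have hGn : (G.card : ℝ) ≤ n := by exact_mod_cast (Finset.card_le_univ G).trans (by simp)
      refine (isLeast_quantile (d := nodeDist Q i) hh (hG.trans hGn)).2 ?_
      refine hG.trans ?_
      refine Nat.cast_le.2 (Finset.card_le_card fun l hl => ?_)
      refine Finset.mem_filter.2 ⟨Finset.mem_univ _, ?_⟩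
      refine nodeDist_le_of_forall_abs_le hn hq0 fun k hki hkl => ?_
      have h1 := hdiff i l k hki hkl
      have h2 := hdot (fun j => P i j - P l j) (fun j => P k j)
        (fun j => by rw [abs_sub_comm]; exact hGη l hl j) (fun j => hP k j)
      rw [abs_le] at h1 h2 ⊢
      constructor <;> linarith [h1.1, h1.2, h2.1, h2.2]
  have hP1 : ∀ l, l ≠ i → l ≠ i' → |∑ j, (P i j - P i' j) * P l j| ≤ n * (q + 2 * D) := by
    intro l hl hl'
    have h1 := hdiff i i' l hl hl'
    have h2 := abs_sum_le_of_nodeDist_le hq0 hquant hl hl'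
    rw [abs_le] at h1 h2 ⊢
    constructor <;> linarith [h1.1, h1.2, h2.1, h2.2]
  -- The distance gives no information for `k = i` or `k = i'`. Among three nodes similar to `k` one
  -- lies outside `{i, i'}`, and it replaces `k` at the cost of `2 ρ η` per column.
  have hthree : ∀ k, |∑ j, (P i j - P i' j) * P k j| ≤ n * (q + 2 * D) + 2 * (n * (ρ * η)) := by
    intro k
    obtain ⟨G, hG3, -, hGη⟩ := hnear k
    obtain ⟨l, hlG, hl⟩ : ∃ l ∈ G, l ∉ ({i, i'} : Finset (Fin n)) := by
      by_contra hcon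
      push Not at hcon
      have := (Finset.card_le_card (show G ⊆ {i, i'} from hcon)).trans Finset.card_le_two
      omega
    simp only [Finset.mem_insert, Finset.mem_singleton, not_or] at hl
    have h1 := hP1 l hl.1 hl.2
    have h2 := hdot (fun j => P l j - P k j) (P i) (hGη l hlG) (hP i)
    have h3 := hdot (fun j => P l j - P k j) (P i') (hGη l hlG) (hP i')
    have e : ∑ j, (P i j - P i' j) * P k j = ∑ j, (P i j - P i' j) * P l j -
        ∑ j, (P l j - P k j) * P i j + ∑ j, (P l j - P k j) * P i' j := by
      rw [← Finset.sum_sub_distrib, ← Finset.sum_add_distrib]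
      exact Finset.sum_congr rfl fun j _ => by ring
    rw [e]
    rw [abs_le] at h1 h2 h3 ⊢
    constructor <;> linarith [h1.1, h1.2, h2.1, h2.2, h3.1, h3.2]
  -- The squared distance is a difference of two inner products, each controlled by `hthree`; `2 (q
  -- + 2 D + 2 ρ η) = 8 D + 6 ρ η`.
  have e : ∑ j, (P i' j - P i j) ^ 2 =
      ∑ j, (P i j - P i' j) * P i j - ∑ j, (P i j - P i' j) * P i' j := by
    rw [← Finset.sum_sub_distrib]
    exact Finset.sum_congr rfl fun j _ => by ring
  have h1 := (abs_le.1 (hthree i)).2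
  have h2 := (abs_le.1 (hthree i')).1
  rw [e]
  linarith

/-- The mean-square size of an average of noise rows. -/
theorem sum_sq_average_le {E : Matrix (Fin n) (Fin n) ℝ} {N : Finset (Fin n)} (hN : N.Nonempty)
    {V D : ℝ} (hrow : ∀ i, ∑ j, E i j ^ 2 ≤ V) (hD : 0 ≤ D)
    (hcross : ∀ i l, i ≠ l → |∑ j, E i j * E l j| ≤ D) :
    ∑ j, (1 / (N.card : ℝ) * ∑ i ∈ N, E i j) ^ 2 ≤ V / N.card + D := by
  have hc : (0 : ℝ) < N.card := Nat.cast_pos.2 hN.card_pos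
  have hexp : ∑ j, (∑ i ∈ N, E i j) ^ 2 = ∑ i ∈ N, ∑ l ∈ N, ∑ j, E i j * E l j := by
    simp only [sq, Finset.sum_mul_sum]
    rw [Finset.sum_comm]
    exact Finset.sum_congr rfl fun i _ => Finset.sum_comm
  -- One diagonal term and fewer than `N.card` off-diagonal ones. The bound holds for every `N`, as
  -- it must since the neighborhoods are chosen from the noisy data.
  have hterm : ∀ i ∈ N, ∑ l ∈ N, ∑ j, E i j * E l j ≤ V + N.card * D := by
    intro i hi
    rw [← Finset.add_sum_erase N _ hi]
    have h1 : ∑ j, E i j * E i j ≤ V := by simpa [sq] using hrow i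
    have h2 : ∑ l ∈ N.erase i, ∑ j, E i j * E l j ≤ ∑ _l ∈ N.erase i, D :=
      Finset.sum_le_sum fun l hl =>
        (le_abs_self _).trans (hcross i l (Finset.ne_of_mem_erase hl).symm)
    have h3 : ∑ _l ∈ N.erase i, D ≤ N.card * D := by
      rw [Finset.sum_const, nsmul_eq_mul]
      exact mul_le_mul_of_nonneg_right
        (Nat.cast_le.2 (Finset.card_le_card (Finset.erase_subset i N))) hD
    linarith
  simp only [mul_pow]
  rw [← Finset.mul_sum, hexp]
  calc (1 / (N.card : ℝ)) ^ 2 * ∑ i ∈ N, ∑ l ∈ N, ∑ j, E i j * E l j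
      ≤ (1 / (N.card : ℝ)) ^ 2 * ∑ _i ∈ N, (V + N.card * D) := by
        gcongr with i hi
        exact hterm i hi
    _ = V / N.card + D := by
        rw [Finset.sum_const, nsmul_eq_mul]
        field_simp

/-- The error is an average of noise rows plus an average of `M i' - P i = (M i' - P i') + (P i' - P
i)`. The last difference is small for selected neighbors, because inner products of distinct rows of
`Q` and `P` differ per column by at most `b (c + ρ)` from the bias and `3 D` from two mixed terms
and one noise-noise term. -/
theorem sum_sq_neighborhoodSmooth_sub_le {P M E : Matrix (Fin n) (Fin n) ℝ}
    (hQ : ∀ i j, Q i j = M i j + E i j) {ρ c b D V η : ℝ}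
    (hP : ∀ i j, |P i j| ≤ ρ) (hM : ∀ i j, |M i j| ≤ c) (hMP : ∀ i j, |M i j - P i j| ≤ b)
    (hD : 0 ≤ D) (hη : 0 ≤ η) (hh : 0 < h * n)
    (hrow : ∀ i, ∑ j, E i j ^ 2 ≤ n * V)
    (hcross : ∀ i l, i ≠ l → |∑ j, E i j * E l j| ≤ n * D)
    (hmix : ∀ i l, |∑ j, E i j * M l j| ≤ n * D)
    (hnear : ∀ i, ∃ G : Finset (Fin n), 3 ≤ G.card ∧ h * n ≤ G.card ∧
      ∀ l ∈ G, ∀ j, |P l j - P i j| ≤ η) (i : Fin n) :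
    ∑ j, (neighborhoodSmooth Q h i j - P i j) ^ 2 ≤
      n * (2 * (V / (h * n) + D) + 4 * b ^ 2 +
        4 * (8 * (b * (c + ρ) + 3 * D) + 6 * (ρ * η))) := by
  have hn' : (0 : ℝ) < n := Nat.cast_pos.2 i.pos
  have hρ : 0 ≤ ρ := (abs_nonneg _).trans (hP i i)
  have hc : 0 ≤ c := (abs_nonneg _).trans (hM i i)
  have hb : 0 ≤ b := (abs_nonneg _).trans (hMP i i)
  set D₁ := b * (c + ρ) + 3 * D with hD₁
  have hD₁0 : 0 ≤ D₁ := by positivity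
  have hQP : ∀ i l, i ≠ l → |∑ j, Q i j * Q l j - ∑ j, P i j * P l j| ≤ n * D₁ := by
    intro i l hil
    have e : ∑ j, Q i j * Q l j - ∑ j, P i j * P l j =
        ∑ j, ((M i j - P i j) * M l j + P i j * (M l j - P l j)) +
        ∑ j, E i j * M l j + ∑ j, E l j * M i j + ∑ j, E i j * E l j := by
      rw [← Finset.sum_sub_distrib, ← Finset.sum_add_distrib, ← Finset.sum_add_distrib,
        ← Finset.sum_add_distrib]
      exact Finset.sum_congr rfl fun j _ => by rw [hQ, hQ]; ring
    have h1 : |∑ j, ((M i j - P i j) * M l j + P i j * (M l j - P l j))| ≤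
        n * (b * (c + ρ)) := by
      calc _ ≤ ∑ j, |(M i j - P i j) * M l j + P i j * (M l j - P l j)| :=
            Finset.abs_sum_le_sum_abs _ _
        _ ≤ ∑ _j : Fin n, b * (c + ρ) := Finset.sum_le_sum fun j _ => by
            refine (abs_add_le _ _).trans ?_
            rw [abs_mul, abs_mul]
            have h2 := mul_le_mul (hMP i j) (hM l j) (abs_nonneg _) hb
            have h3 := mul_le_mul (hP i j) (hMP l j) (abs_nonneg _) hρ
            linarith
        _ = n * (b * (c + ρ)) := by simp
    have h2 := abs_le.1 (hmix i l)
    have h3 := abs_le.1 (hmix l i)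
    have h4 := abs_le.1 (hcross i l hil)
    have h5 := abs_le.1 h1
    rw [e, abs_le]
    constructor <;> simp only [hD₁] <;> linarith [h2.1, h2.2, h3.1, h3.2, h4.1, h4.2, h5.1, h5.2]
  have hcard : h * n ≤ (neighborhood Q h i).card := by
    obtain ⟨G, -, hG, -⟩ := hnear i
    exact le_card_neighborhood i hh
      (hG.trans (by exact_mod_cast (Finset.card_le_univ G).trans (by simp)))
  have hclose := fun {i'} (hi' : i' ∈ neighborhood Q h i) =>
    sum_sq_sub_le_of_mem_neighborhood hP hD₁0 hη hh hQP hnear hi'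
  set N := neighborhood Q h i with hN
  have hNpos : (0 : ℝ) < N.card := hh.trans_le hcard
  have hNne : N.Nonempty := Finset.card_pos.1 (Nat.cast_pos.1 hNpos)
  set bias : Fin n → ℝ := fun j => 1 / (N.card : ℝ) * ∑ i' ∈ N, (M i' j - P i j) with hbias
  have hdecomp : ∀ j, neighborhoodSmooth Q h i j - P i j =
      1 / (N.card : ℝ) * ∑ i' ∈ N, E i' j + bias j := by
    intro j
    simp only [neighborhoodSmooth, Matrix.of_apply, hbias, ← hN, hQ, Finset.sum_add_distrib,
      Finset.sum_sub_distrib, Finset.sum_const, nsmul_eq_mul]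
    field_simp
    ring
  have hbias_sq : ∀ j, bias j ^ 2 ≤ 1 / (N.card : ℝ) * ∑ i' ∈ N, (M i' j - P i j) ^ 2 := by
    intro j
    have := sq_sum_le_card_mul_sum_sq (s := N) (f := fun i' => M i' j - P i j)
    simp only [hbias, mul_pow]
    calc (1 / (N.card : ℝ)) ^ 2 * (∑ i' ∈ N, (M i' j - P i j)) ^ 2
        ≤ (1 / (N.card : ℝ)) ^ 2 * (N.card * ∑ i' ∈ N, (M i' j - P i j) ^ 2) := by gcongr
      _ = _ := by field_simp
  have hbias_sum : ∑ j, bias j ^ 2 ≤ n * (2 * b ^ 2 + 2 * (8 * D₁ + 6 * (ρ * η))) := by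
    calc ∑ j, bias j ^ 2 ≤ ∑ j, 1 / (N.card : ℝ) * ∑ i' ∈ N, (M i' j - P i j) ^ 2 :=
          Finset.sum_le_sum fun j _ => hbias_sq j
      _ = 1 / (N.card : ℝ) * ∑ i' ∈ N, ∑ j, (M i' j - P i j) ^ 2 := by
          rw [← Finset.mul_sum, Finset.sum_comm]
      _ ≤ 1 / (N.card : ℝ) * ∑ _i' ∈ N, n * (2 * b ^ 2 + 2 * (8 * D₁ + 6 * (ρ * η))) := by
          gcongr with i' hi'
          have h1 := hclose hi'
          have h2 : ∑ j, (M i' j - P i' j) ^ 2 ≤ n * b ^ 2 := by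
            calc ∑ j, (M i' j - P i' j) ^ 2 ≤ ∑ _j : Fin n, b ^ 2 :=
                  Finset.sum_le_sum fun j _ =>
                    sq_le_sq' (abs_le.1 (hMP i' j)).1 (abs_le.1 (hMP i' j)).2
              _ = n * b ^ 2 := by simp
          have h3 : ∑ j, (M i' j - P i j) ^ 2 ≤
              2 * ∑ j, (M i' j - P i' j) ^ 2 + 2 * ∑ j, (P i' j - P i j) ^ 2 := by
            rw [Finset.mul_sum, Finset.mul_sum, ← Finset.sum_add_distrib]
            refine Finset.sum_le_sum fun j _ => ?_
            nlinarith [sq_nonneg ((M i' j - P i' j) - (P i' j - P i j))]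
          linarith
      _ = _ := by
          rw [Finset.sum_const, nsmul_eq_mul]
          field_simp
  have hnoise := sum_sq_average_le hNne hrow (by positivity) hcross
  have hV : n * V / N.card ≤ n * V / (h * n) := by
    have : 0 ≤ n * V := (Finset.sum_nonneg fun j _ => sq_nonneg _).trans (hrow i)
    gcongr
  have hfinal : ∑ j, (neighborhoodSmooth Q h i j - P i j) ^ 2 ≤
      2 * ∑ j, (1 / (N.card : ℝ) * ∑ i' ∈ N, E i' j) ^ 2 + 2 * ∑ j, bias j ^ 2 := by
    rw [Finset.mul_sum, Finset.mul_sum, ← Finset.sum_add_distrib]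
    refine Finset.sum_le_sum fun j _ => ?_
    rw [hdecomp]
    nlinarith [sq_nonneg (1 / (N.card : ℝ) * ∑ i' ∈ N, E i' j - bias j)]
  have e : n * V / (h * n) = n * (V / (h * n)) := by ring
  rw [e] at hV
  linarith

end Neighborhood

/-! ### The maximal row norm -/

theorem mul_norm2Inf_sq_le {n : ℕ} (hn : 0 < n) {B : Matrix (Fin n) (Fin n) ℝ} {C : ℝ}
    (hC : 0 ≤ C) (hB : ∀ i, ∑ j, B i j ^ 2 ≤ n * C) : 1 / (n : ℝ) * norm2Inf B ^ 2 ≤ C := by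
  have hn' : (0 : ℝ) < n := Nat.cast_pos.2 hn
  have h1 : norm2Inf B ≤ √(n * C) :=
    Real.iSup_le (fun i => Real.sqrt_le_sqrt (hB i)) (Real.sqrt_nonneg _)
  have h0 : 0 ≤ norm2Inf B := Real.iSup_nonneg fun i => Real.sqrt_nonneg _
  have h2 : norm2Inf B ^ 2 ≤ n * C := by
    calc norm2Inf B ^ 2 ≤ √(n * C) ^ 2 := pow_le_pow_left₀ h0 h1 2
      _ = n * C := Real.sq_sqrt (by positivity)
  rw [div_mul_eq_mul_div, one_mul, div_le_iff₀ hn']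
  linarith

theorem neighborhoodSmooth_eq_self {n : ℕ} (Q : Matrix (Fin n) (Fin n) ℝ) {h : ℝ}
    (hh : h * n ≤ 1) : neighborhoodSmooth Q h = Q := by
  ext i j
  simp [neighborhoodSmooth, neighborhood, hh]

/-! ### Mean and noise of the first-stage estimator -/

section FirstStage

variable {f : ℝ → ℝ → ℝ → ℝ} (hf : IsTimeVaryingGraphon f) {ρ : ℝ} (hρ : ρ ∈ Set.Icc (0 : ℝ) 1)
  {n m : ℕ} (τ : Fin m → ℝ) (w : Fin m → ℝ)

/-- The conditional expectation of a weighted sum of the networks. -/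
def meanMatrix (x : Fin n → ℝ) : Matrix (Fin n) (Fin n) ℝ :=
  Matrix.of fun i j => ∑ k, w k * (linkProb hf hρ (x i) (x j) (τ k) : ℝ)

/-- The noise in a weighted sum of the networks. -/
def noiseMatrix (x : Fin n → ℝ) (a : Edge n → Fin m → Bool) : Matrix (Fin n) (Fin n) ℝ :=
  Matrix.of fun i j => edgeNoise w (edgeProb hf hρ τ x (edge i j)) (a (edge i j))

theorem firstStage_eq_mean_add_noise {K : ℝ → ℝ} {ℓ : ℕ} {h t : ℝ}
    {a : Fin m → Fin n → Fin n → Bool} (ha : ∀ k i j, a k i j = a k j i) (x : Fin n → ℝ)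
    (i j : Fin n) :
    firstStage ℓ K τ h t a i j = meanMatrix hf hρ τ (lpWeight ℓ K τ h t) x i j +
      noiseMatrix hf hρ τ (lpWeight ℓ K τ h t) x (fun e k => a k e.1.1 e.1.2) i j := by
  have hedge : ∀ k, a k (edge i j).1.1 (edge i j).1.2 = a k i j := fun k => by
    rcases le_total i j with h | h
    · simp [edge, h]
    · simp only [edge, min_eq_right h, max_eq_left h]
      exact ha k j i
  simp only [firstStage, meanMatrix, noiseMatrix, Matrix.of_apply, edgeNoise, hedge,
    edgeProb_edge]
  rw [← Finset.sum_add_distrib]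
  exact Finset.sum_congr rfl fun k _ => by ring

theorem abs_meanMatrix_le {S : ℝ} (hS : ∑ k, |w k| ≤ S) (x : Fin n → ℝ) (i j : Fin n) :
    |meanMatrix hf hρ τ w x i j| ≤ ρ * S := by
  simp only [meanMatrix, Matrix.of_apply]
  calc |∑ k, w k * (linkProb hf hρ (x i) (x j) (τ k) : ℝ)|
      ≤ ∑ k, |w k| * ρ := (Finset.abs_sum_le_sum_abs _ _).trans
        (Finset.sum_le_sum fun k _ => by
          rw [abs_mul, abs_of_nonneg (linkProb hf hρ (x i) (x j) (τ k)).2.1]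
          exact mul_le_mul_of_nonneg_left (linkProb_le hf hρ _ _ _) (abs_nonneg _))
    _ = ρ * ∑ k, |w k| := by rw [← Finset.sum_mul, mul_comm]
    _ ≤ ρ * S := mul_le_mul_of_nonneg_left hS hρ.1

theorem measurable_meanMatrix (i j : Fin n) :
    Measurable fun x : Fin n → ℝ => meanMatrix hf hρ τ w x i j := by
  simp only [meanMatrix, Matrix.of_apply]
  refine Finset.measurable_sum _ fun k _ => Measurable.const_mul ?_ _
  have hij : Measurable fun x : Fin n → ℝ => (x i, x j) :=
    (measurable_pi_apply i).prodMk (measurable_pi_apply j)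
  exact (measurable_linkProb hf hρ (τ k)).comp hij

theorem measurable_noiseMatrix (a : Edge n → Fin m → Bool) (i j : Fin n) :
    Measurable fun x : Fin n → ℝ => noiseMatrix hf hρ τ w x a i j := by
  simp only [noiseMatrix, Matrix.of_apply, edgeNoise, edgeProb_edge]
  refine Finset.measurable_sum _ fun k _ => Measurable.const_mul (Measurable.const_sub ?_ _) _
  have hij : Measurable fun x : Fin n → ℝ => (x i, x j) :=
    (measurable_pi_apply i).prodMk (measurable_pi_apply j)
  exact (measurable_linkProb hf hρ (τ k)).comp hij

theorem abs_meanMatrix_sub_probMatrix_le {K : ℝ → ℝ} {β L₁ Kmax lam h t S : ℝ} (hβ : 0 < β)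
    (hL₁ : 0 < L₁) (hHolder : HolderInTime f β L₁) (hτ : ∀ k, τ k ∈ Set.Icc (0 : ℝ) 1)
    (hh : 0 < h) (hlam : 0 < lam) (hK : LPKernel K Kmax) (hspec : LPEigen ⌊β⌋₊ K τ h lam)
    (ht : t ∈ Set.Icc (0 : ℝ) 1) (hS : ∑ k, |lpWeight ⌊β⌋₊ K τ h t k| ≤ S) {x : Fin n → ℝ}
    (hx : ∀ i, x i ∈ Set.Icc (0 : ℝ) 1) (i j : Fin n) :
    |meanMatrix hf hρ τ (lpWeight ⌊β⌋₊ K τ h t) x i j - probMatrix f ρ x t i j| ≤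
      S * L₁ * (ρ * h ^ β) := by
  have hH := hHolder _ (hx i) _ (hx j)
  have h1 := abs_sum_lpWeight_mul_sub_le (g := f (x i) (x j)) hβ hτ hh hlam hK (hspec t ht) ht hL₁
    hH.1 (fun s hs => hH.2 s hs t ht)
  have e : meanMatrix hf hρ τ (lpWeight ⌊β⌋₊ K τ h t) x i j - probMatrix f ρ x t i j =
      ρ * (∑ k, lpWeight ⌊β⌋₊ K τ h t k * f (x i) (x j) (τ k) - f (x i) (x j) t) := by
    simp only [meanMatrix, probMatrix, Matrix.of_apply]
    rw [mul_sub, Finset.mul_sum]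
    congr 1
    refine Finset.sum_congr rfl fun k _ => ?_
    rw [linkProb_of_mem hf hρ (hx i) (hx j) (hτ k)]
    ring
  rw [e, abs_mul, abs_of_nonneg hρ.1]
  calc ρ * |∑ k, lpWeight ⌊β⌋₊ K τ h t k * f (x i) (x j) (τ k) - f (x i) (x j) t|
      ≤ ρ * (S * (L₁ * h ^ β)) := mul_le_mul_of_nonneg_left (h1.trans (by gcongr)) hρ.1
    _ = _ := by ring

/-- The uniform bounds on the noise used for neighborhood smoothing. -/
structure IsNoiseBounded (M E : Matrix (Fin n) (Fin n) ℝ) (T₁ T₂ T₃ : ℝ) : Prop where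
  row : ∀ i, ∑ j, E i j ^ 2 < T₁
  cross : ∀ i l, i ≠ l → |∑ j, E i j * E l j| < T₂
  mix : ∀ i l, |∑ j, E i j * M l j| < T₃

theorem measureReal_iUnion_le_card_mul {Ω ι : Type*} [MeasurableSpace Ω] {μ : Measure Ω}
    [Fintype ι] {s : ι → Set Ω} {c : ℝ} (h : ∀ i, μ.real (s i) ≤ c) :
    μ.real (⋃ i, s i) ≤ Fintype.card ι * c := by
  refine (measureReal_iUnion_fintype_le _).trans ?_
  calc ∑ i, μ.real (s i) ≤ ∑ _i : ι, c := Finset.sum_le_sum fun i _ => h i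
    _ = Fintype.card ι * c := by simp

/-- With high probability the noise is bounded uniformly, at the level of rows and of pairs of
rows. -/
theorem measure_not_isNoiseBounded_le {Ω : Type*} [MeasurableSpace Ω] {μ : Measure Ω}
    [IsProbabilityMeasure μ] {ξ : Fin n → Ω → ℝ} {A : Fin m → Fin n → Fin n → Ω → Bool}
    (hτ : ∀ k, τ k ∈ Set.Icc (0 : ℝ) 1) (hN : IsSparseGraphonNetwork μ f ρ τ ξ A) (hρ0 : 0 < ρ)
    {S S₂ B : ℝ} (hS0 : 0 < S) (hS : ∑ k, |w k| ≤ S) (hw : ∑ k, w k ^ 2 ≤ S₂) (hB : 0 ≤ B) :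
    μ {ω | ¬ IsNoiseBounded (meanMatrix hf hρ τ w fun i => ξ i ω)
      (noiseMatrix hf hρ τ w (fun i => ξ i ω) fun e k => A k e.1.1 e.1.2 ω)
      (n * (ρ * S₂) + (2 * √(n * (S ^ 2 * (ρ * S₂)) * B) + 2 * S ^ 2 * B))
      (2 * √(n * (ρ * S₂) ^ 2 * B) + 2 * S ^ 2 * B + 2 * S ^ 2)
      (2 * √(n * ((ρ * S) ^ 2 * (ρ * S₂)) * B) + 2 * (S * (ρ * S)) * B)} ≤
      ENNReal.ofReal (5 * (n : ℝ) ^ 2 * Real.exp (-B)) := by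
  set T₁ := n * (ρ * S₂) + (2 * √(n * (S ^ 2 * (ρ * S₂)) * B) + 2 * S ^ 2 * B) with hT₁
  set T₂ := 2 * √(n * (ρ * S₂) ^ 2 * B) + 2 * S ^ 2 * B + 2 * S ^ 2 with hT₂
  set T₃ := 2 * √(n * ((ρ * S) ^ 2 * (ρ * S₂)) * B) + 2 * (S * (ρ * S)) * B with hT₃
  set M := meanMatrix hf hρ τ w (n := n)
  set E := noiseMatrix hf hρ τ w (n := n)
  set bad : (Fin n → ℝ) → Set (Edge n → Fin m → Bool) := fun x =>
    (⋃ i, {a | T₁ ≤ ∑ j, E x a i j ^ 2}) ∪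
    ((⋃ p : {p : Fin n × Fin n // p.1 ≠ p.2}, {a | T₂ ≤ |∑ j, E x a p.1.1 j * E x a p.1.2 j|}) ∪
    (⋃ p : Fin n × Fin n, {a | T₃ ≤ |∑ j, E x a p.1 j * M x p.2 j|})) with hbad
  have hEm := measurable_noiseMatrix hf hρ τ w (n := n)
  have hMm := measurable_meanMatrix hf hρ τ w (n := n)
  have hmeas : ∀ a, MeasurableSet {x | a ∈ bad x} := by
    intro a
    have e : {x | a ∈ bad x} = (⋃ i, {x | T₁ ≤ ∑ j, E x a i j ^ 2}) ∪
        ((⋃ p : {p : Fin n × Fin n // p.1 ≠ p.2},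
          {x | T₂ ≤ |∑ j, E x a p.1.1 j * E x a p.1.2 j|}) ∪
        (⋃ p : Fin n × Fin n, {x | T₃ ≤ |∑ j, E x a p.1 j * M x p.2 j|})) := by
      ext x
      simp [hbad]
    rw [e]
    refine (MeasurableSet.iUnion fun i => ?_).union
      ((MeasurableSet.iUnion fun p => ?_).union (MeasurableSet.iUnion fun p => ?_))
    · exact measurableSet_le measurable_const
        (Finset.measurable_sum _ fun j _ => (hEm a i j).pow_const 2)
    · exact measurableSet_le measurable_const (continuous_abs.measurable.comp
        (Finset.measurable_sum _ fun j _ => (hEm a _ j).mul (hEm a _ j)))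
    · exact measurableSet_le measurable_const (continuous_abs.measurable.comp
        (Finset.measurable_sum _ fun j _ => (hEm a _ j).mul (hMm _ j)))
  have hprob : ∀ x, (networkLaw (edgeProb hf hρ τ x)).real (bad x) ≤
      5 * (n : ℝ) ^ 2 * Real.exp (-B) := by
    intro x
    have hX := isEdgeNoise_networkLaw (edgeProb hf hρ τ x) w
      (fun e k => linkProb_le hf hρ _ _ _) hρ.1 hS hw
    -- One family of `n` one-sided events and two families of at most `n²` two-sided events, hence
    -- the factor 5.
    have h1 := measureReal_iUnion_le_card_mul fun i => hX.measureReal_row_sq_ge_le hS0 hB i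
    have h2 := measureReal_iUnion_le_card_mul fun p : {p : Fin n × Fin n // p.1 ≠ p.2} =>
      hX.measureReal_row_row_ge_le hS0 hB p.2
    have h3 := measureReal_iUnion_le_card_mul fun p : Fin n × Fin n =>
      hX.measureReal_row_dot_ge_le hS0 hB p.1 (c := ρ * S) (by positivity) (x := M x p.2)
        (abs_meanMatrix_le hf hρ τ w hS x p.2)
    have hc1 : ((Fintype.card (Fin n) : ℕ) : ℝ) ≤ (n : ℝ) ^ 2 := by
      rw [Fintype.card_fin]
      exact_mod_cast Nat.le_self_pow two_ne_zero n
    have hc2 : ((Fintype.card {p : Fin n × Fin n // p.1 ≠ p.2} : ℕ) : ℝ) ≤ (n : ℝ) ^ 2 := by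
      have := Fintype.card_subtype_le fun p : Fin n × Fin n => p.1 ≠ p.2
      rw [Fintype.card_prod, Fintype.card_fin, ← sq] at this
      exact_mod_cast this
    have hc3 : ((Fintype.card (Fin n × Fin n) : ℕ) : ℝ) = (n : ℝ) ^ 2 := by
      simp [sq]
    have hexp := Real.exp_pos (-B)
    refine (measureReal_union_le _ _).trans ?_
    refine (add_le_add h1 ((measureReal_union_le _ _).trans (add_le_add h2 h3))).trans ?_
    rw [hc3]
    have h4 := mul_le_mul_of_nonneg_right hc1 hexp.le
    have h5 := mul_le_mul_of_nonneg_right hc2 (by positivity : 0 ≤ 2 * Real.exp (-B))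
    linarith
  refine (measure_mono ?_).trans
    (hN.measure_le_of_forall_networkLaw_le hf hρ hτ bad hmeas hprob)
  intro ω hω
  by_contra hcon
  refine hω ?_
  simp only [hbad, Set.mem_ofPred_eq, Set.mem_union, Set.mem_iUnion, not_or, not_exists,
    not_le] at hcon
  exact ⟨hcon.1, fun i l hil => hcon.2.1 ⟨(i, l), hil⟩, fun i l => hcon.2.2 (i, l)⟩

/-- With high probability the noise is bounded uniformly, entry by entry. -/
theorem measure_not_forall_abs_noise_lt_le {Ω : Type*} [MeasurableSpace Ω] {μ : Measure Ω}
    [IsProbabilityMeasure μ] {ξ : Fin n → Ω → ℝ} {A : Fin m → Fin n → Fin n → Ω → Bool}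
    (hτ : ∀ k, τ k ∈ Set.Icc (0 : ℝ) 1) (hN : IsSparseGraphonNetwork μ f ρ τ ξ A)
    {W S₂ B : ℝ} (hW0 : 0 < W) (hW : ∀ k, |w k| ≤ W) (hw : ∑ k, w k ^ 2 ≤ S₂) (hB : 0 ≤ B) :
    μ {ω | ¬ ∀ i j, |noiseMatrix hf hρ τ w (fun i => ξ i ω)
      (fun e k => A k e.1.1 e.1.2 ω) i j| < 2 * √(ρ * S₂ * B) + 2 * W * B} ≤
      ENNReal.ofReal (2 * (n : ℝ) ^ 2 * Real.exp (-B)) := by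
  set E := noiseMatrix hf hρ τ w (n := n)
  set T := 2 * √(ρ * S₂ * B) + 2 * W * B with hT
  set bad : (Fin n → ℝ) → Set (Edge n → Fin m → Bool) := fun x =>
    ⋃ p : Fin n × Fin n, {a | T ≤ |E x a p.1 p.2|} with hbad
  have hmeas : ∀ a, MeasurableSet {x | a ∈ bad x} := by
    intro a
    have e : {x | a ∈ bad x} = ⋃ p : Fin n × Fin n, {x | T ≤ |E x a p.1 p.2|} := by
      ext x
      simp [hbad]
    rw [e]
    exact MeasurableSet.iUnion fun p => measurableSet_le measurable_const
      (continuous_abs.measurable.comp (measurable_noiseMatrix hf hρ τ w a _ _))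
  have hprob : ∀ x, (networkLaw (edgeProb hf hρ τ x)).real (bad x) ≤
      2 * (n : ℝ) ^ 2 * Real.exp (-B) := by
    intro x
    have h1 := measureReal_iUnion_le_card_mul fun p : Fin n × Fin n =>
      measureReal_networkLaw_edgeNoise_ge_le (edgeProb hf hρ τ x) w
        (fun e k => linkProb_le hf hρ _ _ _) hρ.1 hw hW0 hW hB (edge p.1 p.2)
    refine h1.trans (le_of_eq ?_)
    simp [sq]
    ring
  refine (measure_mono ?_).trans
    (hN.measure_le_of_forall_networkLaw_le hf hρ hτ bad hmeas hprob)
  intro ω hω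
  by_contra hcon
  refine hω fun i j => ?_
  simp only [hbad, Set.mem_ofPred_eq, Set.mem_iUnion, not_exists, not_le] at hcon
  exact hcon (i, j)

end FirstStage

/-! ### Bandwidths and rates -/

theorem rpow_one_div_rpow {z a b : ℝ} (hz : 0 ≤ z) : (z ^ (1 / a)) ^ b = z ^ (b / a) := by
  rw [← Real.rpow_mul hz]
  congr 1
  ring

/-- `k + 1` stands in for `√k`, which keeps later constants free of roots. -/
theorem le_of_sq_le_mul_sq {x k u : ℝ} (hk : 0 ≤ k) (hu : 0 ≤ u) (h : x ^ 2 ≤ k * u ^ 2) :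
    x ≤ (k + 1) * u := by
  refine (abs_le_of_sq_le_sq' ?_ (by positivity)).2
  rw [mul_pow]
  nlinarith [sq_nonneg u, mul_nonneg hk (sq_nonneg u), mul_nonneg (mul_nonneg hk hk) (sq_nonneg u)]

theorem sqrt_le_of_le_mul_sq {x k u : ℝ} (hx : 0 ≤ x) (hk : 0 ≤ k) (hu : 0 ≤ u)
    (h : x ≤ k * u ^ 2) : √x ≤ (k + 1) * u :=
  le_of_sq_le_mul_sq hk hu (by rwa [Real.sq_sqrt hx])

theorem lpWeight_bounds {m ℓ : ℕ} {K : ℝ → ℝ} {τ : Fin m → ℝ} {h t lam Kmax a₀ W : ℝ}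
    (hm : 0 < m) (hτ : ∀ k, τ k ∈ Set.Icc (0 : ℝ) 1)
    (hdes : LPDesign τ a₀) (ha₀ : 0 < a₀) (hh : 0 < h) (hlam : 0 < lam) (hK : LPKernel K Kmax)
    (hspec : LPEigen ℓ K τ h lam) (ht : t ∈ Set.Icc (0 : ℝ) 1) (hW : (ℓ + 1) / lam * Kmax ≤ W) :
    (∀ k, |lpWeight ℓ K τ h t k| ≤ W * (1 / (m * h))) ∧
    ∑ k, |lpWeight ℓ K τ h t k| ≤ 2 * a₀ * W ∧
    ∑ k, lpWeight ℓ K τ h t k ^ 2 ≤ 2 * a₀ * W ^ 2 * (1 / (m * h)) := by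
  have h1 : ∀ k, |lpWeight ℓ K τ h t k| ≤ W * (1 / (m * h)) := fun k =>
    (abs_lpWeight_le hh hlam hK (hspec t ht) k).trans (by gcongr)
  have h2 : ∑ k, |lpWeight ℓ K τ h t k| ≤ 2 * a₀ * W :=
    (sum_abs_lpWeight_le hm hτ hdes ha₀ hh hlam hK hspec ht).trans (by gcongr)
  refine ⟨h1, h2, ?_⟩
  have hK0 := hK.nonneg
  have hW0 : 0 ≤ W := le_trans (by positivity) hW
  calc ∑ k, lpWeight ℓ K τ h t k ^ 2
      ≤ ∑ k, W * (1 / (m * h)) * |lpWeight ℓ K τ h t k| := Finset.sum_le_sum fun k _ => by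
        rw [← sq_abs, sq]
        exact mul_le_mul_of_nonneg_right (h1 k) (abs_nonneg _)
    _ = W * (1 / (m * h)) * ∑ k, |lpWeight ℓ K τ h t k| := by rw [Finset.mul_sum]
    _ ≤ W * (1 / (m * h)) * (2 * a₀ * W) := by gcongr
    _ = _ := by ring

/-- The failure probability of `n²` events of probability `(nm)^{-4}` each. -/
theorem sq_mul_exp_neg_four_log_le {n m : ℝ} (hn : 1 ≤ n) (hm : 1 ≤ m) (hnm : 3 ≤ n * m) :
    6 * n ^ 2 * Real.exp (-(4 * Real.log (n * m))) ≤ 2 * (n * m)⁻¹ := by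
  have h0 : 0 < n * m := by positivity
  have h1 : Real.exp (-(4 * Real.log (n * m))) = ((n * m) ^ 4)⁻¹ := by
    rw [Real.exp_neg, show (4 : ℝ) * Real.log (n * m) = ((4 : ℕ) : ℝ) * Real.log (n * m) by
      norm_num, Real.exp_nat_mul, Real.exp_log h0]
  rw [h1, ← div_eq_mul_inv, div_le_iff₀ (by positivity)]
  have h2 : 2 * (n * m)⁻¹ * (n * m) ^ 4 = 2 * (n * m) * (n * m) ^ 2 := by field_simp
  rw [h2]
  have h3 : n ^ 2 ≤ (n * m) ^ 2 := by
    have : n ≤ n * m := by nlinarith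
    gcongr
  nlinarith [sq_nonneg (n * m), sq_nonneg n]

theorem one_le_log_of_three_le {x : ℝ} (hx : 3 ≤ x) : 1 ≤ Real.log x := by
  rw [Real.le_log_iff_exp_le (by linarith)]
  linarith [Real.exp_one_lt_d9]

/-- Subadditivity suffices, so the event need not be shown measurable. -/
theorem ofReal_one_sub_le_measure {Ω : Type*} [MeasurableSpace Ω] {μ : Measure Ω}
    [IsProbabilityMeasure μ] {s : Set Ω} {ε : ℝ} (hε : 0 ≤ ε) (h : μ sᶜ ≤ ENNReal.ofReal ε) :
    ENNReal.ofReal (1 - ε) ≤ μ s := by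
  rw [ENNReal.ofReal_sub _ hε, ENNReal.ofReal_one, tsub_le_iff_right]
  calc (1 : ENNReal) = μ (s ∪ sᶜ) := by rw [Set.union_compl_self, measure_univ]
    _ ≤ μ s + μ sᶜ := measure_union_le _ _
    _ ≤ μ s + ENNReal.ofReal ε := by gcongr

section SparseRegime

variable {β ρ L m y : ℝ}

theorem sparse_rate_eq (hβ : 0 < β) (hρ : 0 < ρ) (hL : 0 < L) (hm : 0 < m)
    (hy : y = (L / (ρ * m)) ^ (1 / (2 * β + 1))) :
    ρ ^ ((2 * β + 2) / (2 * β + 1)) * (L / m) ^ (2 * β / (2 * β + 1)) = (ρ * y ^ β) ^ 2 := by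
  have e1 : L / m = ρ * (L / (ρ * m)) := by field_simp
  have e2 : (ρ * y ^ β) ^ 2 = ρ ^ (2 : ℝ) * (L / (ρ * m)) ^ (2 * β / (2 * β + 1)) := by
    rw [mul_pow, ← Real.rpow_natCast (y ^ β), hy, ← Real.rpow_mul (by positivity),
      ← Real.rpow_mul (by positivity)]
    push_cast
    rw [Real.rpow_two]
    congr 2
    ring
  rw [e1, e2, Real.mul_rpow hρ.le (by positivity), ← mul_assoc, ← Real.rpow_add hρ]
  congr 2
  field_simp
  ring

/-- The definition of the bandwidth scale solved for `L`: it equates the entry variance `ρ L / (m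
y)` with the squared bias `(ρ y^β)²`. -/
theorem sparse_log_eq (hβ : 0 < β) (hρ : 0 < ρ) (hL : 0 < L) (hm : 0 < m)
    (hy : y = (L / (ρ * m)) ^ (1 / (2 * β + 1))) : L = ρ * m * y * (y ^ β) ^ 2 := by
  have hy0 : 0 < y := by rw [hy]; positivity
  have h1 : y * (y ^ β) ^ 2 = y ^ (2 * β + 1) := by
    rw [← Real.rpow_natCast, ← Real.rpow_mul hy0.le, mul_comm, Real.rpow_add_one hy0.ne']
    push_cast
    rw [mul_comm β 2]
  have h2 : y ^ (2 * β + 1) = L / (ρ * m) := by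
    rw [hy, rpow_one_div_rpow (by positivity), div_self (by positivity), Real.rpow_one]
  rw [mul_assoc, h1, h2]
  field_simp

end SparseRegime

section DenseRegime

variable {β ρ L n m y κ : ℝ}

/-- Rewriting in terms of `y^β` leaves a pure power of `ρ`; two choices of `r` give the target rate
`ρ² y^β` and the scale `ρ y^β` of the second bandwidth. -/
theorem dense_rescale_eq (hρ : 0 < ρ) (hL : 0 < L) (hn : 0 < n) (hm : 0 < m)
    (hy : y = (L / (ρ ^ 2 * n * m)) ^ (1 / (2 * β + 1))) (r : ℝ) :
    ρ ^ r * (L / (n * m)) ^ (β / (2 * β + 1)) = ρ ^ (r + 2 * β / (2 * β + 1)) * y ^ β := by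
  have e1 : L / (n * m) = ρ ^ (2 : ℝ) * (L / (ρ ^ 2 * n * m)) := by
    rw [Real.rpow_two]; field_simp
  rw [hy, rpow_one_div_rpow (by positivity), e1, Real.mul_rpow (by positivity) (by positivity),
    ← mul_assoc, ← Real.rpow_mul hρ.le, ← Real.rpow_add hρ]
  congr 3
  ring

theorem dense_rate_eq (hβ : 0 < β) (hρ : 0 < ρ) (hL : 0 < L) (hn : 0 < n) (hm : 0 < m)
    (hy : y = (L / (ρ ^ 2 * n * m)) ^ (1 / (2 * β + 1))) :
    ρ ^ ((2 * β + 2) / (2 * β + 1)) * (L / (n * m)) ^ (β / (2 * β + 1)) = ρ ^ 2 * y ^ β := by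
  rw [dense_rescale_eq hρ hL hn hm hy, ← Real.rpow_two ρ]
  congr 2
  field_simp
  ring

theorem dense_neighborhood_eq (hβ : 0 < β) (hρ : 0 < ρ) (hL : 0 < L) (hn : 0 < n) (hm : 0 < m)
    (hy : y = (L / (ρ ^ 2 * n * m)) ^ (1 / (2 * β + 1))) :
    ρ ^ (1 / (2 * β + 1)) * (L / (n * m)) ^ (β / (2 * β + 1)) = ρ * y ^ β := by
  rw [dense_rescale_eq hρ hL hn hm hy]
  have : 1 / (2 * β + 1) + 2 * β / (2 * β + 1) = 1 := by field_simp; ring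
  rw [this, Real.rpow_one]

theorem dense_log_eq (hβ : 0 < β) (hρ : 0 < ρ) (hL : 0 < L) (hn : 0 < n) (hm : 0 < m)
    (hy : y = (L / (ρ ^ 2 * n * m)) ^ (1 / (2 * β + 1))) :
    L = ρ ^ 2 * n * m * y * (y ^ β) ^ 2 := by
  have h := sparse_log_eq (m := n * m) (y := y) hβ (sq_pos_of_pos hρ) hL (by positivity)
    (by rw [hy, mul_assoc])
  rw [mul_assoc (ρ ^ 2) n m]
  exact h

theorem log_le_of_dense (hL : 0 < L) (hn : 0 < n) (hm : 0 < m) (hκ : 0 < κ)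
    (hreg : κ * √(n * m ^ (β / (β + 1)) * L) ≤ n * ρ) :
    κ ^ 2 * (m ^ (β / (β + 1)) * L) ≤ n * ρ ^ 2 := by
  have h1 : (κ * √(n * m ^ (β / (β + 1)) * L)) ^ 2 ≤ (n * ρ) ^ 2 :=
    pow_le_pow_left₀ (by positivity) hreg 2
  rw [mul_pow, Real.sq_sqrt (by positivity)] at h1
  have h2 : n * (κ ^ 2 * (m ^ (β / (β + 1)) * L)) ≤ n * (n * ρ ^ 2) := by
    calc _ = κ ^ 2 * (n * m ^ (β / (β + 1)) * L) := by ring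
      _ ≤ (n * ρ) ^ 2 := h1
      _ = _ := by ring
  exact le_of_mul_le_mul_left h2 hn

/-- In the dense regime the temporal bandwidth is at most of order `m^{-1/(β+1)}`. -/
theorem dense_bandwidth_le (hβ : 0 < β) (hρ : 0 < ρ) (hL : 0 < L) (hn : 0 < n) (hm : 0 < m)
    (hκ : 0 < κ) (hreg : κ * √(n * m ^ (β / (β + 1)) * L) ≤ n * ρ)
    (hy : y = (L / (ρ ^ 2 * n * m)) ^ (1 / (2 * β + 1))) :
    y ≤ ((κ ^ 2)⁻¹) ^ (1 / (2 * β + 1)) * m ^ (-(1 / (β + 1))) := by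
  have h1 := log_le_of_dense hL hn hm hκ hreg
  have h2 : L / (ρ ^ 2 * n * m) ≤ (κ ^ 2)⁻¹ * (m ^ (-(1 / (β + 1)))) ^ (2 * β + 1) := by
    have e : (m ^ (-(1 / (β + 1)))) ^ (2 * β + 1) = (m ^ (β / (β + 1)) * m)⁻¹ := by
      rw [← Real.rpow_mul hm.le, ← Real.rpow_add_one hm.ne', ← Real.rpow_neg hm.le]
      congr 1
      field_simp
      ring
    rw [e, ← mul_inv, div_le_iff₀ (by positivity), inv_mul_eq_div, le_div_iff₀ (by positivity)]
    calc L * (κ ^ 2 * (m ^ (β / (β + 1)) * m)) = κ ^ 2 * (m ^ (β / (β + 1)) * L) * m := by ring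
      _ ≤ n * ρ ^ 2 * m := by gcongr
      _ = _ := by ring
  calc y = (L / (ρ ^ 2 * n * m)) ^ (1 / (2 * β + 1)) := hy
    _ ≤ ((κ ^ 2)⁻¹ * (m ^ (-(1 / (β + 1)))) ^ (2 * β + 1)) ^ (1 / (2 * β + 1)) :=
        Real.rpow_le_rpow (by positivity) h2 (by positivity)
    _ = _ := by
        rw [Real.mul_rpow (by positivity) (by positivity), ← Real.rpow_mul (by positivity)
          (2 * β + 1), mul_one_div_cancel (by positivity), Real.rpow_one]

end DenseRegime

/-- The deviation bounds for the noise, in terms of the target rate `u`. -/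
theorem noise_thresholds_le {n ρ s L S k p q u : ℝ} (hn : 0 < n) (hρ0 : 0 < ρ) (hρ1 : ρ ≤ 1)
    (hs0 : 0 < s) (hs2 : s ≤ 2) (hL : 1 ≤ L) (hS : 0 < S) (hk : 0 < k) (hp : 0 < p) (hq : 0 < q)
    (hu : 0 ≤ u) (hX : ρ ^ 2 * s * n * L ≤ p * u ^ 2) (hLq : L ≤ q * (ρ ^ 2 * n * s)) :
    n * (ρ * (k * s)) + (2 * √(n * (S ^ 2 * (ρ * (k * s))) * (4 * L)) + 2 * S ^ 2 * (4 * L)) ≤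
      n * ((2 * k + 12 * S ^ 2 * q) * (ρ * s)) ∧
    2 * √(n * (ρ * (k * s)) ^ 2 * (4 * L)) + 2 * S ^ 2 * (4 * L) + 2 * S ^ 2 ≤
      (2 * (8 * k ^ 2 * p + 1) + 2 * (4 * S ^ 2 * k * p + 1) + 10 * S ^ 2 * (q * p + 1)) * u ∧
    2 * √(n * ((ρ * S) ^ 2 * (ρ * (k * s))) * (4 * L)) + 2 * (S * (ρ * S)) * (4 * L) ≤
      (2 * (8 * k ^ 2 * p + 1) + 2 * (4 * S ^ 2 * k * p + 1) + 10 * S ^ 2 * (q * p + 1)) * u ∧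
    L ≤ (q * p + 1) * u := by
  have hL0 : 0 < L := by linarith
  -- Both hypotheses combine to `L² ≤ q ρ² n s L ≤ q p u²`.
  have hLu : L ≤ (q * p + 1) * u := by
    refine le_of_sq_le_mul_sq (by positivity) hu ?_
    calc L ^ 2 = L * L := sq L
      _ ≤ q * (ρ ^ 2 * n * s) * L := by gcongr
      _ = q * (ρ ^ 2 * s * n * L) := by ring
      _ ≤ q * (p * u ^ 2) := by gcongr
      _ = q * p * u ^ 2 := by ring
  have hρsq : ρ ^ 2 ≤ ρ := by nlinarith
  have hSL : S ^ 2 * L ≤ S ^ 2 * ((q * p + 1) * u) := by gcongr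
  have hS1 : S ^ 2 ≤ S ^ 2 * L := le_mul_of_one_le_right (by positivity) hL
  have h2 : √(n * (ρ * (k * s)) ^ 2 * (4 * L)) ≤ (8 * k ^ 2 * p + 1) * u := by
    refine sqrt_le_of_le_mul_sq (by positivity) (by positivity) hu ?_
    calc n * (ρ * (k * s)) ^ 2 * (4 * L) = 4 * k ^ 2 * s * (ρ ^ 2 * s * n * L) := by ring
      _ ≤ 4 * k ^ 2 * 2 * (ρ ^ 2 * s * n * L) := by gcongr
      _ ≤ 4 * k ^ 2 * 2 * (p * u ^ 2) := by gcongr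
      _ = 8 * k ^ 2 * p * u ^ 2 := by ring
  have h3 : √(n * ((ρ * S) ^ 2 * (ρ * (k * s))) * (4 * L)) ≤ (4 * S ^ 2 * k * p + 1) * u := by
    refine sqrt_le_of_le_mul_sq (by positivity) (by positivity) hu ?_
    calc n * ((ρ * S) ^ 2 * (ρ * (k * s))) * (4 * L)
        = 4 * S ^ 2 * k * ρ * (ρ ^ 2 * s * n * L) := by ring
      _ ≤ 4 * S ^ 2 * k * 1 * (p * u ^ 2) := by gcongr
      _ = 4 * S ^ 2 * k * p * u ^ 2 := by ring
  have h2' : 0 ≤ (8 * k ^ 2 * p + 1) * u := by positivity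
  have h3' : 0 ≤ (4 * S ^ 2 * k * p + 1) * u := by positivity
  refine ⟨?_, ?_, ?_, hLu⟩
  -- Arithmetic–geometric mean inequality for `n ρ k s` and `4 S² L`, whose product is under the
  -- root.
  · have h1 : 2 * √(n * (S ^ 2 * (ρ * (k * s))) * (4 * L)) ≤
        n * (ρ * (k * s)) + S ^ 2 * (4 * L) := by
      have h0 : 0 ≤ n * (ρ * (k * s)) + S ^ 2 * (4 * L) := by positivity
      have : √(n * (S ^ 2 * (ρ * (k * s))) * (4 * L)) ≤
          (n * (ρ * (k * s)) + S ^ 2 * (4 * L)) / 2 := by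
        rw [Real.sqrt_le_left (by positivity)]
        nlinarith [sq_nonneg (n * (ρ * (k * s)) - S ^ 2 * (4 * L))]
      linarith
    have h4 : L ≤ q * (ρ * n * s) := hLq.trans (by gcongr)
    have h5 : S ^ 2 * L ≤ S ^ 2 * (q * (ρ * n * s)) := by gcongr
    nlinarith
  · nlinarith
  · have h4 : S * (ρ * S) * L ≤ S ^ 2 * L := by
      have : S * (ρ * S) ≤ S ^ 2 := by nlinarith [mul_pos hS hS]
      gcongr
    have h5 : 0 ≤ S ^ 2 * ((q * p + 1) * u) := by positivity
    nlinarith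

/-! ### The two regimes -/

theorem add_sq_le_of_sq_le {d e x y : ℝ} (hd : d ^ 2 ≤ x) (he : e ^ 2 ≤ y) :
    (d + e) ^ 2 ≤ 2 * y + 2 * x := by
  nlinarith [sq_nonneg (d - e)]

/-- The variance part of the deviation squares to order `ρ s L ≤ (ρ Y)² / c`. The linear part
squares to order `(s L)²`, which carries an extra factor `Y²`; the a priori bound `Z` on `Y` absorbs
it. -/
theorem sq_entry_threshold_le {ρ k s L W c Y Z : ℝ} (hρ : 0 < ρ) (hk : 0 < k) (hs : 0 < s)
    (hL : 0 < L) (hc : 0 < c) (hY : 0 < Y) (hYZ : Y ≤ Z) (hsL : s * L ≤ ρ * Y ^ 2 / c) :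
    (2 * √(ρ * (k * s) * (4 * L)) + 2 * (W * s) * (4 * L)) ^ 2 ≤
      (32 * k / c + 128 * W ^ 2 * Z ^ 2 / c ^ 2) * (ρ * Y) ^ 2 := by
  have h1 : √(ρ * (k * s) * (4 * L)) ^ 2 = ρ * (k * s) * (4 * L) :=
    Real.sq_sqrt (by positivity)
  have h3 : ρ * (s * L) ≤ (ρ * Y) ^ 2 / c := by
    calc ρ * (s * L) ≤ ρ * (ρ * Y ^ 2 / c) := by gcongr
      _ = _ := by ring
  have h4 : (s * L) ^ 2 ≤ Z ^ 2 / c ^ 2 * (ρ * Y) ^ 2 := by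
    calc (s * L) ^ 2 ≤ (ρ * Y ^ 2 / c) ^ 2 := by gcongr
      _ = Y ^ 2 / c ^ 2 * (ρ * Y) ^ 2 := by ring
      _ ≤ _ := by gcongr
  calc (2 * √(ρ * (k * s) * (4 * L)) + 2 * (W * s) * (4 * L)) ^ 2
      ≤ 2 * (2 * √(ρ * (k * s) * (4 * L))) ^ 2 + 2 * (2 * (W * s) * (4 * L)) ^ 2 := by
        nlinarith [sq_nonneg (2 * √(ρ * (k * s) * (4 * L)) - 2 * (W * s) * (4 * L))]
    _ = 32 * k * (ρ * (s * L)) + 128 * W ^ 2 * (s * L) ^ 2 := by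
        rw [mul_pow, h1]; ring
    _ ≤ 32 * k * ((ρ * Y) ^ 2 / c) + 128 * W ^ 2 * (Z ^ 2 / c ^ 2 * (ρ * Y) ^ 2) := by
        gcongr
    _ = _ := by ring

set_option maxHeartbeats 1000000 in
/-- The sparse regime: the first-stage estimator is not averaged over nodes. -/
theorem exists_sparse_regime_bound
    (f : ℝ → ℝ → ℝ → ℝ) (hf : IsTimeVaryingGraphon f)
    (β L₁ : ℝ) (hβ : 0 < β) (hL₁ : 0 < L₁) (hHolder : HolderInTime f β L₁)
    (K : ℝ → ℝ) (Kmax : ℝ) (hK : LPKernel K Kmax)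
    (lam₀ a₀ : ℝ) (hlam₀ : 0 < lam₀) (ha₀ : 0 < a₀)
    (c₁ c₂ : ℝ) (hc₁ : 0 < c₁) (hc₂ : 0 < c₂) :
    ∃ C > (0 : ℝ), ∀ n m : ℕ, 3 ≤ n → 3 ≤ m → ∀ ρ ∈ Set.Ioo (0 : ℝ) 1,
      ∀ τ : Fin m → ℝ, (∀ k, τ k ∈ Set.Icc (0 : ℝ) 1) → LPDesign τ a₀ →
      ∀ h₁ h₂ : ℝ, LPEigen ⌊β⌋₊ K τ h₁ lam₀ →
      ∀ (Ω : Type*) [MeasurableSpace Ω] (μ : Measure Ω) [IsProbabilityMeasure μ]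
        (ξ : Fin n → Ω → ℝ) (A : Fin m → Fin n → Fin n → Ω → Bool),
        IsSparseGraphonNetwork μ f ρ τ ξ A → ∀ t ∈ Set.Icc (0 : ℝ) 1,
        Comparable c₁ c₂ h₁ ((Real.log (n * m) / (ρ * m)) ^ (1 / (2 * β + 1))) →
        h₂ ≤ 1 / n →
        μ {ω | twoStage ⌊β⌋₊ K τ h₁ h₂ t (fun k i j => A k i j ω)
                = firstStage ⌊β⌋₊ K τ h₁ t (fun k i j => A k i j ω) ∧
              1 / (n : ℝ) *
                norm2Inf (twoStage ⌊β⌋₊ K τ h₁ h₂ t (fun k i j => A k i j ω)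
                  - probMatrix f ρ (fun i => ξ i ω) t) ^ 2
              ≤ C * ρ ^ ((2 * β + 2) / (2 * β + 1)) *
                (Real.log (n * m) / m) ^ (2 * β / (2 * β + 1))}ᶜ ≤
          ENNReal.ofReal (2 * ((n : ℝ) * m)⁻¹) := by
  have hK0 := hK.nonneg
  obtain ⟨W, hW⟩ : ∃ W : ℝ, W = (⌊β⌋₊ + 1) / lam₀ * Kmax + 1 := ⟨_, rfl⟩
  have hW0 : 0 < W := by rw [hW]; positivity
  obtain ⟨S, hS⟩ : ∃ S : ℝ, S = 2 * a₀ * W := ⟨_, rfl⟩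
  have hS0 : 0 < S := by rw [hS]; positivity
  obtain ⟨k, hk⟩ : ∃ k : ℝ, k = 2 * a₀ * W ^ 2 := ⟨_, rfl⟩
  have hk0 : 0 < k := by rw [hk]; positivity
  -- The eigenvalue condition caps `h₁`, so `y ≤ h₁ / c₁ ≤ Kmax / lam₀ / c₁` uniformly in `n`, `m`
  -- and `ρ`.
  obtain ⟨Ymax, hYmax⟩ : ∃ Ymax : ℝ, Ymax = (Kmax / lam₀ / c₁) ^ β := ⟨_, rfl⟩
  have hYmax0 : 0 ≤ Ymax := by rw [hYmax]; positivity
  obtain ⟨b, hb⟩ : ∃ b : ℝ, b = S * L₁ * c₂ ^ β := ⟨_, rfl⟩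
  have hb0 : 0 < b := by rw [hb]; positivity
  refine ⟨2 * (32 * k / c₁ + 128 * W ^ 2 * Ymax ^ 2 / c₁ ^ 2) + 2 * b ^ 2, by positivity, ?_⟩
  intro n m hn3 hm3 ρ hρ τ hτ hdes h₁ h₂ hspec Ω _ μ _ ξ A hN t ht hh₁ hh₂
  have hρ0 := hρ.1
  have hρI : ρ ∈ Set.Icc (0 : ℝ) 1 := ⟨hρ.1.le, hρ.2.le⟩
  have hn3' : (3 : ℝ) ≤ n := by exact_mod_cast hn3
  have hm3' : (3 : ℝ) ≤ m := by exact_mod_cast hm3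
  have hn0 : (0 : ℝ) < n := by linarith
  have hm0 : (0 : ℝ) < m := by linarith
  have hnm : 3 ≤ (n : ℝ) * m := hn3'.trans (le_mul_of_one_le_right hn0.le (by linarith))
  generalize hL : Real.log (n * m) = L at *
  have hL1 : 1 ≤ L := hL ▸ one_le_log_of_three_le hnm
  have hL0 : 0 < L := by linarith
  generalize hy' : (L / (ρ * m)) ^ (1 / (2 * β + 1)) = y at *
  have hy := hy'.symm
  have hy0 : 0 < y := by rw [hy]; positivity
  have hh0 : 0 < h₁ := lt_of_lt_of_le (by positivity) hh₁.1
  obtain ⟨Y, hY⟩ : ∃ Y : ℝ, Y = y ^ β := ⟨_, rfl⟩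
  have hY0 : 0 < Y := by rw [hY]; positivity
  have hYle : Y ≤ Ymax := by
    rw [hY, hYmax]
    refine Real.rpow_le_rpow hy0.le ?_ hβ.le
    rw [le_div_iff₀ hc₁, mul_comm]
    exact hh₁.1.trans (bandwidth_le (by omega) hh0 hlam₀ hK (hspec t ht))
  have hLeq : L = ρ * m * y * Y ^ 2 := hY ▸ sparse_log_eq hβ hρ0 hL0 hm0 hy
  have hrate := sparse_rate_eq hβ hρ0 hL0 hm0 hy
  rw [← hY] at hrate
  obtain ⟨s, hs⟩ : ∃ s : ℝ, s = 1 / ((m : ℝ) * h₁) := ⟨_, rfl⟩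
  have hs0 : 0 < s := by rw [hs]; positivity
  have hsL : s * L ≤ ρ * Y ^ 2 / c₁ := by
    rw [hs, div_mul_eq_mul_div, one_mul, div_le_div_iff₀ (by positivity) hc₁]
    calc L * c₁ = ρ * Y ^ 2 * (m * (c₁ * y)) := by rw [hLeq]; ring
      _ ≤ ρ * Y ^ 2 * (m * h₁) := by gcongr; exact hh₁.1
  obtain ⟨hw1, hw2, hw3⟩ := lpWeight_bounds (W := W) (ℓ := ⌊β⌋₊) (by omega) hτ hdes ha₀ hh0 hlam₀ hK
    hspec ht (by rw [hW]; linarith)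
  rw [← hS] at hw2
  rw [← hk, ← hs] at hw3
  rw [← hs] at hw1
  have hprob := measure_not_forall_abs_noise_lt_le hf hρI τ (lpWeight ⌊β⌋₊ K τ h₁ t) hτ hN
    (W := W * s) (by positivity) hw1 hw3 (B := 4 * L) (by positivity)
  have hcube := hN.ae_mem_Icc
  have hexp := sq_mul_exp_neg_four_log_le (by linarith) (by linarith) hnm
  rw [hL] at hexp
  refine le_trans (measure_mono_ae ?_) (hprob.trans (ENNReal.ofReal_le_ofReal ?_))
  swap
  · have : 0 < (n : ℝ) ^ 2 * Real.exp (-(4 * L)) := by positivity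
    linarith
  filter_upwards [hcube] with ω hω hcon
  change ¬ _
  intro hgood
  refine hcon ?_
  have hQ : twoStage ⌊β⌋₊ K τ h₁ h₂ t (fun k i j => A k i j ω)
      = firstStage ⌊β⌋₊ K τ h₁ t (fun k i j => A k i j ω) := by
    refine neighborhoodSmooth_eq_self _ ?_
    calc h₂ * n ≤ 1 / n * n := by gcongr
      _ = 1 := by field_simp
  refine ⟨hQ, ?_⟩
  rw [hQ, mul_assoc, hrate]
  refine mul_norm2Inf_sq_le (by omega) (by positivity) fun i => ?_
  obtain ⟨T, hT⟩ : ∃ T : ℝ, T = 2 * √(ρ * (k * s) * (4 * L)) + 2 * (W * s) * (4 * L) := ⟨_, rfl⟩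
  rw [← hT] at hgood
  have hTsq : T ^ 2 ≤ (32 * k / c₁ + 128 * W ^ 2 * Ymax ^ 2 / c₁ ^ 2) * (ρ * Y) ^ 2 := by
    rw [hT]
    exact sq_entry_threshold_le hρ0 hk0 hs0 hL0 hc₁ hY0 hYle hsL
  have hhβ : h₁ ^ β ≤ c₂ ^ β * Y := by
    rw [hY, ← Real.mul_rpow hc₂.le hy0.le]
    exact Real.rpow_le_rpow hh0.le hh₁.2 hβ.le
  have hrow : ∀ j, (firstStage ⌊β⌋₊ K τ h₁ t (fun k i j => A k i j ω) i j
      - probMatrix f ρ (fun i => ξ i ω) t i j) ^ 2 ≤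
      (2 * (32 * k / c₁ + 128 * W ^ 2 * Ymax ^ 2 / c₁ ^ 2) + 2 * b ^ 2) * (ρ * Y) ^ 2 := by
    intro j
    rw [firstStage_eq_mean_add_noise hf hρI τ (fun k i j => hN.symm_adj k i j ω) fun i => ξ i ω]
    have h1 := (hgood i j).le
    have h2 : |meanMatrix hf hρI τ (lpWeight ⌊β⌋₊ K τ h₁ t) (fun i => ξ i ω) i j -
        probMatrix f ρ (fun i => ξ i ω) t i j| ≤ b * (ρ * Y) := by
      refine (abs_meanMatrix_sub_probMatrix_le hf hρI τ hβ hL₁ hHolder hτ hh0 hlam₀ hK hspec ht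
        hw2 hω i j).trans ?_
      calc S * L₁ * (ρ * h₁ ^ β) ≤ S * L₁ * (ρ * (c₂ ^ β * Y)) := by gcongr
        _ = b * (ρ * Y) := by rw [hb]; ring
    have h3 := sq_le_sq' (abs_le.1 h1).1 (abs_le.1 h1).2
    have h4 := sq_le_sq' (abs_le.1 h2).1 (abs_le.1 h2).2
    rw [add_sub_right_comm]
    refine (add_sq_le_of_sq_le h4 (h3.trans hTsq)).trans (le_of_eq ?_)
    ring
  refine (Finset.sum_le_sum fun j _ => hrow j).trans ?_
  simp

/-- In the dense regime `y = O(m^{-1/(β+1)})`, so a large `m` alone makes `y^β` small, whatever `n`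
and `ρ` are. -/
theorem eventually_rpow_bandwidth_le {β δ b B : ℝ} (hβ : 0 < β) (hδ : 0 < δ) :
    ∀ᶠ m : ℕ in Filter.atTop, B * (b * (m : ℝ) ^ (-(1 / (β + 1)))) ^ β ≤ δ := by
  have h1 : Filter.Tendsto (fun m : ℕ => (m : ℝ) ^ (-(1 / (β + 1)))) Filter.atTop (nhds 0) :=
    (tendsto_rpow_neg_atTop (by positivity)).comp tendsto_natCast_atTop_atTop
  have h2 := ((h1.const_mul b).rpow_const (p := β) (Or.inr hβ.le)).const_mul B
  rw [mul_zero, Real.zero_rpow hβ.ne', mul_zero] at h2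
  exact h2.eventually_le_const hδ

/-- Up to constants, `ρ² n L / (m h)` bounds the squared fluctuations of the inner products of noise
rows with one another and with mean rows. The choice of bandwidth makes it at most the square of `n`
times the target rate. -/
theorem dense_variance_le {ρ L n m y Y h c : ℝ} (hm : 0 < m)
    (hh : 0 < h) (hc : 0 < c) (hch : c * y ≤ h)
    (hL : L = ρ ^ 2 * n * m * y * Y ^ 2) :
    ρ ^ 2 * (1 / (m * h)) * n * L ≤ 1 / c * (n * (ρ ^ 2 * Y)) ^ 2 := by
  have h1 : 1 / (m * h) * (m * y) ≤ 1 / c := by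
    rw [div_mul_eq_mul_div, one_mul, div_le_div_iff₀ (by positivity) hc, one_mul]
    calc m * y * c = m * (c * y) := by ring
      _ ≤ m * h := by gcongr
  calc ρ ^ 2 * (1 / (m * h)) * n * L = 1 / (m * h) * (m * y) * (n * (ρ ^ 2 * Y)) ^ 2 := by
        rw [hL]; ring
    _ ≤ 1 / c * (n * (ρ ^ 2 * Y)) ^ 2 := by gcongr

/-- This is where density of the network makes Bernstein's logarithmic terms harmless: `m h` is
`O(m^{β/(β+1)})`, and `L m^{β/(β+1)}` is `O(n ρ²)`. -/
theorem dense_log_le {β κ ρ L n m h c b : ℝ} (hβ : 0 < β) (hL : 0 < L) (hm : 0 < m)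
    (hκ : 0 < κ) (hh : 0 < h) (hc : 0 < c) (hb : 0 < b) (hch : h ≤ c * (b * m ^ (-(1 / (β + 1)))))
    (hreg : κ ^ 2 * (m ^ (β / (β + 1)) * L) ≤ n * ρ ^ 2) :
    L ≤ c * b / κ ^ 2 * (ρ ^ 2 * n * (1 / (m * h))) := by
  have e : m * m ^ (-(1 / (β + 1))) = m ^ (β / (β + 1)) := by
    rw [mul_comm, ← Real.rpow_add_one hm.ne']
    congr 1
    field_simp
    ring
  have h1 : m * h ≤ c * b * m ^ (β / (β + 1)) := by
    calc m * h ≤ m * (c * (b * m ^ (-(1 / (β + 1))))) := by gcongr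
      _ = c * b * (m * m ^ (-(1 / (β + 1)))) := by ring
      _ = _ := by rw [e]
  have h2 : L * (m * h) ≤ c * b / κ ^ 2 * (n * ρ ^ 2) := by
    calc L * (m * h) ≤ L * (c * b * m ^ (β / (β + 1))) := by gcongr
      _ = c * b / κ ^ 2 * (κ ^ 2 * (m ^ (β / (β + 1)) * L)) := by field_simp
      _ ≤ c * b / κ ^ 2 * (n * ρ ^ 2) := by gcongr
  calc L = L * (m * h) * (1 / (m * h)) := by field_simp
    _ ≤ c * b / κ ^ 2 * (n * ρ ^ 2) * (1 / (m * h)) := by gcongr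
    _ = _ := by ring

/-- The noise level `v ρ s` is divided by the number `h n` of averaged rows. Since `L ≥ 1`, `hX`
gives `ρ² s ≤ p n R²`, and `h ≥ c R / ρ` turns this into order `R`. -/
theorem average_variance_le {ρ n s L h c R v p : ℝ} (hρ : 0 < ρ) (hn : 0 < n) (hs : 0 < s)
    (hL : 1 ≤ L) (hh : 0 < h) (hc : 0 < c) (hR : 0 < R) (hv : 0 < v)
    (hX : ρ ^ 2 * s * n * L ≤ p * (n * R) ^ 2) (hcR : c * R ≤ ρ * h) :
    v * (ρ * s) / (h * n) ≤ v * p / c * R := by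
  rw [div_le_iff₀ (by positivity)]
  have h2 : ρ ^ 2 * s ≤ p * n * R ^ 2 := by
    have h3 : n * (ρ ^ 2 * s) ≤ n * (p * n * R ^ 2) := by
      calc n * (ρ ^ 2 * s) = ρ ^ 2 * s * n * 1 := by ring
        _ ≤ ρ ^ 2 * s * n * L := by gcongr
        _ ≤ p * (n * R) ^ 2 := hX
        _ = _ := by ring
    exact le_of_mul_le_mul_left h3 hn
  have hp : 0 ≤ p := by
    by_contra hcon
    have h5 : 0 < ρ ^ 2 * s := by positivity
    have h6 : p * (n * R ^ 2) < 0 := mul_neg_of_neg_of_pos (not_le.1 hcon) (by positivity)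
    linarith
  have h4 : ρ * (v * (ρ * s)) ≤ ρ * (v * p / c * R * (h * n)) := by
    calc ρ * (v * (ρ * s)) = v * (ρ ^ 2 * s) := by ring
      _ ≤ v * (p * n * R ^ 2) := by gcongr
      _ = v * p / c * R * n * (c * R) := by field_simp
      _ ≤ v * p / c * R * n * (ρ * h) := by gcongr
      _ = _ := by ring
  exact le_of_mul_le_mul_left h4 hρ

/-- A number of equal pieces, for the cells of a partition, that makes the pieces short and well
populated. -/
theorem exists_number_of_pieces {n L δ Y c a B : ℝ} {J : ℕ} {x : ℕ → ℝ} (hn : 0 < n) (hL : 1 ≤ L)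
    (hδ : 0 < δ) (hY : 0 < Y) (hc : 0 < c) (ha : 0 < a) (hB : B = 256 * (a + 1) + 2 * c + 1)
    (hLY : L ≤ (a + 1) * (n * Y)) (hBδ : B * Y ≤ δ) (hx0 : x 0 = 0) (hxJ : x J = 1)
    (hgap : ∀ s < J, δ < x (s + 1) - x s) :
    ∃ M : ℕ, 0 < M ∧ 1 / (M : ℝ) ≤ 2 * B / δ * Y ∧
      256 * L + 2 * (c * (n * Y)) ≤ n * (δ / M) ∧ (J : ℝ) * M ≤ n := by
  have hB0 : 0 < B := by rw [hB]; positivity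
  have hnY : 0 < n * Y := by positivity
  -- Pieces of width of order `Y` are obtained from `M = ⌊δ / (B Y)⌋`. As `B Y ≤ δ`, the floor is
  -- positive and loses at most a factor two.
  have hM1 : 1 ≤ δ / (B * Y) := by rw [le_div_iff₀ (by positivity), one_mul]; exact hBδ
  have hMle : (⌊δ / (B * Y)⌋₊ : ℝ) ≤ δ / (B * Y) := Nat.floor_le (by positivity)
  have hMlt := Nat.lt_floor_add_one (δ / (B * Y))
  have hMpos : 0 < ⌊δ / (B * Y)⌋₊ := Nat.floor_pos.2 hM1
  generalize ⌊δ / (B * Y)⌋₊ = M at *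
  have hMpos' : (1 : ℝ) ≤ M := by exact_mod_cast hMpos
  have hM0 : (0 : ℝ) < M := by linarith
  have hδM : B * Y ≤ δ / M := by
    rw [le_div_iff₀ hM0]
    rw [le_div_iff₀ (by positivity)] at hMle
    linarith
  have hBnY : 256 * L + 2 * (c * (n * Y)) ≤ n * (B * Y) := by
    have e : n * (B * Y) = 256 * ((a + 1) * (n * Y)) + 2 * (c * (n * Y)) + n * Y := by
      rw [hB]; ring
    rw [e]
    linarith
  refine ⟨M, hMpos, ?_, hBnY.trans (by gcongr), ?_⟩
  · have hMge : δ / (B * Y) ≤ 2 * M := by linarith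
    rw [div_mul_eq_mul_div, div_le_div_iff₀ hM0 hδ]
    rw [div_le_iff₀ (by positivity)] at hMge
    linarith
  -- The `J` gaps exceed `δ` and add up to one.
  · have hJδ : (J : ℝ) * δ ≤ 1 := by
      have h1 : ∀ r ≤ J, (r : ℝ) * δ ≤ x r := by
        intro r
        induction r with
        | zero => intro _; simp [hx0]
        | succ r ih =>
          intro hr
          have := ih (by omega)
          have := hgap r (by omega)
          push_cast
          linarith
      have := h1 J le_rfl
      rwa [hxJ] at this
    have h2 : 1 ≤ n * (B * Y) := by
      have : 0 < c * (n * Y) := by positivity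
      linarith
    calc (J : ℝ) * M ≤ J * (δ / (B * Y)) := by gcongr
      _ = J * δ / (B * Y) := by ring
      _ ≤ 1 / (B * Y) := by gcongr
      _ ≤ n := by rw [div_le_iff₀ (by positivity)]; exact h2

set_option maxHeartbeats 2000000 in
/-- The dense regime: neighborhood smoothing improves the first-stage estimator. -/
theorem exists_dense_regime_bound
    (f : ℝ → ℝ → ℝ → ℝ) (hf : IsTimeVaryingGraphon f)
    (β L₁ L₂ : ℝ) (hβ : 0 < β) (hL₁ : 0 < L₁)
    (hHolder : HolderInTime f β L₁) (hLip : PiecewiseLipschitz f L₂)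
    (K : ℝ → ℝ) (Kmax : ℝ) (hK : LPKernel K Kmax)
    (lam₀ a₀ : ℝ) (hlam₀ : 0 < lam₀) (ha₀ : 0 < a₀)
    (κ c₁ c₂ : ℝ) (hκ : 0 < κ) (hc₁ : 0 < c₁) (hc₂ : 0 < c₂) :
    ∃ C > (0 : ℝ), ∃ N₀ : ℕ, ∀ n m : ℕ, 3 ≤ n → 3 ≤ m → N₀ ≤ m → ∀ ρ ∈ Set.Ioo (0 : ℝ) 1,
      ∀ τ : Fin m → ℝ, (∀ k, τ k ∈ Set.Icc (0 : ℝ) 1) → LPDesign τ a₀ →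
      ∀ h₁ h₂ : ℝ, LPEigen ⌊β⌋₊ K τ h₁ lam₀ →
      ∀ (Ω : Type*) [MeasurableSpace Ω] (μ : Measure Ω) [IsProbabilityMeasure μ]
        (ξ : Fin n → Ω → ℝ) (A : Fin m → Fin n → Fin n → Ω → Bool),
        IsSparseGraphonNetwork μ f ρ τ ξ A → ∀ t ∈ Set.Icc (0 : ℝ) 1,
        κ * √(n * (m : ℝ) ^ (β / (β + 1)) * Real.log (n * m)) ≤ n * ρ →
        Comparable c₁ c₂ h₁ ((Real.log (n * m) / (ρ ^ 2 * n * m)) ^ (1 / (2 * β + 1))) →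
        Comparable c₁ c₂ h₂
          (ρ ^ (1 / (2 * β + 1)) * (Real.log (n * m) / (n * m)) ^ (β / (2 * β + 1))) →
        μ {ω | 1 / (n : ℝ) *
                norm2Inf (twoStage ⌊β⌋₊ K τ h₁ h₂ t (fun k i j => A k i j ω)
                  - probMatrix f ρ (fun i => ξ i ω) t) ^ 2
              ≤ C * ρ ^ ((2 * β + 2) / (2 * β + 1)) *
                (Real.log (n * m) / (n * m)) ^ (β / (2 * β + 1))}ᶜ ≤
          ENNReal.ofReal (2 * ((n : ℝ) * m)⁻¹) := by
  have hK0 := hK.nonneg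
  obtain ⟨δ, hδ, J, hJ, x, hx0, hxJ, hgap, hcell⟩ := hLip
  -- The added one keeps `W` positive even when `Kmax = 0`.
  obtain ⟨W, hW⟩ : ∃ W : ℝ, W = (⌊β⌋₊ + 1) / lam₀ * Kmax + 1 := ⟨_, rfl⟩
  have hW0 : 0 < W := by rw [hW]; positivity
  obtain ⟨S, hS⟩ : ∃ S : ℝ, S = 2 * a₀ * W := ⟨_, rfl⟩
  have hS0 : 0 < S := by rw [hS]; positivity
  obtain ⟨k, hk⟩ : ∃ k : ℝ, k = 2 * a₀ * W ^ 2 := ⟨_, rfl⟩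
  have hk0 : 0 < k := by rw [hk]; positivity
  obtain ⟨b₀, hb₀⟩ : ∃ b₀ : ℝ, b₀ = ((κ ^ 2)⁻¹) ^ (1 / (2 * β + 1)) := ⟨_, rfl⟩
  have hb₀0 : 0 < b₀ := by rw [hb₀]; positivity
  obtain ⟨p, hp⟩ : ∃ p : ℝ, p = 1 / c₁ := ⟨_, rfl⟩
  have hp0 : 0 < p := by rw [hp]; positivity
  obtain ⟨q, hq⟩ : ∃ q : ℝ, q = c₂ * b₀ / κ ^ 2 := ⟨_, rfl⟩
  have hq0 : 0 < q := by rw [hq]; positivity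
  obtain ⟨v, hv⟩ : ∃ v : ℝ, v = 2 * k + 12 * S ^ 2 * q := ⟨_, rfl⟩
  have hv0 : 0 < v := by rw [hv]; positivity
  obtain ⟨d, hd⟩ : ∃ d : ℝ, d = 2 * (8 * k ^ 2 * p + 1) + 2 * (4 * S ^ 2 * k * p + 1) + 10 * S ^ 2 * (q * p + 1) := ⟨_, rfl⟩
  have hd0 : 0 < d := by rw [hd]; positivity
  -- `256 = 64 · 4` meets the occupation condition at level `4L`; `2 c₂` makes half of `n δ / M` at
  -- least `h₂ n`.
  obtain ⟨B, hB⟩ : ∃ B : ℝ, B = 256 * (q * p + 1) + 2 * c₂ + 1 := ⟨_, rfl⟩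
  have hB0 : 0 < B := by rw [hB]; positivity
  obtain ⟨b, hb⟩ : ∃ b : ℝ, b = S * L₁ * c₂ ^ β := ⟨_, rfl⟩
  have hb0 : 0 < b := by rw [hb]; positivity
  -- The absolute value appears because no sign is assumed for `L₂`; `2 B / δ` converts the piece
  -- length `1/M` into `Y`.
  obtain ⟨g, hg⟩ : ∃ g : ℝ, g = |L₂| * (2 * B / δ) := ⟨_, rfl⟩
  have hg0 : 0 ≤ g := by rw [hg]; positivity
  -- In the minimum, `δ` allows the subdivision of cells and `1` gives `Y ≤ 1`.
  obtain ⟨N₀, hN₀⟩ := Filter.eventually_atTop.1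
    (eventually_rpow_bandwidth_le (β := β) (δ := min δ 1) (b := b₀) (B := B) hβ (by positivity))
  refine ⟨2 * (v * p / c₁ + d) + 4 * b ^ 2 + 4 * (8 * (b * (S + 1) + 3 * d) + 6 * g),
    by positivity, N₀, ?_⟩
  intro n m hn3 hm3 hmN ρ hρ τ hτ hdes h₁ h₂ hspec Ω _ μ _ ξ A hN t ht hreg hh₁ hh₂
  have hρ0 := hρ.1
  have hρI : ρ ∈ Set.Icc (0 : ℝ) 1 := ⟨hρ.1.le, hρ.2.le⟩
  have hn3' : (3 : ℝ) ≤ n := by exact_mod_cast hn3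
  have hm3' : (3 : ℝ) ≤ m := by exact_mod_cast hm3
  have hn0 : (0 : ℝ) < n := by linarith
  have hm0 : (0 : ℝ) < m := by linarith
  have hnm : 3 ≤ (n : ℝ) * m := hn3'.trans (le_mul_of_one_le_right hn0.le (by linarith))
  generalize hL : Real.log (n * m) = L at *
  have hL1 : 1 ≤ L := hL ▸ one_le_log_of_three_le hnm
  have hL0 : 0 < L := by linarith
  generalize hy' : (L / (ρ ^ 2 * n * m)) ^ (1 / (2 * β + 1)) = y at *
  have hy := hy'.symm
  have hy0 : 0 < y := by rw [hy]; positivity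
  have hh0 : 0 < h₁ := lt_of_lt_of_le (by positivity) hh₁.1
  obtain ⟨Y, hY⟩ : ∃ Y : ℝ, Y = y ^ β := ⟨_, rfl⟩
  have hY0 : 0 < Y := by rw [hY]; positivity
  obtain ⟨R, hR⟩ : ∃ R : ℝ, R = ρ ^ 2 * Y := ⟨_, rfl⟩
  have hR0 : 0 < R := by rw [hR]; positivity
  rw [dense_neighborhood_eq hβ hρ0 hL0 hn0 hm0 hy, ← hY] at hh₂
  have hrate := dense_rate_eq hβ hρ0 hL0 hn0 hm0 hy
  rw [← hY, ← hR] at hrate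
  have hLeq : L = ρ ^ 2 * n * m * y * Y ^ 2 := hY ▸ dense_log_eq hβ hρ0 hL0 hn0 hm0 hy
  have hyle := dense_bandwidth_le hβ hρ0 hL0 hn0 hm0 hκ hreg hy
  rw [← hb₀] at hyle
  have hregime := log_le_of_dense hL0 hn0 hm0 hκ hreg
  have hBY : B * Y ≤ min δ 1 := by
    refine le_trans (mul_le_mul_of_nonneg_left ?_ hB0.le) (hN₀ m hmN)
    rw [hY]
    exact Real.rpow_le_rpow hy0.le hyle hβ.le
  have hBδ : B * Y ≤ δ := hBY.trans (min_le_left _ _)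
  have hY1 : Y ≤ 1 := by
    have h1 : B * Y ≤ 1 := hBY.trans (min_le_right _ _)
    have h2 : 1 ≤ B := by
      have : 0 < 256 * (q * p + 1) + 2 * c₂ := by positivity
      rw [hB]
      linarith
    exact (le_mul_of_one_le_left hY0.le h2).trans h1
  obtain ⟨s, hs⟩ : ∃ s : ℝ, s = 1 / ((m : ℝ) * h₁) := ⟨_, rfl⟩
  have hs0 : 0 < s := by rw [hs]; positivity
  have hs2 : s ≤ 2 := by
    rw [hs, div_le_iff₀ (by positivity)]
    exact one_le_two_mul_mul_bandwidth hh0 hlam₀ hK hspec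
  have hX : ρ ^ 2 * s * n * L ≤ p * (n * R) ^ 2 := by
    rw [hs, hp, hR]
    exact dense_variance_le hm0 hh0 hc₁ hh₁.1 hLeq
  have hLq : L ≤ q * (ρ ^ 2 * n * s) := by
    rw [hs, hq]
    exact dense_log_le hβ hL0 hm0 hκ hh0 hc₂ hb₀0 (hh₁.2.trans (by gcongr)) hregime
  obtain ⟨hT₁, hT₂, hT₃, hLu⟩ := noise_thresholds_le (u := n * R) hn0 hρ0 hρ.2.le hs0 hs2 hL1 hS0
    hk0 hp0 hq0 (by positivity) hX hLq
  rw [← hv] at hT₁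
  rw [← hd] at hT₂ hT₃
  have hnY : L ≤ (q * p + 1) * (n * Y) := by
    refine hLu.trans ?_
    have : R ≤ Y := by
      rw [hR]
      exact mul_le_of_le_one_left hY0.le (pow_le_one₀ hρ0.le hρ.2.le)
    gcongr
  obtain ⟨M, hMpos, hMinv, hnδ, hJM⟩ := exists_number_of_pieces hn0 hL1 hδ hY0 hc₂
    (mul_pos hq0 hp0) hB hnY hBδ hx0 hxJ hgap
  have hc₂nY : 0 ≤ c₂ * (n * Y) := by positivity
  have hnear := measure_not_forall_exists_near_le hN.measurable_latent hN.indep_latent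
    hN.uniform_latent hδ hx0 hxJ hgap hMpos (A := 4 * L) (by positivity) (by linarith)
  obtain ⟨-, hw2, hw3⟩ := lpWeight_bounds (W := W) (ℓ := ⌊β⌋₊) (by omega) hτ hdes ha₀ hh0 hlam₀ hK
    hspec ht (by rw [hW]; linarith)
  rw [← hS] at hw2
  rw [← hk, ← hs] at hw3
  have hnoise := measure_not_isNoiseBounded_le hf hρI τ (lpWeight ⌊β⌋₊ K τ h₁ t) hτ hN hρ0 hS0
    hw2 hw3 (B := 4 * L) (by positivity)
  have hexp := sq_mul_exp_neg_four_log_le (by linarith) (by linarith) hnm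
  rw [hL] at hexp
  -- The number of pieces is at most `n ≤ n²`, so the two failure probabilities total at most `6 n²
  -- exp(-4L)`.
  have hfail : 5 * (n : ℝ) ^ 2 * Real.exp (-(4 * L)) + J * M * Real.exp (-(4 * L)) ≤
      2 * ((n : ℝ) * m)⁻¹ := by
    refine le_trans ?_ hexp
    have h1 : (J : ℝ) * M ≤ n ^ 2 := hJM.trans (le_self_pow₀ (by linarith) two_ne_zero)
    have h2 := mul_le_mul_of_nonneg_right h1 (Real.exp_pos (-(4 * L))).le
    linarith
  refine le_trans ?_ (ENNReal.ofReal_le_ofReal hfail)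
  rw [ENNReal.ofReal_add (by positivity) (by positivity)]
  refine le_trans ?_ (add_le_add hnoise hnear)
  refine (measure_mono ?_).trans (measure_union_le _ _)
  intro ω hω
  by_contra hcon
  rw [Set.mem_union, not_or] at hcon
  simp only [Set.mem_ofPred_eq, not_not] at hcon
  obtain ⟨hbdd, hIco, hG⟩ := hcon
  refine hω ?_
  have hIcc : ∀ i, ξ i ω ∈ Set.Icc (0 : ℝ) 1 := fun i => ⟨(hIco i).1, (hIco i).2.le⟩
  simp only [Set.mem_ofPred_eq]
  rw [mul_assoc, hrate]
  refine mul_norm2Inf_sq_le (by omega) (by positivity) fun i => ?_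
  have hh₂0 : 0 < h₂ := lt_of_lt_of_le (by positivity) hh₂.1
  have hhβ : h₁ ^ β ≤ c₂ ^ β * Y := by
    rw [hY, ← Real.mul_rpow hc₂.le hy0.le]
    exact Real.rpow_le_rpow hh0.le hh₁.2 hβ.le
  have hPρ : ∀ i j, |probMatrix f ρ (fun i => ξ i ω) t i j| ≤ ρ := fun i j => by
    have := hf.mem_Icc _ (hIcc i) _ (hIcc j) t ht
    simp only [probMatrix, Matrix.of_apply]
    rw [abs_of_nonneg (mul_nonneg hρ0.le this.1)]
    exact mul_le_of_le_one_right hρ0.le this.2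
  -- The temporal bias `b ρ Y` and the oscillation `ρ g Y` between nearby nodes become of order `R =
  -- ρ² Y` when multiplied by the entry size `ρ`, the same order as the inner-product error `d R`.
  have hsmooth := sum_sq_neighborhoodSmooth_sub_le (h := h₂)
    (Q := firstStage ⌊β⌋₊ K τ h₁ t (fun k i j => A k i j ω))
    (P := probMatrix f ρ (fun i => ξ i ω) t)
    (firstStage_eq_mean_add_noise hf hρI τ (fun k i j => hN.symm_adj k i j ω) fun i => ξ i ω)
    (ρ := ρ) (c := ρ * S) (b := b * (ρ * Y)) (D := d * R) (V := v * (ρ * s)) (η := ρ * (g * Y))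
    hPρ (abs_meanMatrix_le hf hρI τ _ hw2 _)
    (fun i j => by
      refine (abs_meanMatrix_sub_probMatrix_le hf hρI τ hβ hL₁ hHolder hτ hh0 hlam₀ hK hspec ht
        hw2 hIcc i j).trans ?_
      calc S * L₁ * (ρ * h₁ ^ β) ≤ S * L₁ * (ρ * (c₂ ^ β * Y)) := by gcongr
        _ = b * (ρ * Y) := by rw [hb]; ring)
    (by positivity) (by positivity) (by positivity)
    (fun i => (hbdd.row i).le.trans hT₁)
    (fun i l hil => (hbdd.cross i l hil).le.trans (hT₂.trans (le_of_eq (by ring))))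
    (fun i l => (hbdd.mix i l).le.trans (hT₃.trans (le_of_eq (by ring))))
    (by
      intro i
      obtain ⟨r, hr, G, hGcard, hi, hGl⟩ := hG i
      refine ⟨G, ?_, ?_, fun l hl j => ?_⟩
      · have : (3 : ℝ) ≤ G.card := by linarith
        exact_mod_cast this
      · have h1 : h₂ * n ≤ c₂ * (n * Y) := by
          calc h₂ * n ≤ c₂ * (ρ * Y) * n := by gcongr; exact hh₂.2
            _ ≤ c₂ * (1 * Y) * n := by gcongr; exact hρ.2.le
            _ = _ := by ring
        linarith
      · obtain ⟨hl1, hl2⟩ := hGl l hl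
        -- The column position `ξ j` is held fixed in its own cell; only the row position moves,
        -- inside the cell shared by `i` and `l`.
        obtain ⟨r', hr', hj⟩ := exists_subcell hx0 hxJ (hIco j)
        have h1 := (hcell r hr r' hr' t ht (ξ i ω) hi (ξ l ω) hl1 (ξ i ω) hi (ξ j ω) hj
          (ξ j ω) hj (ξ j ω) hj).1
        simp only [probMatrix, Matrix.of_apply]
        rw [← mul_sub, abs_mul, abs_of_pos hρ0]
        refine mul_le_mul_of_nonneg_left ?_ hρ0.le
        calc |f (ξ l ω) (ξ j ω) t - f (ξ i ω) (ξ j ω) t| ≤ L₂ * |ξ l ω - ξ i ω| := h1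
          _ ≤ |L₂| * (2 * B / δ * Y) :=
              mul_le_mul (le_abs_self _) (hl2.trans hMinv) (abs_nonneg _) (abs_nonneg _)
          _ = g * Y := by rw [hg]; ring) i
  refine hsmooth.trans ?_
  refine mul_le_mul_of_nonneg_left ?_ hn0.le
  have hVR : v * (ρ * s) / (h₂ * n) ≤ v * p / c₁ * R :=
    average_variance_le hρ0 hn0 hs0 hL1 hh₂0 hc₁ hR0 hv0 hX (by
      calc c₁ * R = ρ * (c₁ * (ρ * Y)) := by rw [hR]; ring
        _ ≤ ρ * h₂ := by gcongr; exact hh₂.1)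
  have hbR : (b * (ρ * Y)) ^ 2 ≤ b ^ 2 * R := by
    calc (b * (ρ * Y)) ^ 2 = b ^ 2 * R * Y := by rw [hR]; ring
      _ ≤ b ^ 2 * R * 1 := by gcongr
      _ = _ := mul_one _
  have hbS : b * (ρ * Y) * (ρ * S + ρ) = b * (S + 1) * R := by rw [hR]; ring
  have hgR : ρ * (ρ * (g * Y)) = g * R := by rw [hR]; ring
  rw [hbS, hgR]
  linarith

end

/-! ### Assembly of the two regimes -/

theorem theorem1
    (f : ℝ → ℝ → ℝ → ℝ) (hf : IsTimeVaryingGraphon f)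
    (β L₁ L₂ : ℝ) (hβ : 0 < β) (hL₁ : 0 < L₁)
    (hHolder : HolderInTime f β L₁) (hLip : PiecewiseLipschitz f L₂)
    (K : ℝ → ℝ) (Kmax : ℝ) (hK : LPKernel K Kmax)
    (lam₀ a₀ : ℝ) (hlam₀ : 0 < lam₀) (ha₀ : 0 < a₀)
    (κ c₁ c₂ : ℝ) (hκ : 0 < κ) (hc₁ : 0 < c₁) (hc₂ : 0 < c₂) :
    ∃ C > (0 : ℝ), ∃ C' > (0 : ℝ), ∃ γ > (0 : ℝ), ∃ N₀ : ℕ,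
      ∀ n m : ℕ, N₀ ≤ n → N₀ ≤ m →
      ∀ ρ ∈ Set.Ioo (0 : ℝ) 1, √(Real.log (n * m) / (n * m)) ≤ ρ →
      ∀ τ : Fin m → ℝ, (∀ k, τ k ∈ Set.Icc (0 : ℝ) 1) → LPDesign τ a₀ →
      ∀ h₁ h₂ : ℝ, LPEigen ⌊β⌋₊ K τ h₁ lam₀ →
      ∀ (Ω : Type*) [MeasurableSpace Ω] (μ : Measure Ω) [IsProbabilityMeasure μ]
        (ξ : Fin n → Ω → ℝ) (A : Fin m → Fin n → Fin n → Ω → Bool),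
        IsSparseGraphonNetwork μ f ρ τ ξ A →
      ∀ t ∈ Set.Icc (0 : ℝ) 1,
        (κ * √(n * (m : ℝ) ^ (β / (β + 1)) * Real.log (n * m)) ≤ n * ρ →
          Comparable c₁ c₂ h₁ ((Real.log (n * m) / (ρ ^ 2 * n * m)) ^ (1 / (2 * β + 1))) →
          Comparable c₁ c₂ h₂
            (ρ ^ (1 / (2 * β + 1)) * (Real.log (n * m) / (n * m)) ^ (β / (2 * β + 1))) →
          ENNReal.ofReal (1 - 2 * ((n : ℝ) * m) ^ (-(C' + γ))) ≤
            μ {ω | 1 / (n : ℝ) *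
                norm2Inf (twoStage ⌊β⌋₊ K τ h₁ h₂ t (fun k i j => A k i j ω)
                  - probMatrix f ρ (fun i => ξ i ω) t) ^ 2
              ≤ C * ρ ^ ((2 * β + 2) / (2 * β + 1)) *
                (Real.log (n * m) / (n * m)) ^ (β / (2 * β + 1))}) ∧
        (n * ρ ≤ κ * √(n * (m : ℝ) ^ (β / (β + 1)) * Real.log (n * m)) →
          Comparable c₁ c₂ h₁ ((Real.log (n * m) / (ρ * m)) ^ (1 / (2 * β + 1))) →
          0 < h₂ → h₂ ≤ 1 / n →
          ENNReal.ofReal (1 - 2 * ((n : ℝ) * m) ^ (-(C' + γ))) ≤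
            μ {ω | twoStage ⌊β⌋₊ K τ h₁ h₂ t (fun k i j => A k i j ω)
                = firstStage ⌊β⌋₊ K τ h₁ t (fun k i j => A k i j ω) ∧
              1 / (n : ℝ) *
                norm2Inf (twoStage ⌊β⌋₊ K τ h₁ h₂ t (fun k i j => A k i j ω)
                  - probMatrix f ρ (fun i => ξ i ω) t) ^ 2
              ≤ C * ρ ^ ((2 * β + 2) / (2 * β + 1)) *
                (Real.log (n * m) / m) ^ (2 * β / (2 * β + 1))}) := by
  obtain ⟨Ca, hCa, N₀, ha⟩ := exists_dense_regime_bound f hf β L₁ L₂ hβ hL₁ hHolder hLip K Kmax hK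
    lam₀ a₀ hlam₀ ha₀ κ c₁ c₂ hκ hc₁ hc₂
  obtain ⟨Cb, hCb, hb⟩ := exists_sparse_regime_bound f hf β L₁ hβ hL₁ hHolder K Kmax hK lam₀ a₀
    hlam₀ ha₀ c₁ c₂ hc₁ hc₂
  -- Only the sum of the two exponents matters: it is one, matching the failure probability
  -- `2/(nm)`.
  refine ⟨max Ca Cb, lt_max_of_lt_left hCa, 1 / 2, by norm_num, 1 / 2, by norm_num, max 3 N₀, ?_⟩
  intro n m hn hm ρ hρ _ τ hτ hdes h₁ h₂ hspec Ω _ μ _ ξ A hN t ht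
  have hn3 : 3 ≤ n := (le_max_left _ _).trans hn
  have hm3 : 3 ≤ m := (le_max_left _ _).trans hm
  have hmN : N₀ ≤ m := (le_max_right _ _).trans hm
  have hexp : ((n : ℝ) * m) ^ (-(1 / 2 + 1 / 2 : ℝ)) = ((n : ℝ) * m)⁻¹ := by
    norm_num [Real.rpow_neg_one]
  have hlog : 0 ≤ Real.log (n * m) := by
    have h1 : (1 : ℝ) ≤ n := by exact_mod_cast (by omega : 1 ≤ n)
    have h2 : (1 : ℝ) ≤ m := by exact_mod_cast (by omega : 1 ≤ m)
    exact Real.log_nonneg (by nlinarith)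
  have hρ0 := hρ.1.le
  rw [hexp]
  constructor
  · intro hreg hh₁ hh₂
    refine (ofReal_one_sub_le_measure (by positivity) (ha n m hn3 hm3 hmN ρ hρ τ hτ hdes h₁ h₂
      hspec Ω μ ξ A hN t ht hreg hh₁ hh₂)).trans (measure_mono fun ω hω => ?_)
    refine le_trans (Set.mem_ofPred_eq ▸ hω :) ?_
    gcongr
    exact le_max_left _ _
  · intro _ hh₁ _ hh₂
    refine (ofReal_one_sub_le_measure (by positivity) (hb n m hn3 hm3 ρ hρ τ hτ hdes h₁ h₂
      hspec Ω μ ξ A hN t ht hh₁ hh₂)).trans (measure_mono fun ω hω => ⟨hω.1, le_trans hω.2 ?_⟩)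
    gcongr
    exact le_max_right _ _
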